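/- **Setting.** Let $q\in\mathbb C^{*}$ and let $N,L\ge 1$ be integers. Indices $i$ are taken modulo $N$ and sites $n$ modulo $2L$. Let $A_q(N)$ be the $\mathbb C$-algebra generated by invertible elements $a_i,b_i$ ($1\le i\le N$) with relations $a_{i+1}b_i=q\,b_ia_{i+1}$, $a_ib_i=q^{-1}b_ia_i$, all other pairs of generators commuting. Let $A_q(N,L)=A_q(N)^{\otimes 2L}$, with generators $a_i(n),b_i(n)$, $1\le n\le 2L$, and put $$L_n^+(z)=\sum_{i}e_{i,i}\,a_i(n)+\sum_{i<N}e_{i,i+1}\,b_i(n)+z^{-2}e_{N,1}\,b_N(n),\qquad L_n^-(z)=\sum_{i}e_{i,i}\,a_i(n)^{-1}+\sum_{i<N}e_{i+1,i}\,b_i(n)+z^{2}e_{1,N}\,b_N(n).$$ *Gauge invariance.* $A_q^{inv}(N,L)$ is the subalgebra of elements fixed by all automorphisms $a_i(n)\mapsto \alpha_i(n)\alpha_i(n-1)^{-1}a_i(n)$, $b_i(n)\mapsto\alpha_i(n)\alpha_{i+1}(n-1)^{-1}b_i(n)$ for $n$ odd, $b_i(n)\mapsto\alpha_{i+1}(n-1)\alpha_i(n)^{-1}b_i(n)$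 for $n$ even, with $\alpha_i(n)\in\mathbb C^{*}$. *Fusion.* For $1\le l\le N-1$ let $V(\omega_l)\subset(\mathbb C^N)^{\otimes l}$ be the space of $q$-antisymmetric tensors, with basis $v_J=\sum_{\sigma\in S_l}(-q)^{\mathrm{inv}(\sigma)}e_{J(\sigma(1))}\otimes\cdots\otimes e_{J(\sigma(l))}$ for $1\le J(1)<\dots<J(l)\le N$. Let $L_n^{\omega_l,+}(z)$ and $L_n^{\omega_l,-}(z)$ be the restrictions to $V(\omega_l)$ of $$L^+_{n,(l)}(q^{l-1}z)\cdots L^+_{n,(2)}(qz)\,L^+_{n,(1)}(z)\qquad\text{and}\qquad L^-_{n,(1)}(z)\,L^-_{n,(2)}(qz)\cdots L^-_{n,(l)}(q^{l-1}z),$$ where the subscript $(k)$ refers to the $k$-th tensor factor. The transfer matrices are the formal Laurent series in $z$ with coefficients in $A_q(N,L)$ $$t_l(z)=\mathrm{tr}_{V(\omega_l)}\Big(L^{\omega_l,-}_{2L}(z)^{-1}L^{\omega_l,+}_{2L-1}(z)\cdots L^{\omega_l,-}_{2}(z)^{-1}L^{\omega_l,+}_{1}(z)\Big),\qquad l=1,\dots,N-1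 .$$ *Time evolution.* At time $t\in\mathbb Z$ the operator $L^+$ lives at the sites with $n+t$ odd and $L^-$ at those with $n+t$ even. So for odd $t$ the gauge action is the one above with "odd" and "even" exchanged, its invariants form $A_q^{inv}(N,L)_t$, and $t_l$ is the expression above with all sites shifted by one. For even $t$, $A_q^{inv}(N,L)_t=A_q^{inv}(N,L)$ and $t_l$ is as above. A discrete Toda evolution of the gauge invariant elements, with values in a $\mathbb C$-algebra $\mathcal A$, is a family of algebra homomorphisms $\Phi_t:A_q^{inv}(N,L)_t\to\mathcal A$, $t\in\mathbb Z$, of the following kind: in some algebra $\mathcal B\supseteq\mathcal A$ there are operators $a_i(n,t),b_i(n,t)$ which for each fixed $t$ satisfy the defining relations of $A_q(N,L)$, whose $L$-operators $L^\pm_{n,t}(z)$ satisfy the zero curvature equation $$L^-_{n,t+1}(z)\,L^+_{n,t}(z)=L^+_{n-1,t+1}(z)\,L^-_{n-1,t}(z)\qquad(n+t\ \text{odd}),$$ and such that $\Phi_t(x)$ is obtained from $x$ by substituting $a_i(n,t),b_i(n,t)$ for $a_i(n),b_i(n)$. **Proposition.** Let $1\le l,l'\le N-1$. 0. Fusion is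 well defined: the products above preserve $V(\omega_l)$, and $L_n^{\omega_l,-}(z)$ is invertible over the Laurent series in $z$. 1. The coefficients of $t_l(z)$ are gauge invariant, that is, they belong to $A_q^{inv}(N,L)$. 2. $[t_l(z),t_{l'}(z')]=0$, i.e. all coefficients of $t_l$ commute with all coefficients of $t_{l'}$. 3. The $t_l(z)$ are conserved: for every discrete Toda evolution $\Phi$ the series $\Phi_t(t_l(z))$ does not depend on $t\in\mathbb Z$. (Here 1 and 2 hold at every time $t$.) Moreover, if $N,L\ge 2$, the fields $\chi_i(n,t)=\Phi_t\big(a_i(n+1)b_i(n+1)b_i(n)a_{i+1}(n)^{-1}\big)$, $n+t$ odd, of such an evolution satisfy the discrete Toda equations $$q^{-2}\chi_i(n,t+1)\chi_i(n,t-1)\,\big(1-q^2\chi_i(n+1,t)\big)\big(1-q^2\chi_i(n-1,t)\big)=\chi_i(n+1,t)\chi_i(n-1,t)\,\big(1-\chi_{i-1}(n+1,t)\big)\big(1-\chi_{i+1}(n-1,t)\big)$$ for $n+t$ even. -/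

import Mathlib

namespace Toda

noncomputable section

/-! ### The algebra of observables

`q` is a nonzero complex number.  The index `i = 1, …, N` is modelled by `Fin N` (so `1, …, N`
becomes `0, …, N - 1`, and `i + 1` is cyclic); the site `n = 1, …, 2L` is modelled by
`ZMod (2 * L)`. -/

/-- Names for the generators `a_i(n)`, `a_i(n)⁻¹`, `b_i(n)`, `b_i(n)⁻¹`. -/
inductive Gen (N L : ℕ) : Type
  | a (i : Fin N) (n : ZMod (2 * L)) : Gen N L
  | aInv (i : Fin N) (n : ZMod (2 * L)) : Gen N L
  | b (i : Fin N) (n : ZMod (2 * L)) : Gen N L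
  | bInv (i : Fin N) (n : ZMod (2 * L)) : Gen N L

open FreeAlgebra in
/-- Defining relations of `A_q(N)^{⊗ 2L}`: at each site `a_{i+1} b_i = q b_i a_{i+1}` and
`a_i b_i = q⁻¹ b_i a_i`; all other pairs of generators commute. -/
inductive Rel (q : ℂˣ) (N L : ℕ) [NeZero N] :
    FreeAlgebra ℂ (Gen N L) → FreeAlgebra ℂ (Gen N L) → Prop
  | a_mul_aInv (i n) : Rel q N L (ι ℂ (.a i n) * ι ℂ (.aInv i n)) 1
  | aInv_mul_a (i n) : Rel q N L (ι ℂ (.aInv i n) * ι ℂ (.a i n)) 1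
  | b_mul_bInv (i n) : Rel q N L (ι ℂ (.b i n) * ι ℂ (.bInv i n)) 1
  | bInv_mul_b (i n) : Rel q N L (ι ℂ (.bInv i n) * ι ℂ (.b i n)) 1
  | a_a (i j n m) : Rel q N L (ι ℂ (.a i n) * ι ℂ (.a j m)) (ι ℂ (.a j m) * ι ℂ (.a i n))
  | b_b (i j n m) : Rel q N L (ι ℂ (.b i n) * ι ℂ (.b j m)) (ι ℂ (.b j m) * ι ℂ (.b i n))
  | a_b_succ (i n) : Rel q N L (ι ℂ (.a (i + 1) n) * ι ℂ (.b i n))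
      ((q : ℂ) • (ι ℂ (.b i n) * ι ℂ (.a (i + 1) n)))
  | a_b_same (i n) : Rel q N L (ι ℂ (.a i n) * ι ℂ (.b i n))
      (((q⁻¹ : ℂˣ) : ℂ) • (ι ℂ (.b i n) * ι ℂ (.a i n)))
  | a_b_other (i j n m) (h : n ≠ m ∨ (i ≠ j ∧ i ≠ j + 1)) :
      Rel q N L (ι ℂ (.a i n) * ι ℂ (.b j m)) (ι ℂ (.b j m) * ι ℂ (.a i n))

/-- The algebra `A_q(N, L) = A_q(N)^{⊗ 2L}`. -/
abbrev Aq (q : ℂˣ) (N L : ℕ) [NeZero N] : Type := RingQuot (Rel q N L)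

variable (q : ℂˣ) (N L : ℕ) [NeZero N]

/-- The image in `A_q(N, L)` of a generator. -/
def gen (g : Gen N L) : Aq q N L := RingQuot.mkAlgHom ℂ (Rel q N L) (FreeAlgebra.ι ℂ g)

theorem gen_rel {x y : FreeAlgebra ℂ (Gen N L)} (h : Rel q N L x y) :
    RingQuot.mkAlgHom ℂ (Rel q N L) x = RingQuot.mkAlgHom ℂ (Rel q N L) y :=
  RingQuot.mkAlgHom_rel ℂ h

/-- The invertible element `a_i(n)`. -/
def a (i : Fin N) (n : ZMod (2 * L)) : (Aq q N L)ˣ where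
  val := gen q N L (.a i n)
  inv := gen q N L (.aInv i n)
  val_inv := by simpa [gen] using gen_rel q N L (.a_mul_aInv i n)
  inv_val := by simpa [gen] using gen_rel q N L (.aInv_mul_a i n)

/-- The invertible element `b_i(n)`. -/
def b (i : Fin N) (n : ZMod (2 * L)) : (Aq q N L)ˣ where
  val := gen q N L (.b i n)
  inv := gen q N L (.bInv i n)
  val_inv := by simpa [gen] using gen_rel q N L (.b_mul_bInv i n)
  inv_val := by simpa [gen] using gen_rel q N L (.bInv_mul_b i n)

/-! ### Gauge transformations -/

/-- The factor by which the generators are rescaled, when `a_i(n)` is multiplied by `u i n` and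
`b_i(n)` by `v i n`. -/
def weight {N L : ℕ} (u v : Fin N → ZMod (2 * L) → ℂˣ) : Gen N L → ℂˣ
  | .a i n => u i n
  | .aInv i n => (u i n)⁻¹
  | .b i n => v i n
  | .bInv i n => (v i n)⁻¹

theorem rescale_aux (u v : Fin N → ZMod (2 * L) → ℂˣ) ⦃x y : FreeAlgebra ℂ (Gen N L)⦄
    (h : Rel q N L x y) :
    FreeAlgebra.lift ℂ (fun g => (weight u v g : ℂ) • gen q N L g) x =
      FreeAlgebra.lift ℂ (fun g => (weight u v g : ℂ) • gen q N L g) y := by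
  have key := gen_rel q N L h
  cases h <;>
    simp only [map_mul, map_smul, map_one, FreeAlgebra.lift_ι_apply, smul_mul_smul_comm] at key ⊢ <;>
    simp only [gen, key, weight, Units.val_inv_eq_inv_val, ne_eq, Units.ne_zero, not_false_eq_true,
      mul_inv_cancel₀, inv_mul_cancel₀, one_smul] <;>
    first
      | rw [smul_comm, mul_comm (v _ _ : ℂ)]
      | rw [mul_comm]

/-- The endomorphism `a_i(n) ↦ u_i(n) a_i(n)`, `b_i(n) ↦ v_i(n) b_i(n)` of `A_q(N, L)`. -/
def rescale (u v : Fin N → ZMod (2 * L) → ℂˣ) : Aq q N L →ₐ[ℂ] Aq q N L :=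
  RingQuot.liftAlgHom ℂ
    ⟨FreeAlgebra.lift ℂ fun g => (weight u v g : ℂ) • gen q N L g, rescale_aux q N L u v⟩

/-- The gauge transformation with parameters `α_i(n)` at time `t`.  It is induced by
`L⁺_n ↦ D_n L⁺_n D_{n-1}⁻¹` for `n + t` odd and `L⁻_n ↦ D_{n-1} L⁻_n D_n⁻¹` for `n + t` even, where
`D_n = diag (α_1(n), …, α_N(n))`. -/
def gauge (t : ℤ) (α : Fin N → ZMod (2 * L) → ℂˣ) : Aq q N L →ₐ[ℂ] Aq q N L :=
  rescale q N L (fun i n => α i n * (α i (n - 1))⁻¹)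
    (fun i n => if Odd ((n.val : ℤ) + t) then α i n * (α (i + 1) (n - 1))⁻¹
      else α (i + 1) (n - 1) * (α i n)⁻¹)

/-- The subalgebra of gauge invariant elements at time `t`; `A^inv_q(N, L)` is the case
`t = 0`. -/
def Ainv (t : ℤ) : Subalgebra ℂ (Aq q N L) where
  carrier := {x | ∀ α, gauge q N L t α x = x}
  mul_mem' hx hy α := by rw [map_mul, hx α, hy α]
  add_mem' hx hy α := by rw [map_add, hx α, hy α]
  algebraMap_mem' r α := by rw [AlgHom.commutes]

theorem rescale_gen (u v : Fin N → ZMod (2 * L) → ℂˣ) (g : Gen N L) :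
    rescale q N L u v (gen q N L g) = (weight u v g : ℂ) • gen q N L g := by
  simp [rescale, gen]

/-! ### L-operators -/

section LOperators

variable {N} {R : Type*} [Ring R] [Algebra ℂ R]

/-- `L⁺(c z) = ∑ e_{i,i} a_i + ∑_{i<N} e_{i,i+1} b_i + (c z)⁻² e_{N,1} b_N`, as a matrix of Laurent
series in the formal variable `z`. -/
def Lplus (a b : Fin N → Rˣ) (c : ℂˣ) : Matrix (Fin N) (Fin N) (LaurentSeries R) :=
  Matrix.of fun i j =>
    (if j = i then HahnSeries.single 0 (a i : R) else 0) +
    (if j = i + 1 then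
      (if i + 1 = 0 then HahnSeries.single (-2) (((c ^ (-2 : ℤ) : ℂˣ) : ℂ) • (b i : R))
        else HahnSeries.single 0 (b i : R)) else 0)

/-- `L⁻(c z) = ∑ e_{i,i} a_i⁻¹ + ∑_{i<N} e_{i+1,i} b_i + (c z)² e_{1,N} b_N`. -/
def Lminus (a b : Fin N → Rˣ) (c : ℂˣ) : Matrix (Fin N) (Fin N) (LaurentSeries R) :=
  Matrix.of fun i j =>
    (if i = j then HahnSeries.single 0 ((a j)⁻¹.val : R) else 0) +
    (if i = j + 1 then
      (if j + 1 = 0 then HahnSeries.single 2 (((c ^ (2 : ℤ) : ℂˣ) : ℂ) • (b j : R))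
        else HahnSeries.single 0 (b j : R)) else 0)

/-! ### Fusion -/

/-- The number of inversions of a permutation. -/
def inversions {l : ℕ} (σ : Equiv.Perm (Fin l)) : ℕ :=
  (Finset.univ.filter fun p : Fin l × Fin l => p.1 < p.2 ∧ σ p.2 < σ p.1).card

variable (N) in
/-- The columns of this matrix are the `q`-antisymmetric tensors
`v_J = ∑_σ (-q)^{inv σ} e_{J(σ 1)} ⊗ ⋯ ⊗ e_{J(σ l)}`, `J = {J(1) < ⋯ < J(l)}`, which form a basis of
the fundamental module `V(ω_l) ⊆ (ℂ^N)^{⊗ l}`. -/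
def qAntisym (l : ℕ) : Matrix (Fin l → Fin N) (Fin l ↪o Fin N) ℂ :=
  Matrix.of fun i J =>
    ∑ σ : Equiv.Perm (Fin l), if i = (fun k => J (σ k)) then (-(q : ℂ)) ^ inversions σ else 0

variable (N) (R) in
/-- `qAntisym` with entries regarded as constant Laurent series over `R`. -/
def qAntisymSeries (l : ℕ) : Matrix (Fin l → Fin N) (Fin l ↪o Fin N) (LaurentSeries R) :=
  (qAntisym q N l).map (algebraMap ℂ (LaurentSeries R))

/-- `L⁺_{(l)}(q^{l-1} z) ⋯ L⁺_{(2)}(q z) L⁺_{(1)}(z)` on `(ℂ^N)^{⊗ l}`, where `L⁺_{(k)}` acts in the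
`k`-th tensor factor. -/
def tensorPlus (l : ℕ) (a b : Fin N → Rˣ) :
    Matrix (Fin l → Fin N) (Fin l → Fin N) (LaurentSeries R) :=
  Matrix.of fun i j =>
    ((List.finRange l).reverse.map fun k : Fin l => Lplus a b (q ^ (k : ℕ)) (i k) (j k)).prod

/-- `L⁻_{(1)}(z) L⁻_{(2)}(q z) ⋯ L⁻_{(l)}(q^{l-1} z)` on `(ℂ^N)^{⊗ l}`, where `L⁻_{(k)}` acts in the
`k`-th tensor factor. -/
def tensorMinus (l : ℕ) (a b : Fin N → Rˣ) :
    Matrix (Fin l → Fin N) (Fin l → Fin N) (LaurentSeries R) :=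
  Matrix.of fun i j =>
    ((List.finRange l).map fun k : Fin l => Lminus a b (q ^ (k : ℕ)) (i k) (j k)).prod

/-- The fused operator `L^{ω_l,+}(z)`: the restriction of `tensorPlus` to `V(ω_l)`, in the basis
`v_J`.  As `v_I` is the only basis vector in which `e_{I(1)} ⊗ ⋯ ⊗ e_{I(l)}` occurs, and it occurs
there with coefficient `1`, the `(I, J)` entry is the coefficient of this tensor in the image of
`v_J`. -/
def fusedPlus (l : ℕ) (a b : Fin N → Rˣ) :
    Matrix (Fin l ↪o Fin N) (Fin l ↪o Fin N) (LaurentSeries R) :=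
  Matrix.of fun I J => (tensorPlus q l a b * qAntisymSeries q N R l) I J

/-- The fused operator `L^{ω_l,-}(z)`: the restriction of `tensorMinus` to `V(ω_l)`, in the basis
`v_J`. -/
def fusedMinus (l : ℕ) (a b : Fin N → Rˣ) :
    Matrix (Fin l ↪o Fin N) (Fin l ↪o Fin N) (LaurentSeries R) :=
  Matrix.of fun I J => (tensorMinus q l a b * qAntisymSeries q N R l) I J

end LOperators

/-! ### Transfer matrices -/

/-- The transfer matrix `t_l(z)` at time `t`, a Laurent series in `z` with coefficients in
`A_q(N, L)`.  For even `t` it is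
`tr_{V(ω_l)} ((L^{ω_l,-}_{2L})⁻¹ L^{ω_l,+}_{2L-1} ⋯ (L^{ω_l,-}_2)⁻¹ L^{ω_l,+}_1)`; for odd `t`, where
`L⁻` lives at the odd and `L⁺` at the even sites, all sites are shifted by one. -/
def transfer (l : ℕ) (t : ℤ) : LaurentSeries (Aq q N L) :=
  Matrix.trace <| List.prod <| (List.range L).reverse.map fun k : ℕ =>
    Ring.inverse (fusedMinus q l (fun i => a q N L i ((2 * (k : ℤ) + 2 + t % 2 : ℤ) : ZMod (2 * L)))
        (fun i => b q N L i ((2 * (k : ℤ) + 2 + t % 2 : ℤ) : ZMod (2 * L)))) *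
      fusedPlus q l (fun i => a q N L i ((2 * (k : ℤ) + 1 + t % 2 : ℤ) : ZMod (2 * L)))
        (fun i => b q N L i ((2 * (k : ℤ) + 1 + t % 2 : ℤ) : ZMod (2 * L)))

/-! ### Discrete time evolution -/

/-- The expression `a_i(n+1) b_i(n+1) b_i(n) a_{i+1}(n)⁻¹`.  For `n + t` odd, and with the generators
taken at time `t`, it is the Toda variable `χ_i(n, t)`. -/
def chi (i : Fin N) (n : ZMod (2 * L)) : Aq q N L :=
  ((a q N L i (n + 1) * b q N L i (n + 1) * b q N L i n * (a q N L (i + 1) n)⁻¹ : (Aq q N L)ˣ) :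
    Aq q N L)

theorem odd_val_add_one [NeZero L] (n : ZMod (2 * L)) (t : ℤ) (h : Odd ((n.val : ℤ) + t)) :
    ¬ Odd (((n + 1).val : ℤ) + t) := by
  have hL := NeZero.ne L
  have : Fact (1 < 2 * L) := ⟨by omega⟩
  rw [ZMod.val_add, ZMod.val_one]
  have h1 : (n.val + 1) % (2 * L) % 2 = (n.val + 1) % 2 :=
    Nat.mod_mod_of_dvd _ (Dvd.intro _ rfl)
  rw [Int.odd_iff] at h ⊢
  omega

theorem chi_mem [NeZero L] (i : Fin N) (n : ZMod (2 * L)) (t : ℤ) (h : Odd ((n.val : ℤ) + t)) :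
    chi q N L i n ∈ Ainv q N L t := by
  intro α
  have e : chi q N L i n = gen q N L (.a i (n + 1)) * gen q N L (.b i (n + 1)) *
      gen q N L (.b i n) * gen q N L (.aInv (i + 1) n) := rfl
  rw [e]
  simp only [gauge, map_mul, rescale_gen, smul_mul_smul_comm, weight, if_pos h,
    if_neg (odd_val_add_one L n t h), ← Units.val_mul, add_sub_cancel_right]
  convert one_smul ℂ _ using 2
  rw [Units.val_eq_one, mul_inv_rev, inv_inv]
  have h0 : ∀ x y z w : ℂˣ, x * y⁻¹ * (z * x⁻¹) * (y * w⁻¹) * (w * z⁻¹) = 1 := by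
    intro x y z w
    rw [← Units.val_eq_one]
    push_cast
    field_simp
  exact h0 _ _ _ _

section Evolution

universe u

variable {q N L} {A : Type u} [Ring A] [Algebra ℂ A]

/-- The zero curvature equation
`L⁻_{n,t+1}(z) L⁺_{n,t}(z) = L⁺_{n-1,t+1}(z) L⁻_{n-1,t}(z)`, `n + t` odd, for operators
`a_i(n, t)`, `b_i(n, t)` of an algebra `A` which at each fixed time `t` satisfy the defining
relations of `A_q(N, L)`.  Such operators are the images of the generators under algebra
homomorphisms `ρ t : A_q(N, L) → A`. -/
def ZeroCurvature (ρ : ℤ → (Aq q N L →ₐ[ℂ] A)) : Prop :=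
  let a' (t : ℤ) (n : ZMod (2 * L)) (i : Fin N) : Aˣ := Units.map (ρ t : Aq q N L →* A) (a q N L i n)
  let b' (t : ℤ) (n : ZMod (2 * L)) (i : Fin N) : Aˣ := Units.map (ρ t : Aq q N L →* A) (b q N L i n)
  ∀ (t : ℤ) (n : ZMod (2 * L)), Odd ((n.val : ℤ) + t) →
    Lminus (a' (t + 1) n) (b' (t + 1) n) 1 * Lplus (a' t n) (b' t n) 1 =
      Lplus (a' (t + 1) (n - 1)) (b' (t + 1) (n - 1)) 1 *
        Lminus (a' t (n - 1)) (b' t (n - 1)) 1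

/-- A discrete time evolution of the gauge invariant elements, with values in an algebra `A`
(a completion or a localization of `A^inv_q(N, L)`, say): `Φ t x` is the operator in `A` that the
gauge invariant expression `x` in the generators becomes at time `t`.  The evolution is given by
the zero curvature equation, for non gauge invariant operators which may need a larger algebra. -/
def IsEvolution (Φ : ∀ t : ℤ, Ainv q N L t →ₐ[ℂ] A) : Prop :=
  ∃ (B : Type u) (_ : Ring B) (_ : Algebra ℂ B) (j : A →ₐ[ℂ] B) (ρ : ℤ → (Aq q N L →ₐ[ℂ] B)),
    Function.Injective j ∧ ZeroCurvature ρ ∧ ∀ (t : ℤ) (x : Ainv q N L t), j (Φ t x) = ρ t x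

/-- The Toda field `χ_i(n, t)`; it is defined for `n + t` odd only. -/
def todaField [NeZero L] (Φ : ∀ t : ℤ, Ainv q N L t →ₐ[ℂ] A) (i : Fin N) (n : ZMod (2 * L))
    (t : ℤ) : A :=
  if h : Odd ((n.val : ℤ) + t) then Φ t ⟨chi q N L i n, chi_mem q N L i n t h⟩ else 0

/-- The discrete Toda field equations
`q⁻² χ_i(n, t+1) χ_i(n, t-1) = χ_i(n+1, t) χ_i(n-1, t) ·
(1 - χ_{i-1}(n+1, t)) / (1 - q² χ_i(n+1, t)) · (1 - χ_{i+1}(n-1, t)) / (1 - q² χ_i(n-1, t))`,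
multiplied from the right by the two (commuting) denominators. -/
def TodaEquation (χ : Fin N → ZMod (2 * L) → ℤ → A) (q : ℂˣ) : Prop :=
  ∀ (i : Fin N) (n : ZMod (2 * L)) (t : ℤ), Even ((n.val : ℤ) + t) →
    ((q ^ (-2 : ℤ) : ℂˣ) : ℂ) • (χ i n (t + 1) * χ i n (t - 1)) *
        ((1 - (q : ℂ) ^ 2 • χ i (n + 1) t) * (1 - (q : ℂ) ^ 2 • χ i (n - 1) t)) =
      χ i (n + 1) t * χ i (n - 1) t * ((1 - χ (i - 1) (n + 1) t) * (1 - χ (i + 1) (n - 1) t))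

end Evolution

end

end Toda

namespace Toda

noncomputable section

/-! ### Products of lists in a monoid -/

section ListProducts

variable {M κ κ' : Type*} [Monoid M]

/-! The engine is the exchange relation `R₁₂ L₁(z) L₂(w) = L₂(w) L₁(z) R₁₂` for the trigonometric
R-matrix, which depends only on Z = z² and W = w². Both `L⁺` and the transpose of `L⁻` are
bidiagonal with the spectral parameter only in the corner entry, so one computation,
`exchange_bidiagonal`, serves both. `L⁻` satisfies the opposite relation, hence its inverse
satisfies the same one as `L⁺`; the inverse exists because the constant term of `L⁻` in z is lower
triangular with invertible diagonal.

Fusion: at W = q²Z the R-matrix is a multiple of `rhat`, whose range is the tensors that are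
q-antisymmetric in two factors. Neighbouring factors of a fused product have parameters q^k z and
q^(k+1) z, exactly this ratio, so the exchange relation with `rhat` says that the product preserves
antisymmetry in these two factors. A tensor antisymmetric in all neighbouring pairs is a combination
of the `v_J` (`IsAntisym.eq_sum`), so the restriction to V(ω_l) is a matrix. Using `rhat`, and not R
itself, keeps the argument valid for q² = 1, where R vanishes at this point.

Commutativity: by the Yang–Baxter equation the product of the R-matrices between two families of
tensor factors preserves antisymmetry in each family. Its restriction is a fused R-matrix
(`exists_fusedR`), invertible by unitarity and with central entries. It exchanges fused operators at
each site; operators at different sites commute, so it exchanges whole monodromy matrices, and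
traces give the claim. The two parameters are made independent by working over ℂ((z))((w)), a field
in which the scalars that must be inverted are nonzero.

Gauge invariance: `L⁺_n` and `(L⁻_{n+1})⁻¹` are multiplied on the left and right by diagonal
matrices belonging to neighbouring sites. These cancel telescopically, and periodicity leaves a
conjugation by a scalar diagonal matrix.

Conservation: the zero curvature equation fuses factor by factor, using commutation at equal times
only. It rewrites `(L⁻_n)⁻¹ L⁺_{n-1}` at time t+1 as `L⁺_n (L⁻_{n-1})⁻¹` at time t, so the new
monodromy matrix is the old one with the factors regrouped. One operator moves from the left end to
the right end, which leaves the trace unchanged because the remaining factors live at other sites.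

Toda equations: the entries of the zero curvature equation express χ at time t+1 by operators at
time t and turn factors 1 - χ_i into 1 - χ_{i±1}. Splitting χ(n, t-1) into two halves, each
absorbing one denominator, leaves an identity of q-commuting monomials at time t. -/

theorem commute_list_map_prod {x : M} {y : κ → M} {ks : List κ} (h : ∀ k ∈ ks, Commute x (y k)) :
    Commute x (ks.map y).prod := by
  refine Commute.list_prod_right _ _ fun z hz => ?_
  obtain ⟨k, hk, rfl⟩ := List.mem_map.1 hz
  exact h k hk

/-- If each `r k` exchanges `x k` and `y`, then the product of the `r k` exchanges the product of
the `x k` and `y`. -/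
theorem exchange_prod_left {r x : κ → M} {y : M} {ks : List κ} (hks : ks.Nodup)
    (h : ∀ k, r k * x k * y = y * x k * r k) (hrx : ∀ k j, k ≠ j → Commute (r k) (x j)) :
    (ks.map r).prod * (ks.map x).prod * y = y * (ks.map x).prod * (ks.map r).prod := by
  induction ks with
  | nil => simp
  | cons k ks ih =>
    obtain ⟨hk, hks⟩ := List.nodup_cons.1 hks
    have h1 : Commute (x k) (ks.map r).prod := commute_list_map_prod fun j hj =>
      (hrx j k (by rintro rfl; exact hk hj)).symm
    have h2 : Commute (r k) (ks.map x).prod := commute_list_map_prod fun j hj =>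
      hrx k j (by rintro rfl; exact hk hj)
    simp only [List.map_cons, List.prod_cons]
    have ih := ih hks
    generalize (ks.map r).prod = ρ at *
    generalize (ks.map x).prod = X at *
    calc r k * ρ * (x k * X) * y = r k * (ρ * x k) * X * y := by simp only [mul_assoc]
      _ = r k * x k * (ρ * X * y) := by rw [← h1.eq]; simp only [mul_assoc]
      _ = (r k * x k * y) * X * ρ := by rw [ih]; simp only [mul_assoc]
      _ = y * x k * (r k * X) * ρ := by rw [h]; simp only [mul_assoc]
      _ = y * (x k * X) * (r k * ρ) := by rw [h2.eq]; simp only [mul_assoc]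

/-- The mirror image of `exchange_prod_left`: each factor `r k` now accompanies a factor `y k` and
joins the accumulated product on the right, whence the reversed order. -/
theorem exchange_prod_right {r y : κ → M} {x : M} {ks : List κ} (hks : ks.Nodup)
    (h : ∀ k, r k * x * y k = y k * x * r k) (hry : ∀ k j, k ≠ j → Commute (r k) (y j)) :
    (ks.reverse.map r).prod * x * (ks.map y).prod =
      (ks.map y).prod * x * (ks.reverse.map r).prod := by
  induction ks with
  | nil => simp
  | cons k ks ih =>
    obtain ⟨hk, hks⟩ := List.nodup_cons.1 hks
    have h1 : Commute (y k) (ks.reverse.map r).prod := commute_list_map_prod fun j hj =>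
      (hry j k (by rintro rfl; exact hk (by simpa using hj))).symm
    have h2 : Commute (r k) (ks.map y).prod := commute_list_map_prod fun j hj =>
      hry k j (by rintro rfl; exact hk hj)
    simp only [List.map_cons, List.prod_cons, List.reverse_cons, List.map_append, List.prod_append,
      List.map_nil, List.prod_nil, mul_one]
    have ih := ih hks
    generalize (ks.reverse.map r).prod = ρ at *
    generalize (ks.map y).prod = Y at *
    calc ρ * r k * x * (y k * Y) = ρ * (r k * x * y k) * Y := by simp only [mul_assoc]
      _ = ρ * y k * x * (r k * Y) := by rw [h]; simp only [mul_assoc]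
      _ = (ρ * y k) * x * (Y * r k) := by rw [h2.eq]
      _ = y k * (ρ * x * Y) * r k := by rw [← h1.eq]; simp only [mul_assoc]
      _ = y k * Y * x * (ρ * r k) := by rw [ih]; simp only [mul_assoc]

/-- Moving all `x k` past a single `y m` costs the inner product over `k`; moving them past the
successive `y m` stacks these inner products in reverse order. This is the combinatorial form of the
fusion of R-matrices. -/
theorem exchange_prod_prod {r : κ → κ' → M} {x : κ → M} {y : κ' → M} {ks : List κ} {ms : List κ'}
    (hks : ks.Nodup) (hms : ms.Nodup)
    (h : ∀ k m, r k m * x k * y m = y m * x k * r k m)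
    (hrx : ∀ k j m, k ≠ j → Commute (r k m) (x j)) (hry : ∀ k m j, m ≠ j → Commute (r k m) (y j)) :
    (ms.reverse.map fun m => (ks.map fun k => r k m).prod).prod * (ks.map x).prod * (ms.map y).prod =
      (ms.map y).prod * (ks.map x).prod *
        (ms.reverse.map fun m => (ks.map fun k => r k m).prod).prod :=
  exchange_prod_right hms
    (fun m => exchange_prod_left hks (fun k => h k m) fun k j hkj => hrx k j m hkj)
    fun m j hmj => (commute_list_map_prod fun k _ => (hry k m j hmj).symm).symm

/-- If `r` exchanges `x k` and `y k` for all `k`, then it exchanges their products. -/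
theorem exchange_prod {r : M} {x y : κ → M} {ks : List κ} (hks : ks.Nodup)
    (h : ∀ k, k ∈ ks → r * x k * y k = y k * x k * r)
    (hxy : ∀ k ∈ ks, ∀ j ∈ ks, k ≠ j → Commute (x k) (y j)) :
    r * (ks.map x).prod * (ks.map y).prod = (ks.map y).prod * (ks.map x).prod * r := by
  induction ks with
  | nil => simp
  | cons k ks ih =>
    obtain ⟨hk, hks⟩ := List.nodup_cons.1 hks
    have h1 : Commute (y k) (ks.map x).prod := commute_list_map_prod fun j hj =>
      (hxy j (by simp [hj]) k (by simp) (by rintro rfl; exact hk hj)).symm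
    have h2 : Commute (x k) (ks.map y).prod := commute_list_map_prod fun j hj =>
      hxy k (by simp) j (by simp [hj]) (by rintro rfl; exact hk hj)
    have h0 := h k (by simp)
    have ih := ih hks (fun j hj => h j (by simp [hj]))
      fun i hi j hj => hxy i (by simp [hi]) j (by simp [hj])
    simp only [List.map_cons, List.prod_cons]
    generalize (ks.map x).prod = X at *
    generalize (ks.map y).prod = Y at *
    calc r * (x k * X) * (y k * Y) = r * x k * (X * y k) * Y := by simp only [mul_assoc]
      _ = (r * x k * y k) * X * Y := by rw [← h1.eq]; simp only [mul_assoc]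
      _ = y k * x k * (r * X * Y) := by rw [h0]; simp only [mul_assoc]
      _ = y k * (x k * Y) * X * r := by rw [ih]; simp only [mul_assoc]
      _ = y k * Y * (x k * X) * r := by rw [h2.eq]; simp only [mul_assoc]

/-- If `x k * y k = y' k * x' k` and factors with different indices commute, then the corresponding
nested products agree. -/
theorem nested_prod {x y x' y' : κ → M} {ks : List κ} (hks : ks.Nodup)
    (h : ∀ k, x k * y k = y' k * x' k)
    (hxy : ∀ k j, k ≠ j → Commute (x k) (y' j)) (hyx : ∀ k j, k ≠ j → Commute (y k) (x' j)) :
    (ks.map x).prod * (ks.reverse.map y).prod = (ks.reverse.map y').prod * (ks.map x').prod := by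
  induction ks with
  | nil => simp
  | cons k ks ih =>
    obtain ⟨hk, hks⟩ := List.nodup_cons.1 hks
    have h1 : Commute (x k) (ks.reverse.map y').prod := commute_list_map_prod fun j hj =>
      hxy k j (by rintro rfl; exact hk (by simpa using hj))
    have h2 : Commute (y k) (ks.map x').prod := commute_list_map_prod fun j hj =>
      hyx k j (by rintro rfl; exact hk hj)
    have ih := ih hks
    have h0 := h k
    simp only [List.map_cons, List.prod_cons, List.reverse_cons, List.map_append, List.prod_append,
      List.map_nil, List.prod_nil, mul_one]
    generalize (ks.map x).prod = X at *
    generalize (ks.map x').prod = X' at *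
    generalize (ks.reverse.map y).prod = Y at *
    generalize (ks.reverse.map y').prod = Y' at *
    calc x k * X * (Y * y k) = x k * (X * Y) * y k := by simp only [mul_assoc]
      _ = (x k * Y') * (X' * y k) := by rw [ih]; simp only [mul_assoc]
      _ = Y' * (x k * y k) * X' := by rw [h1.eq, ← h2.eq]; simp only [mul_assoc]
      _ = Y' * y' k * (x' k * X') := by rw [h0]; simp only [mul_assoc]

/-- A product preserves the range of `P` if two adjacent factors do and the others commute
with `P`. -/
theorem prod_preserves {P : M} {x : κ → M} {A B : List κ} {k k' : κ}
    (h : P * (x k * x k') * P = x k * x k' * P)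
    (hA : ∀ j ∈ A, Commute P (x j)) (hB : ∀ j ∈ B, Commute P (x j)) :
    P * ((A ++ k :: k' :: B).map x).prod * P = ((A ++ k :: k' :: B).map x).prod * P := by
  have h1 := commute_list_map_prod hA
  have h2 := commute_list_map_prod hB
  simp only [List.map_append, List.prod_append, List.map_cons, List.prod_cons]
  generalize (A.map x).prod = a at *
  generalize (B.map x).prod = b at *
  calc P * (a * (x k * (x k' * b))) * P = (P * a) * x k * x k' * (b * P) := by simp only [mul_assoc]
    _ = a * (P * (x k * x k') * P) * b := by rw [h1.eq, ← h2.eq]; simp only [mul_assoc]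
    _ = a * (x k * x k') * (P * b) := by rw [h]; simp only [mul_assoc]
    _ = a * (x k * (x k' * b)) * P := by rw [h2.eq]; simp only [mul_assoc]

theorem finRange_eq_append {l k : ℕ} (hk : k + 1 < l) :
    ∃ A B : List (Fin l), List.finRange l = A ++ ⟨k, by omega⟩ :: ⟨k + 1, hk⟩ :: B ∧
      (∀ j ∈ A, j ≠ ⟨k, by omega⟩ ∧ j ≠ ⟨k + 1, hk⟩) ∧
      (∀ j ∈ B, j ≠ ⟨k, by omega⟩ ∧ j ≠ ⟨k + 1, hk⟩) := by
  have e : List.finRange l = (List.finRange l).take k ++ ⟨k, by omega⟩ :: ⟨k + 1, hk⟩ ::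
      (List.finRange l).drop (k + 2) := by
    conv_lhs => rw [← List.take_append_drop k (List.finRange l)]
    rw [List.drop_eq_getElem_cons (by simp; omega), List.drop_eq_getElem_cons (by simp; omega)]
    simp
  have nd := List.nodup_finRange l
  rw [e] at nd
  refine ⟨_, _, e, fun j hj => ?_, fun j hj => ?_⟩
  · have := (List.nodup_append.1 nd).2.2 j hj
    exact ⟨this _ (by simp), this _ (by simp)⟩
  · have h2 := (List.nodup_append.1 nd).2.1
    simp only [List.nodup_cons, List.mem_cons, not_or] at h2
    exact ⟨by rintro rfl; exact h2.1.2 hj, by rintro rfl; exact h2.2.1 hj⟩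

theorem prod_finRange_preserves {l k : ℕ} (hk : k + 1 < l) {P : M} {x : Fin l → M}
    (h : P * (x ⟨k, by omega⟩ * x ⟨k + 1, hk⟩) * P = x ⟨k, by omega⟩ * x ⟨k + 1, hk⟩ * P)
    (hP : ∀ j, j ≠ ⟨k, by omega⟩ → j ≠ ⟨k + 1, hk⟩ → Commute P (x j)) :
    P * ((List.finRange l).map x).prod * P = ((List.finRange l).map x).prod * P := by
  obtain ⟨A, B, e, hA, hB⟩ := finRange_eq_append hk
  rw [e]
  exact prod_preserves h (fun j hj => hP j (hA j hj).1 (hA j hj).2)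
    fun j hj => hP j (hB j hj).1 (hB j hj).2

theorem prod_finRange_reverse_preserves {l k : ℕ} (hk : k + 1 < l) {P : M} {x : Fin l → M}
    (h : P * (x ⟨k + 1, hk⟩ * x ⟨k, by omega⟩) * P = x ⟨k + 1, hk⟩ * x ⟨k, by omega⟩ * P)
    (hP : ∀ j, j ≠ ⟨k, by omega⟩ → j ≠ ⟨k + 1, hk⟩ → Commute P (x j)) :
    P * ((List.finRange l).reverse.map x).prod * P =
      ((List.finRange l).reverse.map x).prod * P := by
  obtain ⟨A, B, e, hA, hB⟩ := finRange_eq_append hk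
  have e' : (List.finRange l).reverse = B.reverse ++ ⟨k + 1, hk⟩ :: ⟨k, by omega⟩ :: A.reverse := by
    rw [e]; simp
  rw [e']
  exact prod_preserves h (fun j hj => hP j (hB j (by simpa using hj)).1 (hB j (by simpa using hj)).2)
    fun j hj => hP j (hA j (by simpa using hj)).1 (hA j (by simpa using hj)).2

/-- The hypotheses on `H` and `P` say that `R` and the idempotent `P` have the same range, while `X
* R = R * X'` shows that `X` maps the range of `R` into itself. -/
theorem preserves_of_exchange {P R H X X' : M} (hRH : R * H = P) (hPR : P * R = R)
    (h : X * R = R * X') : P * X * P = X * P := by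
  rw [← hRH, mul_assoc (R * H), ← mul_assoc X, h, hRH, ← mul_assoc, ← mul_assoc, hPR]

/-- Inverting both factors in an exchange relation. -/
theorem exchange_inv {R x y x' y' : M} (hx : x * x' = 1) (hx' : x' * x = 1) (hy : y * y' = 1)
    (hy' : y' * y = 1) (h : x * y * R = R * y * x) : R * x' * y' = y' * x' * R := by
  calc R * x' * y' = y' * (x' * x) * y * (R * x' * y') := by
        rw [hx', mul_one, hy', one_mul]
    _ = y' * x' * (x * y * R) * x' * y' := by simp only [mul_assoc]
    _ = y' * x' * R * (y * (x * x') * y') := by rw [h]; simp only [mul_assoc]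
    _ = y' * x' * R := by rw [hx, mul_one, hy, mul_one]

theorem list_map_prod_inverse {x x' : κ → M} (h : ∀ k, x k * x' k = 1) (ks : List κ) :
    (ks.map x).prod * (ks.reverse.map x').prod = 1 := by
  induction ks with
  | nil => simp
  | cons k ks ih =>
    simp only [List.map_cons, List.prod_cons, List.reverse_cons, List.map_append, List.prod_append,
      List.map_nil, List.prod_nil, mul_one]
    rw [mul_assoc, ← mul_assoc _ _ (x' k), ih, one_mul, h]

end ListProducts

end

end Toda

namespace Toda

noncomputable section

/-! ### Operators acting in one or two tensor factors -/

section Swap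

open Function

variable {n ι : Type*} [DecidableEq ι]

theorem comp_swap_apply_left (i : ι → n) (p p' : ι) : (i ∘ Equiv.swap p p') p = i p' := by simp

theorem comp_swap_apply_right (i : ι → n) (p p' : ι) : (i ∘ Equiv.swap p p') p' = i p := by simp

theorem comp_swap_apply_of_ne (i : ι → n) {p p' r : ι} (h : r ≠ p) (h' : r ≠ p') :
    (i ∘ Equiv.swap p p') r = i r := by simp [Equiv.swap_apply_of_ne_of_ne h h']

theorem comp_swap_swap (i : ι → n) (p p' : ι) : (i ∘ Equiv.swap p p') ∘ Equiv.swap p p' = i := by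
  ext; simp

theorem update_comp_swap (i : ι → n) {p p' r : ι} (h : r ≠ p) (h' : r ≠ p') (c : n) :
    update i r c ∘ Equiv.swap p p' = update (i ∘ Equiv.swap p p') r c := by
  ext m
  by_cases hm : m = r
  · subst hm
    simp [Equiv.swap_apply_of_ne_of_ne h h']
  · rw [update_of_ne hm, comp_apply, comp_apply, update_of_ne]
    intro h1
    rw [Equiv.swap_apply_eq_iff, Equiv.swap_apply_of_ne_of_ne h h'] at h1
    exact hm h1

theorem update_update_comp_swap (i : ι → n) {p p' : ι} (h : p ≠ p') (c d : n) :
    update (update (i ∘ Equiv.swap p p') p c) p' d = update (update i p c) p' d := by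
  ext m
  by_cases hm : m = p'
  · subst hm; simp
  · by_cases hm' : m = p
    · subst hm'; simp [h]
    · simp [hm, hm', Equiv.swap_apply_of_ne_of_ne]

theorem swap_update_update (i : ι → n) {p p' : ι} (h : p ≠ p') (c d : n) :
    update (update i p c) p' d ∘ Equiv.swap p p' = update (update i p d) p' c := by
  ext m
  by_cases hm : m = p'
  · subst hm; simp [h]
  · by_cases hm' : m = p
    · subst hm'; simp [h]
    · simp [hm, hm', Equiv.swap_apply_of_ne_of_ne]

end Swap

section Embed

open Function

variable {n ι γ S K : Type*} [Fintype n] [DecidableEq n] [Fintype ι] [DecidableEq ι] [Ring S]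
  [CommRing K] [Algebra K S]

/-- The matrix `M` acting in the tensor factor `p` of `⨂_{ι} S^n`. -/
def embed (p : ι) (M : Matrix n n S) : Matrix (ι → n) (ι → n) S :=
  Matrix.of fun i j => if ∀ m, m ≠ p → i m = j m then M (i p) (j p) else 0

theorem embed_mul_apply (p : ι) (M : Matrix n n S) (X : Matrix (ι → n) γ S) (i : ι → n) (c : γ) :
    (embed p M * X) i c = ∑ k, M (i p) k * X (update i p k) c := by
  rw [Matrix.mul_apply]
  symm
  refine Fintype.sum_of_injective (fun k => update i p k) (update_injective i p) _ _ ?_ ?_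
  · intro j hj
    rw [embed, Matrix.of_apply, if_neg, zero_mul]
    intro h
    refine hj ⟨j p, funext fun m => ?_⟩
    by_cases hm : m = p
    · subst hm; simp
    · simp [hm, h m hm]
  · intro k
    rw [embed, Matrix.of_apply, if_pos]
    · simp
    · intro m hm; simp [hm]

/-- Operators are compared through their action on an arbitrary matrix, so that a product of several
operators is evaluated by composing action formulas and no entries of products are needed. -/
theorem matrix_eq_of_mul_apply {m : Type*} [Fintype m] [DecidableEq m] {A B : Matrix m m S}
    (h : ∀ (X : Matrix m m S) (i c : m), (A * X) i c = (B * X) i c) : A = B := by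
  ext i c
  simpa using h 1 i c

theorem embed_one (p : ι) : embed p (1 : Matrix n n S) = 1 := by
  refine matrix_eq_of_mul_apply fun X i c => ?_
  simp [embed_mul_apply, Matrix.one_apply]

theorem embed_mul (p : ι) (M M' : Matrix n n S) : embed p (M * M') = embed p M * embed p M' := by
  refine matrix_eq_of_mul_apply fun X i c => ?_
  rw [mul_assoc, embed_mul_apply, embed_mul_apply]
  simp only [embed_mul_apply, update_self, update_idem, Finset.mul_sum]
  rw [Finset.sum_comm]
  refine Finset.sum_congr rfl fun k _ => ?_
  rw [Matrix.mul_apply, Finset.sum_mul]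
  simp only [mul_assoc]

theorem embed_commute {p p' : ι} (hp : p ≠ p') {M M' : Matrix n n S}
    (h : ∀ i j k l, Commute (M i j) (M' k l)) : Commute (embed p M) (embed p' M') := by
  refine matrix_eq_of_mul_apply fun X i c => ?_
  rw [mul_assoc, mul_assoc]
  simp only [embed_mul_apply, update_of_ne hp, update_of_ne hp.symm, Finset.mul_sum]
  rw [Finset.sum_comm]
  refine Finset.sum_congr rfl fun k _ => Finset.sum_congr rfl fun k' _ => ?_
  rw [← mul_assoc, ← mul_assoc, (h _ _ _ _).eq, update_comm hp]

/-- A product of operators in different tensor factors has as entries products of entries. -/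
theorem embed_prod_apply (M : ι → Matrix n n S) {ks : List ι} (hks : ks.Nodup) (i j : ι → n) :
    (ks.map fun k => embed k (M k)).prod i j =
      if ∀ m, m ∉ ks → i m = j m then (ks.map fun k => M k (i k) (j k)).prod else 0 := by
  induction ks generalizing i with
  | nil =>
    simp [Matrix.one_apply, funext_iff]
  | cons k ks ih =>
    obtain ⟨hk, hks⟩ := List.nodup_cons.1 hks
    simp only [List.map_cons, List.prod_cons, embed_mul_apply, ih hks]
    have key : ∀ x, (ks.map fun m => M m (update i k x m) (j m)).prod =
        (ks.map fun m => M m (i m) (j m)).prod := fun x => by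
      refine congrArg List.prod (List.map_congr_left fun m hm => ?_)
      rw [update_of_ne]
      rintro rfl
      exact hk hm
    simp only [key]
    split_ifs with h
    · rw [Finset.sum_eq_single (j k)]
      · rw [if_pos]
        intro m hm
        by_cases hmk : m = k
        · subst hmk; simp
        · rw [update_of_ne hmk]
          exact h m (by simp [hmk, hm])
      · intro x _ hx
        rw [if_neg, mul_zero]
        intro h'
        have := h' k hk
        rw [update_self] at this
        exact hx this
      · simp
    · refine Finset.sum_eq_zero fun x _ => ?_
      rw [if_neg, mul_zero]
      intro h'
      refine h fun m hm => ?_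
      simp only [List.mem_cons, not_or] at hm
      have := h' m hm.2
      rwa [update_of_ne hm.1] at this

variable (S) in
/-- The operator `e_x ⊗ e_y ↦ α(x, y) e_x ⊗ e_y + β(y, x) e_y ⊗ e_x` in the tensor factors
`p` and `p'`. -/
def rmat (p p' : ι) (α β : n → n → K) : Matrix (ι → n) (ι → n) S :=
  Matrix.of fun i j => (if j = i then algebraMap K S (α (i p) (i p')) else 0) +
    (if j = i ∘ Equiv.swap p p' then algebraMap K S (β (i p) (i p')) else 0)

theorem rmat_mul_apply (p p' : ι) (α β : n → n → K) (X : Matrix (ι → n) γ S) (i : ι → n) (c : γ) :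
    (rmat S p p' α β * X) i c =
      α (i p) (i p') • X i c + β (i p) (i p') • X (i ∘ Equiv.swap p p') c := by
  simp [Matrix.mul_apply, rmat, add_mul, Finset.sum_add_distrib, Algebra.smul_def]

theorem rmat_commute_embed {p p' r : ι} (h : r ≠ p) (h' : r ≠ p') (α β : n → n → K)
    (M : Matrix n n S) : Commute (rmat S p p' α β) (embed r M) := by
  refine matrix_eq_of_mul_apply fun X i c => ?_
  rw [mul_assoc, mul_assoc]
  simp only [embed_mul_apply, rmat_mul_apply, update_of_ne h.symm, update_of_ne h'.symm,
    comp_swap_apply_of_ne i h h', update_comp_swap i h h', Finset.smul_sum, mul_add,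
    Finset.sum_add_distrib, mul_smul_comm]

theorem rmat_commute_rmat {p p' r r' : ι} (h₁ : r ≠ p) (h₂ : r ≠ p') (h₃ : r' ≠ p) (h₄ : r' ≠ p')
    (α β α' β' : n → n → K) : Commute (rmat S p p' α β) (rmat S r r' α' β') := by
  refine matrix_eq_of_mul_apply fun X i c => ?_
  have e : (i ∘ Equiv.swap p p') ∘ Equiv.swap r r' = (i ∘ Equiv.swap r r') ∘ Equiv.swap p p' := by
    have : Equiv.Perm.Disjoint (Equiv.swap p p') (Equiv.swap r r') := by
      intro x
      by_cases hx : x = r ∨ x = r'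
      · left
        rcases hx with rfl | rfl <;> exact Equiv.swap_apply_of_ne_of_ne (by assumption) (by assumption)
      · right
        push Not at hx
        exact Equiv.swap_apply_of_ne_of_ne hx.1 hx.2
    have := this.commute.eq
    ext m
    exact congrArg i (DFunLike.congr_fun this m)
  rw [mul_assoc, mul_assoc]
  simp only [rmat_mul_apply, comp_swap_apply_of_ne i h₁ h₂, comp_swap_apply_of_ne i h₃ h₄,
    comp_swap_apply_of_ne i h₁.symm h₃.symm, comp_swap_apply_of_ne i h₂.symm h₄.symm, e]
  module

/-- Component form of the relation `R L₁ L'₂ = L'₂ L₁ R`. -/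
def Exchange (α β : n → n → K) (L L' : Matrix n n S) : Prop :=
  ∀ i j m k, α i j • (L i m * L' j k) + β i j • (L j m * L' i k) =
    α m k • (L' j k * L i m) + β k m • (L' j m * L i k)

theorem Exchange.embed {α β : n → n → K} {L L' : Matrix n n S} (h : Exchange α β L L') {p p' : ι}
    (hp : p ≠ p') : rmat S p p' α β * embed p L * embed p' L' =
      embed p' L' * embed p L * rmat S p p' α β := by
  refine matrix_eq_of_mul_apply fun X i c => ?_
  simp only [mul_assoc]
  simp only [embed_mul_apply, rmat_mul_apply, update_of_ne hp, update_of_ne hp.symm,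
    comp_swap_apply_left, comp_swap_apply_right, update_self, update_update_comp_swap i hp,
    update_comm hp.symm, swap_update_update i hp]
  -- All evaluations of `X` are now at multi-indices that differ from `i` at `p` and `p'` only, so
  -- `X` may be treated as a function of two indices.
  generalize hY : (fun k k' => X (update (update i p k) p' k') c) = Y
  have hY : ∀ k k', X (update (update i p k) p' k') c = Y k k' := fun k k' => by rw [← hY]
  simp only [hY]
  calc _ = ∑ k, ∑ k', (α (i p) (i p') • (L (i p) k * L' (i p') k') +
          β (i p) (i p') • (L (i p') k * L' (i p) k')) * Y k k' := by
        simp only [add_mul, Finset.sum_add_distrib, Finset.smul_sum, Finset.mul_sum,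
          smul_mul_assoc, mul_assoc]
    _ = ∑ k, ∑ k', (α k k' • (L' (i p') k' * L (i p) k) + β k' k • (L' (i p') k * L (i p) k')) *
          Y k k' := by
        simp only [h (i p) (i p')]
    _ = (∑ k, ∑ k', α k k' • (L' (i p') k' * L (i p) k) * Y k k') +
          ∑ k, ∑ k', β k' k • (L' (i p') k * L (i p) k') * Y k k' := by
        simp only [add_mul, Finset.sum_add_distrib]
    _ = (∑ k', ∑ k, α k k' • (L' (i p') k' * L (i p) k) * Y k k') +
          ∑ k', ∑ k, β k k' • (L' (i p') k' * L (i p) k) * Y k' k := by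
        rw [Finset.sum_comm]
    _ = _ := by
        simp only [Finset.mul_sum, mul_add, Finset.sum_add_distrib, mul_smul_comm, smul_mul_assoc,
          mul_assoc]

/-- Component form of the relation `L₁ L'₂ R = R L'₂ L₁`. -/
def ExchangeOp (α β : n → n → K) (L L' : Matrix n n S) : Prop :=
  ∀ i j m k, α m k • (L i m * L' j k) + β k m • (L i k * L' j m) =
    α i j • (L' j k * L i m) + β i j • (L' i k * L j m)

theorem ExchangeOp.embed {α β : n → n → K} {L L' : Matrix n n S} (h : ExchangeOp α β L L')
    {p p' : ι} (hp : p ≠ p') : embed p L * embed p' L' * rmat S p p' α β =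
      rmat S p p' α β * embed p' L' * embed p L := by
  refine matrix_eq_of_mul_apply fun X i c => ?_
  simp only [mul_assoc]
  simp only [embed_mul_apply, rmat_mul_apply, update_of_ne hp, update_of_ne hp.symm,
    comp_swap_apply_left, comp_swap_apply_right, update_self, update_comm hp.symm,
    update_update_comp_swap i hp, swap_update_update i hp]
  generalize hY : (fun k k' => X (update (update i p k) p' k') c) = Y
  have hY : ∀ k k', X (update (update i p k) p' k') c = Y k k' := fun k k' => by rw [← hY]
  simp only [hY]
  symm
  calc _ = ∑ k, ∑ k', (α (i p) (i p') • (L' (i p') k' * L (i p) k) +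
          β (i p) (i p') • (L' (i p) k' * L (i p') k)) * Y k k' := by
        rw [Finset.sum_comm]
        simp only [add_mul, Finset.sum_add_distrib, Finset.smul_sum, Finset.mul_sum,
          smul_mul_assoc, mul_assoc]
    _ = ∑ k, ∑ k', (α k k' • (L (i p) k * L' (i p') k') + β k' k • (L (i p) k' * L' (i p') k)) *
          Y k k' := by
        simp only [h (i p) (i p')]
    _ = (∑ k, ∑ k', α k k' • (L (i p) k * L' (i p') k') * Y k k') +
          ∑ k, ∑ k', β k' k • (L (i p) k' * L' (i p') k) * Y k k' := by
        simp only [add_mul, Finset.sum_add_distrib]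
    _ = (∑ k, ∑ k', α k k' • (L (i p) k * L' (i p') k') * Y k k') +
          ∑ k', ∑ k, β k' k • (L (i p) k' * L' (i p') k) * Y k k' := by
        rw [Finset.sum_comm (f := fun k k' => β k' k • _ * _)]
    _ = _ := by
        simp only [Finset.mul_sum, mul_add, Finset.sum_add_distrib, mul_smul_comm, smul_mul_assoc,
          mul_assoc]

end Embed

end

end Toda

namespace Toda

noncomputable section

/-! ### The trigonometric R-matrix -/

section RMatrix

open Function

variable {n ι S K : Type*} [LinearOrder n]

/-- The function with value `u` on the diagonal and `v` off the diagonal. -/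
def diagOff [Zero K] (u v : K) (x y : n) : K := if x = y then u else v

/-- The function with value `s` above the diagonal, `t` below the diagonal and `0` on it. -/
def upperLower [Zero K] (s t : K) (x y : n) : K := if x < y then s else if y < x then t else 0

section
variable [Zero K] {s t u v : K} {x y : n}
theorem diagOff_self : diagOff u v x x = u := if_pos rfl
theorem diagOff_of_ne (h : x ≠ y) : diagOff u v x y = v := if_neg h
theorem diagOff_of_lt (h : x < y) : diagOff u v x y = v := if_neg h.ne
theorem diagOff_of_gt (h : y < x) : diagOff u v x y = v := if_neg h.ne'
theorem upperLower_self : upperLower s t x x = 0 := by simp [upperLower]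
theorem upperLower_of_lt (h : x < y) : upperLower s t x y = s := if_pos h
theorem upperLower_of_gt (h : y < x) : upperLower s t x y = t := by
  simp [upperLower, h, h.not_gt]
end

variable [Fintype n] [Fintype ι] [DecidableEq ι] [Ring S] [CommRing K] [Algebra K S]

variable (n S) in
/-- The R-matrix `R(Z, W)` in the tensor factors `p` and `p'`. -/
def rmatrix (q : Kˣ) (Z W : K) (p p' : ι) : Matrix (ι → n) (ι → n) S :=
  rmat S p p' (diagOff (q * Z - (q⁻¹ : Kˣ) * W) (Z - W))
    (upperLower ((q - (q⁻¹ : Kˣ)) * Z) ((q - (q⁻¹ : Kˣ)) * W))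

variable (n S) in
/-- The R-matrix at `W = q² Z`, divided by `(1 - q²) Z`. -/
def rhat (q : Kˣ) (p p' : ι) : Matrix (ι → n) (ι → n) S :=
  rmat S p p' (diagOff 0 1) (upperLower (-((q⁻¹ : Kˣ) : K)) (-(q : K)))

variable (n S) in
/-- An idempotent with the same range as `rhat`, the tensors which are `q`-antisymmetric in the
factors `p` and `p'`. -/
def antisymProj (q : Kˣ) (p p' : ι) : Matrix (ι → n) (ι → n) S :=
  rmat S p p' (upperLower 1 0) (upperLower 0 (-(q : K)))

/-- Together with `antisymProj_mul_rhat` this identifies the ranges of `rhat` and `antisymProj`,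
which is the input of `preserves_of_exchange`. The right factor keeps only components increasing at
`p`, `p'`; these determine an antisymmetric tensor. -/
theorem rhat_mul_half (q : Kˣ) (p p' : ι) :
    rhat n S q p p' * rmat S p p' (upperLower (1 : K) 0) (fun _ _ => 0) =
      (antisymProj n S q p p' : Matrix (ι → n) (ι → n) S) := by
  refine matrix_eq_of_mul_apply fun X i c => ?_
  rw [mul_assoc]
  simp only [rhat, antisymProj, rmat_mul_apply, comp_swap_apply_left, comp_swap_apply_right,
    zero_smul, add_zero]
  rcases lt_trichotomy (i p) (i p') with h | h | h
  · simp [upperLower_of_lt h, upperLower_of_gt h, diagOff_of_ne h.ne]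
  · simp [h, upperLower_self]
  · simp [upperLower_of_lt h, upperLower_of_gt h, diagOff_of_ne h.ne']

theorem antisymProj_mul_rhat (q : Kˣ) (p p' : ι) :
    antisymProj n S q p p' * rhat n S q p p' = (rhat n S q p p' : Matrix (ι → n) (ι → n) S) := by
  refine matrix_eq_of_mul_apply fun X i c => ?_
  rw [mul_assoc]
  simp only [rhat, antisymProj, rmat_mul_apply, comp_swap_apply_left, comp_swap_apply_right,
    comp_swap_swap]
  rcases lt_trichotomy (i p) (i p') with h | h | h
  · simp [upperLower_of_lt h, diagOff_of_ne h.ne]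
  · simp [h, upperLower_self, diagOff_self]
  · simp [upperLower_of_lt h, upperLower_of_gt h, diagOff_of_ne h.ne', diagOff_of_ne h.ne,
      smul_smul, add_comm]

/-- Unitarity of the R-matrix. Invoked a second time with the parameters and tensor factors
exchanged, it also provides the left inverse in `isUnit_rmatrix`. -/
theorem rmatrix_mul_rmatrix (q : Kˣ) (Z W : K) {p p' : ι} :
    rmatrix n S q Z W p p' * rmatrix n S q W Z p' p =
      ((q * Z - (q⁻¹ : Kˣ) * W) * (q * W - (q⁻¹ : Kˣ) * Z)) •
        (1 : Matrix (ι → n) (ι → n) S) := by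
  refine matrix_eq_of_mul_apply fun X i c => ?_
  rw [mul_assoc]
  simp only [rmatrix, rmat_mul_apply, comp_swap_apply_left, comp_swap_apply_right,
    Equiv.swap_comm p' p, comp_swap_swap, smul_mul_assoc, one_mul, Matrix.smul_apply]
  have hq : (q : K) * (q⁻¹ : Kˣ) = 1 := q.mul_inv
  generalize ((q⁻¹ : Kˣ) : K) = r at *
  rcases lt_trichotomy (i p) (i p') with h | h | h
  · simp only [upperLower_of_lt h, upperLower_of_gt h, diagOff_of_ne h.ne, diagOff_of_ne h.ne']
    match_scalars <;> grind
  · simp only [h, upperLower_self, diagOff_self]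
    match_scalars <;> grind
  · simp only [upperLower_of_lt h, upperLower_of_gt h, diagOff_of_ne h.ne, diagOff_of_ne h.ne']
    match_scalars <;> grind

theorem isUnit_rmatrix (q : Kˣ) {Z W : K} (p p' : ι)
    (h : IsUnit ((q * Z - (q⁻¹ : Kˣ) * W) * (q * W - (q⁻¹ : Kˣ) * Z))) :
    IsUnit (rmatrix n S q Z W p p') := by
  obtain ⟨c, hc⟩ := h
  refine ⟨⟨rmatrix n S q Z W p p', (c⁻¹ : Kˣ) • rmatrix n S q W Z p' p, ?_, ?_⟩, rfl⟩
  · rw [mul_smul_comm, rmatrix_mul_rmatrix, ← hc, ← Units.smul_def, inv_smul_smul]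
  · rw [smul_mul_assoc, rmatrix_mul_rmatrix, mul_comm, ← hc, ← Units.smul_def, inv_smul_smul]

omit [Fintype n] [Fintype ι] [LinearOrder n] in
/-- A function of `i : ι → n` in terms of the values of `i` at three places. -/
theorem exists_three_places {γ : Type*} (i : ι → n) {p p' r : ι} (h₁ : p ≠ p') (h₂ : p ≠ r)
    (h₃ : p' ≠ r) (X : (ι → n) → γ) : ∃ G : n → n → n → γ,
      ∀ g : ι → n, (∀ m, m ≠ p → m ≠ p' → m ≠ r → g m = i m) → X g = G (g p) (g p') (g r) := by
  refine ⟨fun x y z => X (update (update (update i p x) p' y) r z), fun g hg => ?_⟩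
  congr 1
  ext m
  by_cases hr : m = r
  · subst hr; simp
  by_cases hp' : m = p'
  · subst hp'; simp [h₃]
  by_cases hp : m = p
  · subst hp; simp [h₁, h₂]
  · simp [hr, hp, hp', hg m hp hp' hr]

set_option maxHeartbeats 1000000 in
-- The Yang–Baxter equation in which the parameters of the pair `p`, `p'` have ratio q², so that
-- their R-matrix is replaced by `rhat`. Dividing out the scalar (1 - q²)Z beforehand avoids any
-- assumption on q.
theorem rhat_mul_rmatrix_mul_rmatrix (q : Kˣ) (Z W : K) {p p' r : ι} (h₁ : p ≠ p') (h₂ : p ≠ r)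
    (h₃ : p' ≠ r) :
    rhat n S q p p' * rmatrix n S q Z W p r * rmatrix n S q ((q : K) ^ 2 * Z) W p' r =
      (rmatrix n S q ((q : K) ^ 2 * Z) W p' r * rmatrix n S q Z W p r * rhat n S q p p' :
        Matrix (ι → n) (ι → n) S) := by
  refine matrix_eq_of_mul_apply fun X i c => ?_
  obtain ⟨G, hG⟩ := exists_three_places i h₁ h₂ h₃ fun j => X j c
  replace hG : ∀ g : ι → n, (∀ m, m ≠ p → m ≠ p' → m ≠ r → g m = i m) →
    X g c = G (g p) (g p') (g r) := hG
  have s12 : Equiv.swap p p' r = r := Equiv.swap_apply_of_ne_of_ne h₂.symm h₃.symm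
  have s13 : Equiv.swap p r p' = p' := Equiv.swap_apply_of_ne_of_ne h₁.symm h₃
  have s23 : Equiv.swap p' r p = p := Equiv.swap_apply_of_ne_of_ne h₁ h₂
  simp only [mul_assoc]
  simp only [rmatrix, rhat, rmat_mul_apply]
  simp +contextual only [hG, comp_apply, Equiv.swap_apply_left, Equiv.swap_apply_right, s12, s13,
    s23, Equiv.swap_apply_of_ne_of_ne, ne_eq, not_false_eq_true, implies_true]
  have hq : (q : K) * (q⁻¹ : Kˣ) = 1 := q.mul_inv
  generalize ((q⁻¹ : Kˣ) : K) = t at *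
  generalize i p = x, i p' = y, i r = z
  -- The weights depend only on the relative order of the three indices. Inconsistent combinations
  -- are discarded by `order`; the others are polynomial identities modulo `q * t = 1`.
  rcases lt_trichotomy x y with h | h | h <;> rcases lt_trichotomy y z with h' | h' | h' <;>
    rcases lt_trichotomy x z with h'' | h'' | h'' <;>
    first
    | (exfalso; order)
    | (try subst h
       try subst h'
       try subst h''
       simp only [upperLower_of_lt, upperLower_of_gt, diagOff_of_lt, diagOff_of_gt,
          upperLower_self, diagOff_self, *]
       match_scalars <;> grind)

set_option maxHeartbeats 1000000 in
-- The companion Yang–Baxter equation with the degenerate pair in the second slot of the R-matrices.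
-- It handles antisymmetry in the second family of tensor factors.
theorem rmatrix_mul_rmatrix_mul_rhat (q : Kˣ) (Z W : K) {p p' r : ι} (h₁ : p ≠ p') (h₂ : p ≠ r)
    (h₃ : p' ≠ r) :
    rmatrix n S q Z W r p * rmatrix n S q Z ((q : K) ^ 2 * W) r p' * rhat n S q p p' =
      (rhat n S q p p' * rmatrix n S q Z ((q : K) ^ 2 * W) r p' * rmatrix n S q Z W r p :
        Matrix (ι → n) (ι → n) S) := by
  refine matrix_eq_of_mul_apply fun X i c => ?_
  obtain ⟨G, hG⟩ := exists_three_places i h₁ h₂ h₃ fun j => X j c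
  replace hG : ∀ g : ι → n, (∀ m, m ≠ p → m ≠ p' → m ≠ r → g m = i m) →
    X g c = G (g p) (g p') (g r) := hG
  have s12 : Equiv.swap p p' r = r := Equiv.swap_apply_of_ne_of_ne h₂.symm h₃.symm
  have s13 : Equiv.swap r p p' = p' := Equiv.swap_apply_of_ne_of_ne h₃ h₁.symm
  have s23 : Equiv.swap r p' p = p := Equiv.swap_apply_of_ne_of_ne h₂ h₁
  simp only [mul_assoc]
  simp only [rmatrix, rhat, rmat_mul_apply]
  simp +contextual only [hG, comp_apply, Equiv.swap_apply_left, Equiv.swap_apply_right, s12, s13,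
    s23, Equiv.swap_apply_of_ne_of_ne, ne_eq, not_false_eq_true, implies_true]
  have hq : (q : K) * (q⁻¹ : Kˣ) = 1 := q.mul_inv
  generalize ((q⁻¹ : Kˣ) : K) = t at *
  generalize i p = x, i p' = y, i r = z
  rcases lt_trichotomy x y with h | h | h <;> rcases lt_trichotomy y z with h' | h' | h' <;>
    rcases lt_trichotomy x z with h'' | h'' | h'' <;>
    first
    | (exfalso; order)
    | (try subst h
       try subst h'
       try subst h''
       simp only [upperLower_of_lt, upperLower_of_gt, diagOff_of_lt, diagOff_of_gt,
          upperLower_self, diagOff_self, *]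
       match_scalars <;> grind)

end RMatrix

end

end Toda

namespace Toda

noncomputable section

/-! ### `q`-antisymmetric tensors -/

section Antisymmetric

variable {N l : ℕ} {M : Type*} [AddCommGroup M] [Module ℂ M]

theorem inversions_one : inversions (1 : Equiv.Perm (Fin l)) = 0 := by
  rw [inversions, Finset.card_eq_zero, Finset.filter_eq_empty_iff]
  rintro ⟨a, b⟩ -
  simp only [Equiv.Perm.coe_one, id]
  exact fun h => lt_asymm h.1 h.2

theorem swap_lt_swap {p p' : Fin l} (hp : (p : ℕ) + 1 = p') {a b : Fin l} (hab : a < b)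
    (h : ¬ (a = p ∧ b = p')) : Equiv.swap p p' a < Equiv.swap p p' b := by
  simp only [Equiv.swap_apply_def]
  split_ifs <;> simp only [Fin.lt_def, Fin.ext_iff] at * <;> omega

/-- The transposition acts on pairs of places and matches the inversions of σ with those of the
product other than `(p, p')` itself, since it preserves the order of every other pair. -/
theorem inversions_mul_swap (σ : Equiv.Perm (Fin l)) {p p' : Fin l} (hp : (p : ℕ) + 1 = p')
    (h : σ p < σ p') : inversions (σ * Equiv.swap p p') = inversions σ + 1 := by
  have hpp : p < p' := by rw [Fin.lt_def]; omega
  unfold inversions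
  rw [← Finset.card_erase_add_one (a := (p, p')) (Finset.mem_filter.2 ⟨Finset.mem_univ _, hpp, by simpa using h⟩)]
  congr 1
  have key : ∀ a b : Fin l, a < b → ¬ (a = p ∧ b = p') →
      (Equiv.swap p p' a < Equiv.swap p p' b ∧
        ¬ (Equiv.swap p p' a = p ∧ Equiv.swap p p' b = p')) := by
    refine fun a b hab hne => ⟨swap_lt_swap hp hab hne, ?_⟩
    rintro ⟨h1, h2⟩
    rw [Equiv.swap_apply_eq_iff, Equiv.swap_apply_left] at h1
    rw [Equiv.swap_apply_eq_iff, Equiv.swap_apply_right] at h2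
    subst h1 h2
    exact lt_asymm hpp hab
  refine Finset.card_nbij' (fun x => (Equiv.swap p p' x.1, Equiv.swap p p' x.2))
    (fun x => (Equiv.swap p p' x.1, Equiv.swap p p' x.2)) ?_ ?_ ?_ ?_
  · rintro ⟨a, b⟩ hx
    rw [Finset.mem_coe, Finset.mem_erase, Finset.mem_filter, Ne, Prod.mk.injEq] at hx
    exact Finset.mem_coe.2 (Finset.mem_filter.2
      ⟨Finset.mem_univ _, (key a b hx.2.2.1 hx.1).1, by simpa using hx.2.2.2⟩)
  · rintro ⟨a, b⟩ hx
    rw [Finset.mem_coe, Finset.mem_filter] at hx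
    rw [Finset.mem_coe, Finset.mem_erase, Finset.mem_filter, Ne, Prod.mk.injEq]
    have hne : ¬ (a = p ∧ b = p') := by
      rintro ⟨rfl, rfl⟩
      exact lt_asymm h hx.2.2
    exact ⟨(key a b hx.2.1 hne).2, Finset.mem_univ _, (key a b hx.2.1 hne).1,
      by simpa using hx.2.2⟩
  · rintro ⟨a, b⟩ _; simp
  · rintro ⟨a, b⟩ _; simp

/-- The tensor with components `f i` is `q`-antisymmetric. -/
def IsAntisym (q : ℂ) (f : (Fin l → Fin N) → M) : Prop :=
  ∀ (k : ℕ) (hk : k + 1 < l) (i : Fin l → Fin N),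
    (i ⟨k, by omega⟩ = i ⟨k + 1, hk⟩ → f i = 0) ∧
    (i ⟨k + 1, hk⟩ < i ⟨k, by omega⟩ →
      f i = -q • f (i ∘ Equiv.swap ⟨k, by omega⟩ ⟨k + 1, hk⟩))

theorem strictMono_of_lt_succ {i : Fin l → Fin N}
    (h : ∀ (k : ℕ) (hk : k + 1 < l), i ⟨k, by omega⟩ < i ⟨k + 1, hk⟩) : StrictMono i := by
  cases l with
  | zero => exact fun a => a.elim0
  | succ m => exact Fin.strictMono_iff_lt_succ.2 fun k => h k (by omega)

/-- Well-founded induction on the lexicographic order: a multi-index that is not increasing has a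
neighbouring pair of equal entries, where `f` vanishes, or a descent, whose exchange yields a
lexicographically smaller multi-index. -/
theorem IsAntisym.eq_zero {q : ℂ} {f : (Fin l → Fin N) → M} (hf : IsAntisym q f)
    (h : ∀ J : Fin l ↪o Fin N, f J = 0) : f = 0 := by
  have : ∀ i : Lex (Fin l → Fin N), f (ofLex i) = 0 := by
    intro i
    induction i using WellFoundedLT.induction with
    | ind i ih =>
      by_cases hi : ∀ (k : ℕ) (hk : k + 1 < l), (ofLex i) ⟨k, by omega⟩ < (ofLex i) ⟨k + 1, hk⟩
      · exact h (OrderEmbedding.ofStrictMono _ (strictMono_of_lt_succ hi))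
      · push Not at hi
        obtain ⟨k, hk, hi⟩ := hi
        rcases hi.lt_or_eq with hi | hi
        · rw [(hf k hk _).2 hi]
          have := ih (toLex (ofLex i ∘ Equiv.swap ⟨k, by omega⟩ ⟨k + 1, hk⟩))
            (Pi.lex_desc (by rw [Fin.le_def]; simp) hi)
          rw [ofLex_toLex] at this
          rw [this, smul_zero]
        · exact (hf k hk _).1 hi.symm
  funext i
  exact this (toLex i)

/-- With a repeated entry no permutation contributes, as `J` is injective. At a descent the sum is
reindexed by right multiplication with the adjacent transposition, which changes the number of
inversions by one and so yields the factor -q. -/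
theorem qAntisym_isAntisym (q : ℂˣ) (J : Fin l ↪o Fin N) :
    IsAntisym (q : ℂ) fun i => qAntisym q N l i J := by
  intro k hk i
  constructor
  · intro h
    simp only [qAntisym, Matrix.of_apply]
    refine Finset.sum_eq_zero fun σ _ => if_neg ?_
    rintro rfl
    have := σ.injective (J.injective h)
    simp [Fin.ext_iff] at this
  · intro h
    simp only [qAntisym, Matrix.of_apply]
    rw [← Equiv.sum_comp (Equiv.mulRight (Equiv.swap ⟨k, by omega⟩ ⟨k + 1, hk⟩ : Equiv.Perm (Fin l)))
      (fun σ : Equiv.Perm (Fin l) =>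
        if i ∘ Equiv.swap ⟨k, by omega⟩ ⟨k + 1, hk⟩ = (fun k => J (σ k))
          then (-(q : ℂ)) ^ inversions σ else 0), smul_eq_mul, Finset.mul_sum]
    refine Finset.sum_congr rfl fun σ _ => ?_
    rw [Equiv.coe_mulRight]
    have e : (i ∘ Equiv.swap ⟨k, by omega⟩ ⟨k + 1, hk⟩ =
        fun m => J ((σ * (Equiv.swap ⟨k, by omega⟩ ⟨k + 1, hk⟩ : Equiv.Perm (Fin l))) m)) ↔
          i = fun m => J (σ m) := by
      constructor
      · intro h'
        ext m
        have := congrFun h' (Equiv.swap ⟨k, by omega⟩ ⟨k + 1, hk⟩ m)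
        simpa using congrArg Fin.val this
      · intro h'
        ext m
        simp [h']
    simp only [e]
    split_ifs with h'
    · subst h'
      have hσ : σ ⟨k + 1, hk⟩ < σ ⟨k, by omega⟩ := J.lt_iff_lt.1 h
      have hk' := Nat.lt_of_succ_lt hk
      have := inversions_mul_swap (p := ⟨k, hk'⟩) (p' := ⟨k + 1, hk⟩)
        (σ * Equiv.swap ⟨k, hk'⟩ ⟨k + 1, hk⟩) rfl (by simpa using hσ)
      rw [mul_assoc, Equiv.swap_mul_self, mul_one] at this
      rw [this, pow_succ']
    · simp

/-- Only the identity permutation can make `J ∘ σ` increasing, so the `v_J` are dual to the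
increasing components. -/
theorem qAntisym_apply_orderEmb (q : ℂˣ) (I J : Fin l ↪o Fin N) :
    qAntisym q N l I J = if I = J then 1 else 0 := by
  simp only [qAntisym, Matrix.of_apply]
  rw [Finset.sum_eq_single 1]
  · simp only [inversions_one, pow_zero, Equiv.Perm.coe_one, id]
    refine if_congr ?_ rfl rfl
    exact DFunLike.coe_injective.eq_iff (a := I) (b := J)
  · intro σ _ hσ
    refine if_neg fun h => hσ ?_
    have hm : StrictMono σ := fun a b hab => by
      have : I a < I b := I.lt_iff_lt.2 hab
      rw [h] at this
      exact J.lt_iff_lt.1 this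
    ext a
    have := congrFun ((hm.range_inj strictMono_id).1 (by simp)) a
    simp [this]
  · simp

/-- The difference of both sides is again antisymmetric and has no increasing components, so
`IsAntisym.eq_zero` applies. This makes the `v_J` a basis over any coefficient module. -/
theorem IsAntisym.eq_sum (q : ℂˣ) {f : (Fin l → Fin N) → M} (hf : IsAntisym (q : ℂ) f)
    (i : Fin l → Fin N) : f i = ∑ J : Fin l ↪o Fin N, qAntisym q N l i J • f J := by
  have : IsAntisym (q : ℂ) fun i => f i - ∑ J : Fin l ↪o Fin N, qAntisym q N l i J • f J := by
    intro k hk i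
    constructor
    · intro h
      simp only [(hf k hk i).1 h, (qAntisym_isAntisym q _ k hk i).1 h, zero_smul,
        Finset.sum_const_zero, sub_zero]
    · intro h
      simp only [(hf k hk i).2 h, (qAntisym_isAntisym q _ k hk i).2 h, smul_sub, Finset.smul_sum,
        smul_eq_mul, mul_smul]
  have := congrFun (this.eq_zero fun I => by simp [qAntisym_apply_orderEmb]) i
  exact sub_eq_zero.1 this

/-- `antisymProj` was chosen so that its fixed tensors satisfy literally the relations of
`IsAntisym` at one neighbouring pair. -/
theorem antisymProj_mul_eq_self {S K γ ι : Type*} [Fintype ι] [DecidableEq ι] [Ring S] [CommRing K]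
    [Algebra K S] {q : Kˣ} {p p' : ι} {X : Matrix (ι → Fin N) γ S} :
    antisymProj (Fin N) S q p p' * X = X ↔ ∀ i c, (i p = i p' → X i c = 0) ∧
      (i p' < i p → X i c = -(q : K) • X (i ∘ Equiv.swap p p') c) := by
  rw [← Matrix.ext_iff]
  refine forall₂_congr fun i c => ?_
  rw [antisymProj, rmat_mul_apply]
  rcases lt_trichotomy (i p) (i p') with h | h | h
  · simp [upperLower_of_lt h, h.ne, h.not_gt]
  · simp [h, upperLower_self, eq_comm]
  · simp only [upperLower_of_gt h, h.ne', h, zero_smul, zero_add, IsEmpty.forall_iff, true_and,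
      forall_const]
    exact eq_comm

end Antisymmetric

end

end Toda

namespace Toda

noncomputable section

/-! ### Fusion -/

section Fusion

variable {N l : ℕ} {S : Type*} [Ring S]

/-- The product `L_{(l)} ⋯ L_{(1)}`. -/
def descProd (L : Fin l → Matrix (Fin N) (Fin N) S) : Matrix (Fin l → Fin N) (Fin l → Fin N) S :=
  ((List.finRange l).reverse.map fun k => embed k (L k)).prod

/-- The product `L_{(1)} ⋯ L_{(l)}`. -/
def ascProd (L : Fin l → Matrix (Fin N) (Fin N) S) : Matrix (Fin l → Fin N) (Fin l → Fin N) S :=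
  ((List.finRange l).map fun k => embed k (L k)).prod

theorem descProd_apply (L : Fin l → Matrix (Fin N) (Fin N) S) (i j : Fin l → Fin N) :
    descProd L i j = ((List.finRange l).reverse.map fun k => L k (i k) (j k)).prod := by
  rw [descProd, embed_prod_apply L (List.nodup_reverse.2 (List.nodup_finRange l)), if_pos (by simp)]

theorem ascProd_apply (L : Fin l → Matrix (Fin N) (Fin N) S) (i j : Fin l → Fin N) :
    ascProd L i j = ((List.finRange l).map fun k => L k (i k) (j k)).prod := by
  rw [ascProd, embed_prod_apply L (List.nodup_finRange l), if_pos (by simp)]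

theorem embed_mul_embed_eq_one {n ι : Type*} [Fintype n] [DecidableEq n] [Fintype ι]
    [DecidableEq ι] {L L' : Matrix n n S} (h : L * L' = 1) (k : ι) :
    embed k L * embed k L' = 1 := by
  rw [← embed_mul, h, embed_one]

theorem ascProd_mul_descProd {L L' : Fin l → Matrix (Fin N) (Fin N) S} (h : ∀ k, L k * L' k = 1) :
    ascProd L * descProd L' = 1 :=
  list_map_prod_inverse (fun k => embed_mul_embed_eq_one (h k) k) _

theorem descProd_mul_ascProd {L L' : Fin l → Matrix (Fin N) (Fin N) S} (h : ∀ k, L k * L' k = 1) :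
    descProd L * ascProd L' = 1 := by
  have := list_map_prod_inverse (fun k => embed_mul_embed_eq_one (h k) k) (List.finRange l).reverse
  rwa [List.reverse_reverse] at this

variable [Algebra ℂ S]

variable (N S) in
/-- `qAntisym` with entries in a `ℂ`-algebra. -/
def antisymMatrix (q : ℂˣ) (l : ℕ) : Matrix (Fin l → Fin N) (Fin l ↪o Fin N) S :=
  (qAntisym q N l).map (algebraMap ℂ S)

/-- The restriction of an operator to the space of `q`-antisymmetric tensors. -/
def fuse (q : ℂˣ) (T : Matrix (Fin l → Fin N) (Fin l → Fin N) S) :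
    Matrix (Fin l ↪o Fin N) (Fin l ↪o Fin N) S :=
  Matrix.of fun I J => (T * antisymMatrix N S q l) I J

/-- `T` preserves `q`-antisymmetric tensors. -/
def Preserves (q : ℂˣ) (T : Matrix (Fin l → Fin N) (Fin l → Fin N) S) : Prop :=
  ∀ (k : ℕ) (hk : k + 1 < l),
    antisymProj (Fin N) S q (⟨k, by omega⟩ : Fin l) ⟨k + 1, hk⟩ * T *
      antisymProj (Fin N) S q (⟨k, by omega⟩ : Fin l) ⟨k + 1, hk⟩ =
      T * antisymProj (Fin N) S q (⟨k, by omega⟩ : Fin l) ⟨k + 1, hk⟩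

theorem isAntisym_of_antisymProj_mul {γ : Type*} {q : ℂˣ} {X : Matrix (Fin l → Fin N) γ S}
    (h : ∀ (k : ℕ) (hk : k + 1 < l), antisymProj (Fin N) S q (⟨k, by omega⟩ : Fin l) ⟨k + 1, hk⟩ * X = X) (c : γ) :
    IsAntisym (q : ℂ) fun i => X i c :=
  fun k hk i => antisymProj_mul_eq_self.1 (h k hk) i c

theorem antisymProj_mul_antisymMatrix (q : ℂˣ) (k : ℕ) (hk : k + 1 < l) :
    antisymProj (Fin N) S q (⟨k, by omega⟩ : Fin l) ⟨k + 1, hk⟩ * antisymMatrix N S q l = antisymMatrix N S q l := by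
  rw [antisymProj_mul_eq_self]
  intro i J
  have := qAntisym_isAntisym q J k hk i
  dsimp only at this
  simp only [antisymMatrix, Matrix.map_apply]
  refine ⟨fun h => by rw [this.1 h, map_zero], fun h => ?_⟩
  rw [this.2 h, smul_eq_mul, map_mul, ← Algebra.smul_def]

/-- The columns of `T * antisymMatrix` are again antisymmetric, and `fuse` collects their increasing
components, which are the coefficients in the expansion of `IsAntisym.eq_sum`. -/
theorem Preserves.mul_antisymMatrix {q : ℂˣ} {T : Matrix (Fin l → Fin N) (Fin l → Fin N) S}
    (h : Preserves q T) : T * antisymMatrix N S q l = antisymMatrix N S q l * fuse q T := by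
  ext i J
  have := IsAntisym.eq_sum q (isAntisym_of_antisymProj_mul (q := q)
    (X := T * antisymMatrix N S q l) (fun k hk => by
      conv_lhs => rw [← antisymProj_mul_antisymMatrix q k hk, ← Matrix.mul_assoc,
        ← Matrix.mul_assoc, h k hk, Matrix.mul_assoc, antisymProj_mul_antisymMatrix]) J) i
  rw [this, Matrix.mul_apply]
  simp only [antisymMatrix, Matrix.map_apply, Algebra.smul_def, fuse, Matrix.of_apply]

/-- Only the right factor has to preserve antisymmetric tensors: it acts first, and the left one is
then merely evaluated on its image. -/
theorem fuse_mul {q : ℂˣ} {T T' : Matrix (Fin l → Fin N) (Fin l → Fin N) S}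
    (h : Preserves q T') : fuse q (T * T') = fuse q T * fuse q T' := by
  ext I J
  rw [fuse, Matrix.of_apply, Matrix.mul_assoc, h.mul_antisymMatrix, ← Matrix.mul_assoc]
  rfl

theorem fuse_one (q : ℂˣ) : fuse q (1 : Matrix (Fin l → Fin N) (Fin l → Fin N) S) = 1 := by
  ext I J
  simp [fuse, antisymMatrix, qAntisym_apply_orderEmb, Matrix.one_apply]

/-- For each neighbouring pair, the two adjacent factors preserve the range of `rhat` by the
exchange relation, and all the other factors commute with the projection. -/
theorem Preserves.descProd {q : ℂˣ} {L : Fin l → Matrix (Fin N) (Fin N) S}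
    (h : ∀ (k : ℕ) (hk : k + 1 < l),
      rhat (Fin N) S q (⟨k, by omega⟩ : Fin l) ⟨k + 1, hk⟩ * embed (⟨k, by omega⟩ : Fin l) (L ⟨k, by omega⟩) *
        embed (⟨k + 1, hk⟩ : Fin l) (L ⟨k + 1, hk⟩) =
      embed (⟨k + 1, hk⟩ : Fin l) (L ⟨k + 1, hk⟩) * embed (⟨k, by omega⟩ : Fin l) (L ⟨k, by omega⟩) *
        rhat (Fin N) S q (⟨k, by omega⟩ : Fin l) ⟨k + 1, hk⟩) : Preserves q (descProd L) := fun k hk =>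
  prod_finRange_reverse_preserves hk
    (preserves_of_exchange (rhat_mul_half _ _ _) (antisymProj_mul_rhat _ _ _)
      ((h k hk).symm.trans (mul_assoc _ _ _)))
    fun _ h1 h2 => rmat_commute_embed h1 h2 _ _ _

theorem Preserves.ascProd {q : ℂˣ} {L : Fin l → Matrix (Fin N) (Fin N) S}
    (h : ∀ (k : ℕ) (hk : k + 1 < l),
      embed (⟨k, by omega⟩ : Fin l) (L ⟨k, by omega⟩) * embed (⟨k + 1, hk⟩ : Fin l) (L ⟨k + 1, hk⟩) *
        rhat (Fin N) S q (⟨k, by omega⟩ : Fin l) ⟨k + 1, hk⟩ =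
      rhat (Fin N) S q (⟨k, by omega⟩ : Fin l) ⟨k + 1, hk⟩ * embed (⟨k + 1, hk⟩ : Fin l) (L ⟨k + 1, hk⟩) *
        embed (⟨k, by omega⟩ : Fin l) (L ⟨k, by omega⟩)) : Preserves q (ascProd L) := fun k hk =>
  prod_finRange_preserves hk
    (preserves_of_exchange (rhat_mul_half _ _ _) (antisymProj_mul_rhat _ _ _)
      ((h k hk).trans (mul_assoc _ _ _)))
    fun _ h1 h2 => rmat_commute_embed h1 h2 _ _ _

end Fusion

/-! ### Operators on tensor products -/

section Tensor

variable {m o S : Type*} [Fintype m] [DecidableEq m] [Fintype o] [DecidableEq o] [Ring S]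

variable (o) in
/-- `F ⊗ 1`. -/
def tensLeft : Matrix m m S →+* Matrix (m × o) (m × o) S :=
  (Matrix.blockDiagonalRingHom m o S).comp (Pi.constRingHom o _)

variable (m) in
/-- `1 ⊗ F`. -/
def tensRight : Matrix o o S →+* Matrix (m × o) (m × o) S :=
  ((Matrix.reindexRingEquiv S (Equiv.prodComm o m)) : _ →+* _).comp (tensLeft m)

theorem tensLeft_apply (F : Matrix m m S) (i j : m × o) :
    tensLeft o F i j = if i.2 = j.2 then F i.1 j.1 else 0 := rfl

theorem tensRight_apply (F : Matrix o o S) (i j : m × o) :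
    tensRight m F i j = if i.1 = j.1 then F i.2 j.2 else 0 := rfl

theorem tensLeft_mul_apply {γ : Type*} (F : Matrix m m S) (X : Matrix (m × o) γ S) (i : m × o)
    (c : γ) : (tensLeft o F * X) i c = ∑ j, F i.1 j * X (j, i.2) c := by
  simp [Matrix.mul_apply, tensLeft_apply, Fintype.sum_prod_type]

theorem tensRight_mul_apply {γ : Type*} (F : Matrix o o S) (X : Matrix (m × o) γ S) (i : m × o)
    (c : γ) : (tensRight m F * X) i c = ∑ j, F i.2 j * X (i.1, j) c := by
  simp [Matrix.mul_apply, tensRight_apply, Fintype.sum_prod_type]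

theorem trace_tensLeft_mul_tensRight (F : Matrix m m S) (F' : Matrix o o S) :
    (tensLeft o F * tensRight m F').trace = F.trace * F'.trace := by
  simp [Matrix.trace, tensLeft_mul_apply, tensRight_apply, Fintype.sum_prod_type, Finset.sum_mul,
    Finset.mul_sum]
  exact Finset.sum_comm

theorem trace_tensRight_mul_tensLeft (F : Matrix m m S) (F' : Matrix o o S) :
    (tensRight m F' * tensLeft o F).trace = F'.trace * F.trace := by
  simp only [Matrix.trace, Matrix.diag_apply, tensRight_mul_apply, tensLeft_apply,
    Fintype.sum_prod_type, Finset.sum_mul, Finset.mul_sum, mul_ite, mul_zero]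
  rw [Finset.sum_comm]
  simp only [Finset.sum_ite_eq', Finset.mem_univ, if_true]
  exact Finset.sum_comm

theorem tensLeft_commute_tensRight {F : Matrix m m S} {F' : Matrix o o S}
    (h : ∀ i j k l, Commute (F i j) (F' k l)) : Commute (tensLeft o F) (tensRight m F') := by
  ext i j
  rw [tensLeft_mul_apply, tensRight_mul_apply]
  simp [tensLeft_apply, tensRight_apply, (h _ _ _ _).eq]

omit [DecidableEq m] in
-- Over a noncommutative ring the trace is not cyclic; this is the substitute used throughout, where
-- only entries that meet in the trace have to commute.
theorem trace_mul_comm_of_commute {A B : Matrix m m S} (h : ∀ i j, Commute (A i j) (B j i)) :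
    (A * B).trace = (B * A).trace := by
  simp only [Matrix.trace, Matrix.diag_apply, Matrix.mul_apply]
  rw [Finset.sum_comm]
  simp only [(h _ _).eq]

/-- If `x` commutes with the entries of a matrix, then it commutes with those of the inverse. -/
theorem commute_inverse_apply {x : S} {A B : Matrix m m S} (hAB : A * B = 1) (hBA : B * A = 1)
    (h : ∀ i j, Commute x (A i j)) (i j : m) : Commute x (B i j) := by
  have h1 : Commute (Matrix.scalar m x) A := by
    ext i j
    simp [(h i j).eq]
  have h2 : Commute (Matrix.scalar m x) B := Commute.units_inv_right (u := ⟨A, B, hAB, hBA⟩) h1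
  have := congrFun (congrFun h2.eq i) j
  simpa [Commute, SemiconjBy] using this

/-- Matrices with entries in the centralizer of `x` form a subring. -/
theorem commute_prod_apply {x : S} {As : List (Matrix m m S)}
    (h : ∀ A ∈ As, ∀ i j, Commute x (A i j)) (i j : m) : Commute x (As.prod i j) := by
  have : As.prod ∈ (Subring.centralizer {x}).matrix (n := m) :=
    list_prod_mem fun A hA i j => Subring.mem_centralizer_iff.2 fun y hy => by
      rw [Set.mem_singleton_iff.1 hy]
      exact h A hA i j
  exact Subring.mem_centralizer_iff.1 (this i j) x rfl

end Tensor

end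

end Toda

namespace Toda

noncomputable section

/-! ### The fused R-matrix -/

section UnitProducts

variable {M : Type*} [Monoid M] {l : ℕ}

/-- `u` and its inverse preserve the range of `P`. -/
def UnitPreserves (P : M) (u : Mˣ) : Prop :=
  P * u * P = u * P ∧ P * (u⁻¹ : Mˣ) * P = (u⁻¹ : Mˣ) * P

theorem UnitPreserves.one (P : M) (hP : P * P = P) : UnitPreserves P 1 := by
  simp [UnitPreserves, hP]

theorem UnitPreserves.mul {P : M} {u v : Mˣ} (hu : UnitPreserves P u) (hv : UnitPreserves P v) :
    UnitPreserves P (u * v) := by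
  have key : ∀ {a b : M}, P * a * P = a * P → P * b * P = b * P → P * (a * b) * P = a * b * P := by
    intro a b ha hb
    calc P * (a * b) * P = P * a * (b * P) := by simp only [mul_assoc]
      _ = (P * a * P) * b * P := by rw [← hb]; simp only [mul_assoc]
      _ = a * (P * b * P) := by rw [ha]; simp only [mul_assoc]
      _ = a * b * P := by rw [hb, mul_assoc]
  constructor
  · rw [Units.val_mul]
    exact key hu.1 hv.1
  · rw [mul_inv_rev, Units.val_mul]
    exact key hv.2 hu.2

theorem UnitPreserves.inv {P : M} {u : Mˣ} (hu : UnitPreserves P u) : UnitPreserves P u⁻¹ :=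
  ⟨hu.2, by rw [inv_inv]; exact hu.1⟩

theorem UnitPreserves.list_prod {P : M} (hP : P * P = P) {us : List Mˣ}
    (h : ∀ u ∈ us, UnitPreserves P u) : UnitPreserves P us.prod := by
  induction us with
  | nil => exact UnitPreserves.one P hP
  | cons u us ih =>
    rw [List.prod_cons]
    exact (h u (by simp)).mul (ih fun v hv => h v (by simp [hv]))

theorem units_exchange_inv {R : M} {x y : Mˣ} (h : R * x * y = y * x * R) :
    (x⁻¹ : Mˣ) * (y⁻¹ : Mˣ) * R = R * (y⁻¹ : Mˣ) * (x⁻¹ : Mˣ) := by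
  calc ((x⁻¹ : Mˣ) : M) * (y⁻¹ : Mˣ) * R
      = (x⁻¹ : Mˣ) * (y⁻¹ : Mˣ) * (R * x * y) * (y⁻¹ : Mˣ) * (x⁻¹ : Mˣ) := by
        simp only [mul_assoc, Units.mul_inv, mul_one]
    _ = R * (y⁻¹ : Mˣ) * (x⁻¹ : Mˣ) := by
        rw [h]
        simp only [mul_assoc, Units.inv_mul_cancel_left]

theorem units_val_list_prod (us : List Mˣ) :
    ((us.prod : Mˣ) : M) = (us.map (Units.val : Mˣ → M)).prod :=
  map_list_prod (Units.coeHom M) us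

/-- The inverses satisfy the opposite exchange relation, and the inverse of a descending product is
the ascending product of inverses, so the inverse preserves the range for the same reason. -/
theorem unitPreserves_desc {k : ℕ} (hk : k + 1 < l) {P R H : M} (hRH : R * H = P) (hPR : P * R = R)
    {x : Fin l → Mˣ}
    (h : R * x ⟨k, by omega⟩ * x ⟨k + 1, hk⟩ = x ⟨k + 1, hk⟩ * x ⟨k, by omega⟩ * R)
    (hP : ∀ j, j ≠ ⟨k, by omega⟩ → j ≠ ⟨k + 1, hk⟩ → Commute P (x j)) :
    UnitPreserves P ((List.finRange l).reverse.map x).prod := by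
  constructor
  · have := prod_finRange_reverse_preserves hk (x := fun j => (x j : M))
      (preserves_of_exchange hRH hPR (h.symm.trans (mul_assoc _ _ _))) hP
    simpa [units_val_list_prod, Function.comp_def] using this
  · have := prod_finRange_preserves hk (x := fun j => ((x j)⁻¹ : Mˣ).val)
      (preserves_of_exchange hRH hPR ((units_exchange_inv h).trans (mul_assoc _ _ _)))
      (fun j h1 h2 => (hP j h1 h2).units_inv_right)
    simpa [List.prod_inv_reverse, units_val_list_prod, Function.comp_def] using this

/-- An ascending product is the inverse of the descending product of the inverses, which reduces
this case to `unitPreserves_desc`. -/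
theorem unitPreserves_asc {k : ℕ} (hk : k + 1 < l) {P R H : M} (hRH : R * H = P) (hPR : P * R = R)
    {x : Fin l → Mˣ}
    (h : R * x ⟨k + 1, hk⟩ * x ⟨k, by omega⟩ = x ⟨k, by omega⟩ * x ⟨k + 1, hk⟩ * R)
    (hP : ∀ j, j ≠ ⟨k, by omega⟩ → j ≠ ⟨k + 1, hk⟩ → Commute P (x j)) :
    UnitPreserves P ((List.finRange l).map x).prod := by
  have := (unitPreserves_desc hk hRH hPR (x := fun j => (x j)⁻¹)
    (by rw [units_exchange_inv h]) (fun j h1 h2 => (hP j h1 h2).units_inv_right)).inv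
  simpa [List.prod_inv_reverse, Function.comp_def] using this

end UnitProducts

section FusedR

open Sum

variable {N l l' : ℕ} {S K : Type*} [Ring S]

/-- Two families of tensor factors. -/
abbrev splitEquiv (N l l' : ℕ) :
    (Fin l ⊕ Fin l' → Fin N) ≃ (Fin l → Fin N) × (Fin l' → Fin N) :=
  Equiv.sumArrowEquivProdArrow _ _ _

variable (l') in
/-- The action of an operator in the first `l` tensor factors. -/
def liftLeft : Matrix (Fin l → Fin N) (Fin l → Fin N) S →+*
    Matrix (Fin l ⊕ Fin l' → Fin N) (Fin l ⊕ Fin l' → Fin N) S :=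
  (Matrix.reindexRingEquiv S (splitEquiv N l l').symm).toRingHom.comp (tensLeft (Fin l' → Fin N))

variable (l) in
/-- The action of an operator in the last `l'` tensor factors. -/
def liftRight : Matrix (Fin l' → Fin N) (Fin l' → Fin N) S →+*
    Matrix (Fin l ⊕ Fin l' → Fin N) (Fin l ⊕ Fin l' → Fin N) S :=
  (Matrix.reindexRingEquiv S (splitEquiv N l l').symm).toRingHom.comp (tensRight (Fin l → Fin N))

theorem liftLeft_embed (k : Fin l) (A : Matrix (Fin N) (Fin N) S) :
    liftLeft l' (embed k A) = embed (inl k : Fin l ⊕ Fin l') A := by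
  ext i j
  change (if (i ∘ inr : Fin l' → Fin N) = j ∘ inr then embed k A (i ∘ inl) (j ∘ inl) else 0) = _
  have e : (∀ m, m ≠ (inl k : Fin l ⊕ Fin l') → i m = j m) ↔
      (i ∘ inr = j ∘ inr ∧ ∀ m, m ≠ k → (i ∘ inl) m = (j ∘ inl) m) := by
    simp [Sum.forall, funext_iff, and_comm]
  rw [embed, embed, Matrix.of_apply, Matrix.of_apply]
  by_cases h1 : (∀ m, m ≠ (inl k : Fin l ⊕ Fin l') → i m = j m)
  · rw [if_pos h1, if_pos (e.1 h1).1, if_pos (e.1 h1).2]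
    rfl
  · rw [if_neg h1]
    split_ifs with h2 h3
    exacts [absurd (e.2 ⟨h2, h3⟩) h1, rfl, rfl]

theorem liftRight_embed (k : Fin l') (A : Matrix (Fin N) (Fin N) S) :
    liftRight l (embed k A) = embed (inr k : Fin l ⊕ Fin l') A := by
  ext i j
  change (if (i ∘ inl : Fin l → Fin N) = j ∘ inl then embed k A (i ∘ inr) (j ∘ inr) else 0) = _
  have e : (∀ m, m ≠ (inr k : Fin l ⊕ Fin l') → i m = j m) ↔
      (i ∘ inl = j ∘ inl ∧ ∀ m, m ≠ k → (i ∘ inr) m = (j ∘ inr) m) := by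
    simp [Sum.forall, funext_iff]
  rw [embed, embed, Matrix.of_apply, Matrix.of_apply]
  by_cases h1 : (∀ m, m ≠ (inr k : Fin l ⊕ Fin l') → i m = j m)
  · rw [if_pos h1, if_pos (e.1 h1).1, if_pos (e.1 h1).2]
    rfl
  · rw [if_neg h1]
    split_ifs with h2 h3
    exacts [absurd (e.2 ⟨h2, h3⟩) h1, rfl, rfl]

theorem liftLeft_mul_apply {γ : Type*} (T : Matrix (Fin l → Fin N) (Fin l → Fin N) S)
    (X : Matrix (Fin l ⊕ Fin l' → Fin N) γ S) (i : Fin l ⊕ Fin l' → Fin N) (c : γ) :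
    (liftLeft l' T * X) i c = ∑ j, T (i ∘ inl) j * X (Sum.elim j (i ∘ inr)) c := by
  have := tensLeft_mul_apply T (X.submatrix (splitEquiv N l l').symm id) (splitEquiv N l l' i) c
  rw [Matrix.mul_apply, ← (splitEquiv N l l').sum_comp] at this
  rw [Matrix.mul_apply]
  refine Eq.trans (Finset.sum_congr rfl fun j _ => ?_) this
  rw [Matrix.submatrix_apply, Equiv.symm_apply_apply]
  rfl

theorem liftRight_mul_apply {γ : Type*} (T : Matrix (Fin l' → Fin N) (Fin l' → Fin N) S)
    (X : Matrix (Fin l ⊕ Fin l' → Fin N) γ S) (i : Fin l ⊕ Fin l' → Fin N) (c : γ) :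
    (liftRight l T * X) i c = ∑ j, T (i ∘ inr) j * X (Sum.elim (i ∘ inl) j) c := by
  have := tensRight_mul_apply T (X.submatrix (splitEquiv N l l').symm id) (splitEquiv N l l' i) c
  rw [Matrix.mul_apply, ← (splitEquiv N l l').sum_comp] at this
  rw [Matrix.mul_apply]
  refine Eq.trans (Finset.sum_congr rfl fun j _ => ?_) this
  rw [Matrix.submatrix_apply, Equiv.symm_apply_apply]
  rfl

variable [CommRing K] [Algebra ℂ S] [Algebra ℂ K] [Algebra K S] [IsScalarTower ℂ K S]

variable (N S) in
/-- The tensor product of two matrices `antisymMatrix`. -/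
def antisymTensor (q : ℂˣ) (l l' : ℕ) :
    Matrix (Fin l ⊕ Fin l' → Fin N) ((Fin l ↪o Fin N) × (Fin l' ↪o Fin N)) S :=
  Matrix.of fun i J => antisymMatrix N S q l (i ∘ inl) J.1 * antisymMatrix N S q l' (i ∘ inr) J.2

theorem antisymMatrix_commute (q : ℂˣ) (i : Fin l → Fin N) (J : Fin l ↪o Fin N) (x : S) :
    Commute (antisymMatrix N S q l i J) x := Algebra.commutes _ _

theorem antisymTensor_mul_apply {γ : Type*} (q : ℂˣ)
    (X : Matrix ((Fin l ↪o Fin N) × (Fin l' ↪o Fin N)) γ S) (I : Fin l ↪o Fin N)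
    (I' : Fin l' ↪o Fin N) (c : γ) :
    (antisymTensor N S q l l' * X) (Sum.elim I I') c = X (I, I') c := by
  simp [Matrix.mul_apply, antisymTensor, antisymMatrix, qAntisym_apply_orderEmb,
    Fintype.sum_prod_type]

/-- Increasing components recover the coefficients, so identities between fused operators may be
verified after multiplication by `antisymTensor`. -/
theorem antisymTensor_mul_cancel {γ : Type*} {q : ℂˣ}
    {X Y : Matrix ((Fin l ↪o Fin N) × (Fin l' ↪o Fin N)) γ S}
    (h : antisymTensor N S q l l' * X = antisymTensor N S q l l' * Y) : X = Y := by
  ext I c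
  rw [← antisymTensor_mul_apply q X, h, antisymTensor_mul_apply]

theorem liftLeft_mul_antisymTensor {q : ℂˣ} {T : Matrix (Fin l → Fin N) (Fin l → Fin N) S}
    (h : Preserves q T) : liftLeft l' T * antisymTensor N S q l l' =
      antisymTensor N S q l l' * tensLeft (Fin l' ↪o Fin N) (fuse q T) := by
  ext i J
  have h1 := congrFun (congrFun h.mul_antisymMatrix (i ∘ inl)) J.1
  rw [Matrix.mul_apply, Matrix.mul_apply] at h1
  rw [liftLeft_mul_apply, Matrix.mul_apply]
  simp only [antisymTensor, Matrix.of_apply, tensLeft_apply, Fintype.sum_prod_type, mul_ite,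
    mul_zero, Finset.sum_ite_eq', Finset.mem_univ, if_true, Sum.elim_comp_inl, Sum.elim_comp_inr]
  simp only [← mul_assoc, ← Finset.sum_mul, h1]
  rw [Finset.sum_mul]
  refine Finset.sum_congr rfl fun I _ => ?_
  rw [mul_assoc, mul_assoc, (antisymMatrix_commute q (i ∘ inr) _ _).eq]

theorem liftRight_mul_antisymTensor {q : ℂˣ} {T : Matrix (Fin l' → Fin N) (Fin l' → Fin N) S}
    (h : Preserves q T) : liftRight l T * antisymTensor N S q l l' =
      antisymTensor N S q l l' * tensRight (Fin l ↪o Fin N) (fuse q T) := by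
  ext i J
  have h1 := congrFun (congrFun h.mul_antisymMatrix (i ∘ inr)) J.2
  rw [Matrix.mul_apply, Matrix.mul_apply] at h1
  rw [liftRight_mul_apply, Matrix.mul_apply]
  simp only [antisymTensor, Matrix.of_apply, tensRight_apply, Fintype.sum_prod_type_right, mul_ite,
    mul_zero, Finset.sum_ite_eq', Finset.mem_univ, if_true, Sum.elim_comp_inl, Sum.elim_comp_inr]
  simp only [(antisymMatrix_commute q (i ∘ inl) J.1 _).eq, ← mul_assoc, ← Finset.sum_mul, h1]
  rw [Finset.sum_mul]
  refine Finset.sum_congr rfl fun I _ => ?_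
  rw [mul_assoc, mul_assoc, (antisymMatrix_commute q _ _ _).symm.eq]

/-- The components of `X` along increasing multi-indices. -/
def restrictTensor {γ : Type*} (X : Matrix (Fin l ⊕ Fin l' → Fin N) γ S) :
    Matrix ((Fin l ↪o Fin N) × (Fin l' ↪o Fin N)) γ S :=
  Matrix.of fun I c => X (Sum.elim I.1 I.2) c

/-- A tensor which is `q`-antisymmetric in the first `l` and in the last `l'` factors is a
combination of the columns of `antisymTensor`. -/
theorem eq_antisymTensor_mul {γ : Type*} {q : ℂˣ} {X : Matrix (Fin l ⊕ Fin l' → Fin N) γ S}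
    (h : ∀ i' c, IsAntisym (q : ℂ) fun i : Fin l → Fin N => X (Sum.elim i i') c)
    (h' : ∀ i c, IsAntisym (q : ℂ) fun i' : Fin l' → Fin N => X (Sum.elim i i') c) :
    X = antisymTensor N S q l l' * restrictTensor X := by
  ext i c
  rw [Matrix.mul_apply, Fintype.sum_prod_type]
  have h1 := (h (i ∘ inr) c).eq_sum q (i ∘ inl)
  simp only [Sum.elim_comp_inl_inr] at h1
  rw [h1]
  refine Finset.sum_congr rfl fun I _ => ?_
  rw [(h' I c).eq_sum q (i ∘ inr), Finset.smul_sum]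
  refine Finset.sum_congr rfl fun I' _ => ?_
  simp [antisymTensor, antisymMatrix, restrictTensor, Algebra.smul_def, mul_assoc]

variable (K) in
/-- `q` as a scalar in a `ℂ`-algebra. -/
abbrev scalarUnit (q : ℂˣ) : Kˣ := Units.map (algebraMap ℂ K : ℂ →* K) q

theorem sumElim_comp_swap_inl {n : Type*} (i : Fin l → n) (i' : Fin l' → n) (a b : Fin l) :
    Sum.elim i i' ∘ Equiv.swap (inl a) (inl b) = Sum.elim (i ∘ Equiv.swap a b) i' := by
  funext m
  rcases m with m | m
  · rw [Function.comp_apply, Sum.inl_injective.swap_apply]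
    rfl
  · rw [Function.comp_apply, Equiv.swap_apply_of_ne_of_ne (by simp) (by simp)]
    rfl

theorem sumElim_comp_swap_inr {n : Type*} (i : Fin l → n) (i' : Fin l' → n) (a b : Fin l') :
    Sum.elim i i' ∘ Equiv.swap (inr a) (inr b) = Sum.elim i (i' ∘ Equiv.swap a b) := by
  funext m
  rcases m with m | m
  · rw [Function.comp_apply, Equiv.swap_apply_of_ne_of_ne (by simp) (by simp)]
    rfl
  · rw [Function.comp_apply, Sum.inr_injective.swap_apply]
    rfl

theorem antisymProj_inl_mul_eq_self {γ : Type*} {q : ℂˣ} {X : Matrix (Fin l ⊕ Fin l' → Fin N) γ S} :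
    (∀ (k : ℕ) (hk : k + 1 < l), antisymProj (Fin N) S (scalarUnit K q)
        (inl ⟨k, by omega⟩ : Fin l ⊕ Fin l') (inl ⟨k + 1, hk⟩) * X = X) ↔
      ∀ i' c, IsAntisym (q : ℂ) fun i : Fin l → Fin N => X (Sum.elim i i') c := by
  simp only [antisymProj_mul_eq_self]
  constructor
  · intro h i' c k hk i
    have := h k hk (Sum.elim i i') c
    simpa [← map_neg, algebraMap_smul, sumElim_comp_swap_inl] using this
  · intro h k hk i c
    have := h (i ∘ inr) c k hk (i ∘ inl)
    dsimp only at this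
    rw [← sumElim_comp_swap_inl, Sum.elim_comp_inl_inr] at this
    simpa [← map_neg, algebraMap_smul] using this

theorem antisymProj_inr_mul_eq_self {γ : Type*} {q : ℂˣ} {X : Matrix (Fin l ⊕ Fin l' → Fin N) γ S} :
    (∀ (k : ℕ) (hk : k + 1 < l'), antisymProj (Fin N) S (scalarUnit K q)
        (inr ⟨k, by omega⟩ : Fin l ⊕ Fin l') (inr ⟨k + 1, hk⟩) * X = X) ↔
      ∀ i c, IsAntisym (q : ℂ) fun i' : Fin l' → Fin N => X (Sum.elim i i') c := by
  simp only [antisymProj_mul_eq_self]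
  constructor
  · intro h i c k hk i'
    have := h k hk (Sum.elim i i') c
    simpa [← map_neg, algebraMap_smul, sumElim_comp_swap_inr] using this
  · intro h k hk i c
    have := h (i ∘ inl) c k hk (i ∘ inr)
    dsimp only at this
    rw [← sumElim_comp_swap_inr, Sum.elim_comp_inl_inr] at this
    simpa [← map_neg, algebraMap_smul] using this

theorem isAntisym_antisymTensor_inl (q : ℂˣ) (i' : Fin l' → Fin N)
    (J : (Fin l ↪o Fin N) × (Fin l' ↪o Fin N)) :
    IsAntisym (q : ℂ) fun i => antisymTensor N S q l l' (Sum.elim i i') J := by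
  intro k hk i
  have := isAntisym_of_antisymProj_mul (antisymProj_mul_antisymMatrix (N := N) (S := S) q) J.1 k hk i
  dsimp only at this
  simp only [antisymTensor, Matrix.of_apply, Sum.elim_comp_inl, Sum.elim_comp_inr]
  exact ⟨fun h => by rw [this.1 h, zero_mul], fun h => by rw [this.2 h, smul_mul_assoc]⟩

theorem isAntisym_antisymTensor_inr (q : ℂˣ) (i : Fin l → Fin N)
    (J : (Fin l ↪o Fin N) × (Fin l' ↪o Fin N)) :
    IsAntisym (q : ℂ) fun i' => antisymTensor N S q l l' (Sum.elim i i') J := by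
  intro k hk i'
  have := isAntisym_of_antisymProj_mul (antisymProj_mul_antisymMatrix (N := N) (S := S) q) J.2 k hk
    i'
  dsimp only at this
  simp only [antisymTensor, Matrix.of_apply, Sum.elim_comp_inl, Sum.elim_comp_inr]
  exact ⟨fun h => by rw [this.1 h, mul_zero], fun h => by rw [this.2 h, mul_smul_comm]⟩

/-- The restriction of an operator to the tensor product of two spaces of `q`-antisymmetric
tensors. -/
def fuseTensor (q : ℂˣ) (A : Matrix (Fin l ⊕ Fin l' → Fin N) (Fin l ⊕ Fin l' → Fin N) S) :
    Matrix ((Fin l ↪o Fin N) × (Fin l' ↪o Fin N)) ((Fin l ↪o Fin N) × (Fin l' ↪o Fin N)) S :=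
  restrictTensor (A * antisymTensor N S q l l')

/-- The analogue of `Preserves.mul_antisymMatrix` for an operator that mixes two families of factors
and need not be a tensor product: the columns of the product remain antisymmetric in each family
separately. -/
theorem mul_antisymTensor {q : ℂˣ}
    {A : Matrix (Fin l ⊕ Fin l' → Fin N) (Fin l ⊕ Fin l' → Fin N) S}
    (h : ∀ (k : ℕ) (hk : k + 1 < l),
      antisymProj (Fin N) S (scalarUnit K q) (inl ⟨k, by omega⟩ : Fin l ⊕ Fin l')
          (inl ⟨k + 1, hk⟩) * A *
        antisymProj (Fin N) S (scalarUnit K q) (inl ⟨k, by omega⟩ : Fin l ⊕ Fin l')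
          (inl ⟨k + 1, hk⟩) =
      A * antisymProj (Fin N) S (scalarUnit K q) (inl ⟨k, by omega⟩ : Fin l ⊕ Fin l')
          (inl ⟨k + 1, hk⟩))
    (h' : ∀ (k : ℕ) (hk : k + 1 < l'),
      antisymProj (Fin N) S (scalarUnit K q) (inr ⟨k, by omega⟩ : Fin l ⊕ Fin l')
          (inr ⟨k + 1, hk⟩) * A *
        antisymProj (Fin N) S (scalarUnit K q) (inr ⟨k, by omega⟩ : Fin l ⊕ Fin l')
          (inr ⟨k + 1, hk⟩) =
      A * antisymProj (Fin N) S (scalarUnit K q) (inr ⟨k, by omega⟩ : Fin l ⊕ Fin l')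
          (inr ⟨k + 1, hk⟩)) :
    A * antisymTensor N S q l l' = antisymTensor N S q l l' * fuseTensor q A := by
  have h1 := (antisymProj_inl_mul_eq_self (K := K)).2
    (isAntisym_antisymTensor_inl (S := S) (N := N) (l := l) (l' := l') q)
  have h2 := (antisymProj_inr_mul_eq_self (K := K)).2
    (isAntisym_antisymTensor_inr (S := S) (N := N) (l := l) (l' := l') q)
  refine eq_antisymTensor_mul ((antisymProj_inl_mul_eq_self (K := K)).1 fun k hk => ?_)
    ((antisymProj_inr_mul_eq_self (K := K)).1 fun k hk => ?_)
  · conv_lhs => rw [← h1 k hk, ← Matrix.mul_assoc, ← Matrix.mul_assoc, h k hk, Matrix.mul_assoc,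
      h1 k hk]
  · conv_lhs => rw [← h2 k hk, ← Matrix.mul_assoc, ← Matrix.mul_assoc, h' k hk, Matrix.mul_assoc,
      h2 k hk]

end FusedR

end

end Toda

namespace Toda

noncomputable section

theorem rmatrix_commute_apply {S K n ι : Type*} [Ring S] [CommRing K] [Algebra K S]
    [LinearOrder n] [Fintype n] [Fintype ι] [DecidableEq ι] (q : Kˣ) (Z W : K) (p p' : ι) (s : S) (i j : ι → n) :
    Commute s (rmatrix n S q Z W p p' i j) := by
  rw [rmatrix, rmat, Matrix.of_apply]
  refine Commute.add_right ?_ ?_ <;> split_ifs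
  exacts [(Algebra.commutes _ _).symm, Commute.zero_right _, (Algebra.commutes _ _).symm,
    Commute.zero_right _]

section FusedR

open Sum

variable {N l l' : ℕ} {S K : Type*} [Ring S] [CommRing K] [Algebra ℂ S] [Algebra ℂ K] [Algebra K S]
  [IsScalarTower ℂ K S]

/-- The fused R-matrix exchanges fused L-operators. -/
theorem exists_fusedR (q : ℂˣ) {Z : Fin l → K} {W : Fin l' → K}
    (hZ : ∀ (k : ℕ) (hk : k + 1 < l), Z ⟨k + 1, hk⟩ = (scalarUnit K q : K) ^ 2 * Z ⟨k, by omega⟩)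
    (hW : ∀ (k : ℕ) (hk : k + 1 < l'), W ⟨k + 1, hk⟩ = (scalarUnit K q : K) ^ 2 * W ⟨k, by omega⟩)
    (hu : ∀ k m, IsUnit (((scalarUnit K q : K) * Z k - ((scalarUnit K q)⁻¹ : Kˣ) * W m) *
      ((scalarUnit K q : K) * W m - ((scalarUnit K q)⁻¹ : Kˣ) * Z k))) :
    ∃ R : Matrix ((Fin l ↪o Fin N) × (Fin l' ↪o Fin N)) ((Fin l ↪o Fin N) × (Fin l' ↪o Fin N)) S,
      IsUnit R ∧ (∀ s I J, Commute s (R I J)) ∧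
      ∀ (x : Fin l → Matrix (Fin N) (Fin N) S) (y : Fin l' → Matrix (Fin N) (Fin N) S),
        (∀ k m, rmatrix (Fin N) S (scalarUnit K q) (Z k) (W m) (inl k : Fin l ⊕ Fin l') (inr m) *
            embed (inl k) (x k) * embed (inr m) (y m) = embed (inr m) (y m) * embed (inl k) (x k) *
            rmatrix (Fin N) S (scalarUnit K q) (Z k) (W m) (inl k : Fin l ⊕ Fin l') (inr m)) →
        Preserves q (descProd x) → Preserves q (descProd y) →
        R * tensLeft (Fin l' ↪o Fin N) (fuse q (descProd x)) *
            tensRight (Fin l ↪o Fin N) (fuse q (descProd y)) =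
          tensRight (Fin l ↪o Fin N) (fuse q (descProd y)) *
            tensLeft (Fin l' ↪o Fin N) (fuse q (descProd x)) * R := by
  have hex : ∀ k m, ∃ u : (Matrix (Fin l ⊕ Fin l' → Fin N) (Fin l ⊕ Fin l' → Fin N) S)ˣ,
      (u : Matrix (Fin l ⊕ Fin l' → Fin N) (Fin l ⊕ Fin l' → Fin N) S) =
        rmatrix (Fin N) S (scalarUnit K q) (Z k) (W m) (inl k) (inr m) :=
    fun k m => isUnit_rmatrix (scalarUnit K q) (inl k) (inr m) (hu k m)
  choose r hr using hex
  -- For fixed `m` the R-matrices run over descending `k`, and `Ω` then runs over ascending `m`. In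
  -- this order neighbouring factors are adjacent in the way required by the Yang–Baxter equation,
  -- and the whole matches the descending products of `descProd`.
  let ρ : Fin l' → (Matrix (Fin l ⊕ Fin l' → Fin N) (Fin l ⊕ Fin l' → Fin N) S)ˣ :=
    fun m => ((List.finRange l).reverse.map fun k => r k m).prod
  have hρ : ∀ m, (ρ m : Matrix (Fin l ⊕ Fin l' → Fin N) (Fin l ⊕ Fin l' → Fin N) S) =
      ((List.finRange l).reverse.map fun k =>
        rmatrix (Fin N) S (scalarUnit K q) (Z k) (W m) (inl k) (inr m)).prod := fun m => by
    rw [units_val_list_prod, List.map_map]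
    simp only [Function.comp_def, hr]
  let Ω := ((List.finRange l').map ρ).prod
  have hΩ : (Ω : Matrix (Fin l ⊕ Fin l' → Fin N) (Fin l ⊕ Fin l' → Fin N) S) =
      ((List.finRange l').map fun m => ((List.finRange l).reverse.map fun k =>
        rmatrix (Fin N) S (scalarUnit K q) (Z k) (W m) (inl k) (inr m)).prod).prod := by
    rw [units_val_list_prod, List.map_map]
    simp only [Function.comp_def, hρ]
  have idem : ∀ p p' : Fin l ⊕ Fin l', antisymProj (Fin N) S (scalarUnit K q) p p' *
      antisymProj (Fin N) S (scalarUnit K q) p p' = antisymProj (Fin N) S (scalarUnit K q) p p' :=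
    fun p p' => by
      conv_lhs => rw [← rhat_mul_half (scalarUnit K q) p p', ← mul_assoc, rhat_mul_half,
        antisymProj_mul_rhat, rhat_mul_half]
  -- Antisymmetry in the first family is preserved by each `ρ m` separately.
  have hl : ∀ (k : ℕ) (hk : k + 1 < l), UnitPreserves (antisymProj (Fin N) S (scalarUnit K q)
      (inl ⟨k, by omega⟩ : Fin l ⊕ Fin l') (inl ⟨k + 1, hk⟩)) Ω := by
    intro k hk
    refine UnitPreserves.list_prod (idem _ _) fun u hu => ?_
    obtain ⟨m, -, rfl⟩ := List.mem_map.1 hu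
    refine unitPreserves_desc hk (rhat_mul_half _ _ _) (antisymProj_mul_rhat _ _ _) ?_ ?_
    · rw [hr, hr, hZ k hk]
      exact rhat_mul_rmatrix_mul_rmatrix _ _ _ (by simp) (by simp) (by simp)
    · intro j h1 h2
      rw [hr]
      exact rmat_commute_rmat (by simpa using h1) (by simpa using h2) (by simp) (by simp) _ _ _ _
  -- In the second family `rhat` has to pass two neighbouring blocks `ρ m` at once; `exchange_prod`
  -- assembles this from the Yang–Baxter equations for the individual `j`.
  have hl' : ∀ (k : ℕ) (hk : k + 1 < l'), UnitPreserves (antisymProj (Fin N) S (scalarUnit K q)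
      (inr ⟨k, by omega⟩ : Fin l ⊕ Fin l') (inr ⟨k + 1, hk⟩)) Ω := by
    intro k hk
    refine unitPreserves_asc hk (rhat_mul_half _ _ _) (antisymProj_mul_rhat _ _ _) ?_ ?_
    · rw [hρ, hρ]
      refine exchange_prod (List.nodup_reverse.2 (List.nodup_finRange l)) (fun j _ => ?_)
        fun i _ j _ hij => ?_
      · rw [hW k hk]
        exact (rmatrix_mul_rmatrix_mul_rhat _ _ _ (by simp) (by simp) (by simp)).symm
      · exact rmat_commute_rmat (by simpa using hij.symm) (by simp) (by simp) (by simp) _ _ _ _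
    · intro j h1 h2
      rw [hρ]
      refine commute_list_map_prod fun i _ => ?_
      exact rmat_commute_rmat (by simp) (by simp) (by simpa using h1) (by simpa using h2) _ _ _ _
  have h1 := mul_antisymTensor (K := K) (fun k hk => (hl k hk).1) fun k hk => (hl' k hk).1
  -- Invertibility of `Ω` alone would not make its restriction invertible; the inverse must preserve
  -- the subspace as well.
  have h2 := mul_antisymTensor (K := K) (fun k hk => (hl k hk).2) fun k hk => (hl' k hk).2
  refine ⟨fuseTensor q (Ω : Matrix (Fin l ⊕ Fin l' → Fin N) (Fin l ⊕ Fin l' → Fin N) S),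
    ⟨⟨fuseTensor q Ω, fuseTensor q (Ω⁻¹ : (Matrix _ _ S)ˣ), ?_, ?_⟩, rfl⟩, ?_, ?_⟩
  · refine antisymTensor_mul_cancel (q := q) ?_
    rw [← Matrix.mul_assoc, ← h1, Matrix.mul_assoc, ← h2, ← Matrix.mul_assoc, Units.mul_inv,
      Matrix.one_mul, Matrix.mul_one]
  · refine antisymTensor_mul_cancel (q := q) ?_
    rw [← Matrix.mul_assoc, ← h2, Matrix.mul_assoc, ← h1, ← Matrix.mul_assoc, Units.inv_mul,
      Matrix.one_mul, Matrix.mul_one]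
  · intro s I J
    rw [fuseTensor, restrictTensor, Matrix.of_apply, Matrix.mul_apply]
    refine Commute.sum_right _ _ _ fun i _ => Commute.mul_right ?_ ?_
    · rw [hΩ]
      refine commute_prod_apply (fun A hA i j => ?_) _ _
      obtain ⟨m, -, rfl⟩ := List.mem_map.1 hA
      refine commute_prod_apply (fun A hA i j => ?_) _ _
      obtain ⟨k, -, rfl⟩ := List.mem_map.1 hA
      exact rmatrix_commute_apply _ _ _ _ _ _ _ _
    · exact Commute.mul_right (antisymMatrix_commute q _ _ _).symm
        (antisymMatrix_commute q _ _ _).symm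
  · intro x y hxy hx hy
    have h3 := liftLeft_mul_antisymTensor (l' := l') hx
    have h4 := liftRight_mul_antisymTensor (l := l) hy
    have key : (Ω : Matrix (Fin l ⊕ Fin l' → Fin N) (Fin l ⊕ Fin l' → Fin N) S) *
        liftLeft l' (descProd x) * liftRight l (descProd y) =
        liftRight l (descProd y) * liftLeft l' (descProd x) *
          (Ω : Matrix (Fin l ⊕ Fin l' → Fin N) (Fin l ⊕ Fin l' → Fin N) S) := by
      rw [descProd, descProd, map_list_prod, map_list_prod, List.map_map, List.map_map]
      simp only [Function.comp_def, liftLeft_embed, liftRight_embed]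
      rw [hΩ]
      have := exchange_prod_prod (ks := (List.finRange l).reverse) (ms := (List.finRange l').reverse)
        (List.nodup_reverse.2 (List.nodup_finRange l))
        (List.nodup_reverse.2 (List.nodup_finRange l')) hxy
        (fun k j m hkj => rmat_commute_embed (by simpa using hkj.symm) (by simp) _ _ _)
        (fun k m j hmj => rmat_commute_embed (by simp) (by simpa using hmj.symm) _ _ _)
      rwa [List.reverse_reverse] at this
    -- In the relation for the full tensor space, `antisymTensor` is moved to the left through one
    -- operator after another, which replaces each by its fused version.
    refine antisymTensor_mul_cancel (q := q) ?_
    have key2 := congrArg (· * antisymTensor N S q l l') key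
    simp only [Matrix.mul_assoc, h1, h4] at key2 ⊢
    simp only [← Matrix.mul_assoc, h3, h4] at key2 ⊢
    simp only [Matrix.mul_assoc, h1] at key2 ⊢
    simp only [← Matrix.mul_assoc] at key2 ⊢
    exact key2

end FusedR

/-- The exchange relation conjugates one product into the other. As the entries of `R`, and hence of
its inverse, are central, the trace is invariant under this conjugation even over a noncommutative
ring. -/
theorem trace_mul_comm_of_exchange {S m : Type*} [Ring S] [Fintype m]
    [DecidableEq m] {R A B : Matrix m m S} (hR : IsUnit R) (hc : ∀ s i j, Commute s (R i j))
    (h : R * A * B = B * A * R) : (A * B).trace = (B * A).trace := by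
  obtain ⟨u, rfl⟩ := hR
  have hi : ∀ s i j, Commute s ((u⁻¹ : (Matrix m m S)ˣ) i j) := fun s i j =>
    commute_inverse_apply u.mul_inv u.inv_mul (hc s) i j
  calc (A * B).trace = ((u⁻¹ : (Matrix m m S)ˣ) * (B * A * u)).trace := by
        rw [← h, mul_assoc, Units.inv_mul_cancel_left]
    _ = (B * A * u * (u⁻¹ : (Matrix m m S)ˣ)).trace :=
        trace_mul_comm_of_commute fun i j => (hi _ _ _).symm
    _ = (B * A).trace := by rw [Units.mul_inv_cancel_right]

end

end Toda

namespace Toda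

noncomputable section

/-! ### Bidiagonal L-operators -/

section Bidiagonal

variable {N : ℕ} [NeZero N] {S K : Type*} [Ring S] [CommRing K] [Algebra K S]

/-- The matrix with diagonal entries `a i` and entries `b i` at `(i, i + 1)`, indices being
cyclic. -/
def bidiagonal (a b : Fin N → S) : Matrix (Fin N) (Fin N) S :=
  Matrix.of fun i j => (if j = i then a i else 0) + (if j = i + 1 then b i else 0)

theorem bidiagonal_apply (a b : Fin N → S) (i j : Fin N) :
    bidiagonal a b i j = (if j = i then a i else 0) + (if j = i + 1 then b i else 0) := rfl

/-- The commutation relations of one site. -/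
structure WeylRel (q r : K) (a b : Fin N → S) : Prop where
  aa : ∀ i j, Commute (a i) (a j)
  succ : ∀ i, a (i + 1) * b i = q • (b i * a (i + 1))
  same : ∀ i, a i * b i = r • (b i * a i)
  other : ∀ i j, i ≠ j → i ≠ j + 1 → Commute (a i) (b j)

theorem add_one_ne_self (hN : 2 ≤ N) (i : Fin N) : i + 1 ≠ i := by
  have : Fact (1 < N) := ⟨hN⟩
  intro h
  have h1 := congrArg Fin.val h
  rw [Fin.val_add, Fin.val_one', Nat.mod_eq_of_lt hN] at h1
  have := i.2
  by_cases hi : i.val + 1 < N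
  · rw [Nat.mod_eq_of_lt hi] at h1; omega
  · have : i.val + 1 = N := by omega
    rw [this, Nat.mod_self] at h1; omega

theorem val_add_one_of_ne {i : Fin N} (h : i + 1 ≠ 0) : (i + 1).val = i.val + 1 := by
  have hN : 2 ≤ N := by
    rcases N with _ | _ | N
    · exact i.elim0
    · exact absurd (Subsingleton.elim (α := Fin 1) _ _) h
    · omega
  have hi : i.val + 1 < N := by
    by_contra h2
    refine h (Fin.ext ?_)
    rw [Fin.val_add, Fin.val_one', Nat.mod_eq_of_lt hN, (by have := i.2; omega : i.val + 1 = N),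
      Nat.mod_self]
    rfl
  rw [Fin.val_add, Fin.val_one', Nat.mod_eq_of_lt hN, Nat.mod_eq_of_lt hi]

theorem val_of_add_one_eq_zero {i : Fin N} (h : i + 1 = 0) : i.val = N - 1 := by
  have h1 := congrArg Fin.val h
  have := i.2
  by_contra h2
  have hN : 2 ≤ N := by omega
  rw [Fin.val_add, Fin.val_one', Nat.mod_eq_of_lt hN, Nat.mod_eq_of_lt (by omega)] at h1
  simp at h1

variable {s t : K} {b b' : Fin N → S}

/-- Passing from `i` to `i + 1` changes the position relative to `j` only when the index wraps
around. There the weights `s` and `t` change places, which is compensated by the different spectral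
parameters in `b` and `b'`. -/
theorem upperLower_smul_left (hb : ∀ i, i + 1 ≠ 0 → b i = b' i)
    (hb' : ∀ i, i + 1 = 0 → s • b i = t • b' i) {i j : Fin N} (h : j ≠ i) (h' : j ≠ i + 1) :
    upperLower s t i j • b' i = upperLower s t (i + 1) j • b i := by
  have hij : j.val ≠ i.val := fun e => h (Fin.ext e)
  have hij' : j.val ≠ (i + 1).val := fun e => h' (Fin.ext e)
  by_cases hi : i + 1 = 0
  · have := val_of_add_one_eq_zero hi
    have := j.2
    have h0 : (i + 1).val = 0 := by rw [hi]; rfl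
    rw [upperLower_of_gt (Fin.lt_def.2 (by omega)), upperLower_of_lt (Fin.lt_def.2 (by omega)),
      hb' i hi]
  · have := val_add_one_of_ne hi
    rw [hb i hi]
    rcases lt_or_gt_of_ne hij with hlt | hlt
    · rw [upperLower_of_gt (Fin.lt_def.2 (by omega)), upperLower_of_gt (Fin.lt_def.2 (by omega))]
    · rw [upperLower_of_lt (Fin.lt_def.2 (by omega)), upperLower_of_lt (Fin.lt_def.2 (by omega))]

theorem upperLower_smul_right (hb : ∀ i, i + 1 ≠ 0 → b i = b' i)
    (hb' : ∀ i, i + 1 = 0 → s • b i = t • b' i) {i j : Fin N} (h : i ≠ j) (h' : i ≠ j + 1) :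
    upperLower s t i j • b j = upperLower s t i (j + 1) • b' j := by
  have hij : i.val ≠ j.val := fun e => h (Fin.ext e)
  have hij' : i.val ≠ (j + 1).val := fun e => h' (Fin.ext e)
  by_cases hi : j + 1 = 0
  · have := val_of_add_one_eq_zero hi
    have := i.2
    have h0 : (j + 1).val = 0 := by rw [hi]; rfl
    rw [upperLower_of_lt (Fin.lt_def.2 (by omega)), upperLower_of_gt (Fin.lt_def.2 (by omega)),
      hb' j hi]
  · have := val_add_one_of_ne hi
    rw [hb j hi]
    rcases lt_or_gt_of_ne hij with hlt | hlt
    · rw [upperLower_of_lt (Fin.lt_def.2 (by omega)), upperLower_of_lt (Fin.lt_def.2 (by omega))]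
    · rw [upperLower_of_gt (Fin.lt_def.2 (by omega)), upperLower_of_gt (Fin.lt_def.2 (by omega))]

theorem upperLower_smul_succ_left (hN : 2 ≤ N) (hb : ∀ i, i + 1 ≠ 0 → b i = b' i)
    (hb' : ∀ i, i + 1 = 0 → s • b i = t • b' i) (i : Fin N) :
    upperLower s t (i + 1) i • b i = t • b' i := by
  by_cases hi : i + 1 = 0
  · have := val_of_add_one_eq_zero hi
    have h0 : (i + 1).val = 0 := by rw [hi]; rfl
    rw [upperLower_of_lt (Fin.lt_def.2 (by omega)), hb' i hi]
  · have := val_add_one_of_ne hi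
    rw [upperLower_of_gt (Fin.lt_def.2 (by omega)), hb i hi]

theorem upperLower_smul_succ_right (hN : 2 ≤ N) (hb : ∀ i, i + 1 ≠ 0 → b i = b' i)
    (hb' : ∀ i, i + 1 = 0 → s • b i = t • b' i) (i : Fin N) :
    upperLower s t i (i + 1) • b' i = s • b i := by
  by_cases hi : i + 1 = 0
  · have := val_of_add_one_eq_zero hi
    have h0 : (i + 1).val = 0 := by rw [hi]; rfl
    rw [upperLower_of_gt (Fin.lt_def.2 (by omega)), hb' i hi]
  · have := val_add_one_of_ne hi
    rw [upperLower_of_lt (Fin.lt_def.2 (by omega)), hb i hi]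

theorem smul_smul_mul_comm (c : K) (x y : S) : c • (x * y) = (c • x) * y := (smul_mul_assoc c x y).symm

/-- The exchange relation of bidiagonal L-operators. -/
theorem exchange_bidiagonal (hN : 2 ≤ N) {q r u v : K} {a : Fin N → S} (h : WeylRel q r a b)
    (h' : WeylRel q r a b') (hbb : ∀ i j, Commute (b i) (b' j)) (hqr : q * r = 1)
    (hb : ∀ i, i + 1 ≠ 0 → b i = b' i) (hb' : ∀ i, i + 1 = 0 → s • b i = t • b' i)
    (hu : u = q * v + t) (hu' : u = r * v + s) :
    Exchange (diagOff u v) (upperLower s t) (bidiagonal a b) (bidiagonal a b') := by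
  have ne : ∀ i : Fin N, i + 1 ≠ i := add_one_ne_self hN
  have hl := @upperLower_smul_left N _ S K _ _ _ s t b b' hb hb'
  have hr := @upperLower_smul_right N _ S K _ _ _ s t b b' hb hb'
  have hsl := @upperLower_smul_succ_left N _ S K _ _ _ s t b b' hN hb hb'
  have hsr := @upperLower_smul_succ_right N _ S K _ _ _ s t b b' hN hb hb'
  have D : ∀ (a b : Fin N → S) i, bidiagonal a b i i = a i := fun a b i => by
    simp [bidiagonal_apply, (ne i).symm]
  have O : ∀ (a b : Fin N → S) i, bidiagonal a b i (i + 1) = b i := fun a b i => by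
    simp [bidiagonal_apply, ne i]
  have Z : ∀ (a b : Fin N → S) i j, j ≠ i → j ≠ i + 1 → bidiagonal a b i j = 0 := fun a b i j h1 h2 => by
    simp [bidiagonal_apply, h1, h2]
  have swap : ∀ i, b i * a i = q • (a i * b i) := fun i => by
    rw [h.same, smul_smul, hqr, one_smul]
  have swap' : ∀ i, b' i * a i = q • (a i * b' i) := fun i => by
    rw [h'.same, smul_smul, hqr, one_smul]
  have swaps : ∀ i, b i * a (i + 1) = r • (a (i + 1) * b i) := fun i => by
    rw [h.succ, smul_smul, mul_comm, hqr, one_smul]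
  have cases : ∀ i j : Fin N, j = i ∨ j = i + 1 ∨ (j ≠ i ∧ j ≠ i + 1) := fun i j => by tauto
  -- If exactly one of `i = j`, `m = k` holds, commuting some `a` past a neighbouring `b` produces a
  -- power of q, and `hu` or `hu'` accounts for it. If neither holds, the diagonal weights are equal
  -- and the two terms match separately, the second by the wrap-around identities.
  intro i j m k
  by_cases hij : i = j
  · subst hij
    rw [diagOff_self, upperLower_self, zero_smul, add_zero]
    by_cases hmk : m = k
    · subst hmk
      rw [diagOff_self, upperLower_self, zero_smul, add_zero]
      congr 1
      rcases cases i m with rfl | rfl | ⟨h1, h2⟩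
      · rw [D, D]
      · rw [O, O, (hbb i i).eq]
      · rw [Z _ _ _ _ h1 h2, Z _ _ _ _ h1 h2]
    · rw [diagOff_of_ne hmk]
      rcases cases i m with rfl | rfl | ⟨h1, h2⟩
      · rcases cases m k with rfl | rfl | ⟨h3, h4⟩
        · exact absurd rfl hmk
        · rw [D, D, O, O, ← mul_smul_comm (upperLower s t _ _), hsl, swap', hu, mul_smul_comm]
          module
        · simp [Z _ _ _ _ h3 h4]
      · rcases cases i k with rfl | rfl | ⟨h3, h4⟩
        · rw [D, D, O, O, smul_smul_mul_comm (upperLower s t _ _), hsr, h.same, hu', smul_mul_assoc]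
          module
        · exact absurd rfl hmk
        · simp [Z _ _ _ _ h3 h4]
      · simp [Z _ _ _ _ h1 h2]
  · rw [diagOff_of_ne hij]
    by_cases hmk : m = k
    · subst hmk
      rw [diagOff_self, upperLower_self, zero_smul, add_zero]
      rcases cases i m with rfl | rfl | ⟨h1, h2⟩
      · rcases cases j m with rfl | rfl | ⟨h3, h4⟩
        · exact absurd rfl hij
        · rw [D, D, O, O, smul_smul_mul_comm (upperLower s t _ _), hsl, h'.succ, hu, smul_mul_assoc]
          module
        · simp [Z _ _ _ _ h3 h4]
      · rcases cases j (i + 1) with rfl | hj | ⟨h3, h4⟩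
        · rw [D, D, O, O, ← mul_smul_comm (upperLower s t _ _), hsr, swaps, hu', mul_smul_comm]
          module
        · exact absurd (add_right_cancel hj) hij
        · simp [Z _ _ _ _ h3 h4]
      · simp [Z _ _ _ _ h1 h2]
    · rw [diagOff_of_ne hmk]
      refine congrArg₂ (· + ·) (congrArg _ ?_) ?_
      · rcases cases i m with rfl | rfl | ⟨h1, h2⟩
        · rcases cases j k with rfl | rfl | ⟨h3, h4⟩
          · rw [D, D, (h.aa _ _).eq]
          · rw [D, O, (h'.other _ _ hij hmk).eq]
          · simp [Z _ _ _ _ h3 h4]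
        · rcases cases j k with rfl | rfl | ⟨h3, h4⟩
          · rw [D, O, (h.other _ _ (Ne.symm hij) (Ne.symm hmk)).eq]
          · rw [O, O, (hbb _ _).eq]
          · simp [Z _ _ _ _ h3 h4]
        · simp [Z _ _ _ _ h1 h2]
      · rcases cases j m with rfl | rfl | ⟨h1, h2⟩
        · rcases cases i k with rfl | rfl | ⟨h3, h4⟩
          · rw [D, D, D, D]
          · rw [D, D, O, O, ← mul_smul_comm, ← mul_smul_comm, hl (Ne.symm hij) hmk]
          · simp [Z _ _ _ _ h3 h4]
        · rcases cases i k with rfl | rfl | ⟨h3, h4⟩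
          · rw [D, D, O, O, smul_smul_mul_comm, smul_smul_mul_comm, hr hij (Ne.symm hmk)]
          · rw [O, O, O, O]
            by_cases hj : j = i + 1
            · subst hj
              rw [← mul_smul_comm, hsr, smul_smul_mul_comm (upperLower s t _ _), hsr, mul_smul_comm,
                smul_mul_assoc]
            · rw [← mul_smul_comm, hl (Ne.symm hij) hj, mul_smul_comm, smul_smul_mul_comm,
                hr (Ne.symm hj) (fun e => hij (add_right_cancel e)), smul_mul_assoc]
          · simp [Z _ _ _ _ h3 h4]
        · simp [Z _ _ _ _ h1 h2]

/-- Transposition turns the exchange relation into the opposite one and interchanges the upper and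
lower weights of R. -/
theorem exchangeOp_bidiagonal_transpose (hN : 2 ≤ N) {q r u v : K} {a : Fin N → S}
    (h : WeylRel q r a b) (h' : WeylRel q r a b') (hbb : ∀ i j, Commute (b i) (b' j))
    (hqr : q * r = 1) (hb : ∀ i, i + 1 ≠ 0 → b i = b' i)
    (hb' : ∀ i, i + 1 = 0 → t • b i = s • b' i) (hu : u = q * v + s) (hu' : u = r * v + t) :
    ExchangeOp (diagOff u v) (upperLower s t) (bidiagonal a b).transpose
      (bidiagonal a b').transpose := by
  have key := exchange_bidiagonal hN h h' hbb hqr hb hb' hu hu'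
  have e : ∀ i j : Fin N, upperLower s t i j = upperLower t s j i := fun i j => by
    rcases lt_trichotomy i j with h | rfl | h
    · rw [upperLower_of_lt h, upperLower_of_gt h]
    · rw [upperLower_self, upperLower_self]
    · rw [upperLower_of_gt h, upperLower_of_lt h]
  intro i j m k
  simp only [Matrix.transpose_apply, e]
  exact key m k i j

end Bidiagonal

end

end Toda

namespace Toda

noncomputable section

/-! ### Matrices of power series -/

section PowerSeriesMatrix

variable {n R : Type*} [Fintype n] [DecidableEq n] [Ring R]

/-- A power series of matrices, as a matrix of power series. -/
def matrixOfPowerSeries : PowerSeries (Matrix n n R) →+* Matrix n n (PowerSeries R) where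
  toFun F := Matrix.of fun i j => PowerSeries.mk fun k => PowerSeries.coeff k F i j
  map_one' := by
    ext i j k
    by_cases hij : i = j <;> by_cases hk : k = 0 <;>
      simp [PowerSeries.coeff_one, hij, hk, Matrix.one_apply]
  map_zero' := by ext; simp
  map_add' F G := by ext; simp
  map_mul' F G := by
    ext i j k
    simp only [Matrix.of_apply, PowerSeries.coeff_mk, PowerSeries.coeff_mul, Matrix.mul_apply,
      Matrix.sum_apply, map_sum]
    exact Finset.sum_comm

/-- A matrix of power series is a power series with matrix coefficients, and such a series is
invertible as soon as its constant term is. -/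
theorem isUnit_of_constantCoeff {P : Matrix n n (PowerSeries R)}
    (h : IsUnit (P.map PowerSeries.constantCoeff)) : IsUnit P := by
  have e : matrixOfPowerSeries (PowerSeries.mk fun k => P.map (PowerSeries.coeff k)) = P := by
    ext i j k
    simp [matrixOfPowerSeries]
  rw [← e]
  refine IsUnit.map _ (PowerSeries.isUnit_iff_constantCoeff.2 ?_)
  convert h using 1
  rw [← PowerSeries.coeff_zero_eq_constantCoeff_apply, PowerSeries.coeff_mk]
  ext i j
  simp

theorem isNilpotent_of_strictlyLower {N : ℕ} {X : Matrix (Fin N) (Fin N) R}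
    (h : ∀ i j, i ≤ j → X i j = 0) : IsNilpotent X := by
  have key : ∀ (k : ℕ) (i j : Fin N), i.val < j.val + k → (X ^ k) i j = 0 := by
    intro k
    induction k with
    | zero =>
      intro i j hij
      rw [pow_zero, Matrix.one_apply_ne]
      rintro rfl
      simp at hij
    | succ k ih =>
      intro i j hij
      rw [pow_succ', Matrix.mul_apply]
      refine Finset.sum_eq_zero fun m _ => ?_
      by_cases him : i ≤ m
      · rw [h i m him, zero_mul]
      · rw [ih m j (by have := Fin.lt_def.1 (not_le.1 him); omega), mul_zero]
  exact ⟨N, Matrix.ext fun i j => key N i j (by omega)⟩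

/-- After the invertible diagonal is divided out, what remains is one plus a strictly lower
triangular, hence nilpotent, matrix; this needs no commutativity. -/
theorem isUnit_of_lower {N : ℕ} {T : Matrix (Fin N) (Fin N) R} (h : ∀ i j, i < j → T i j = 0)
    (hd : ∀ i, IsUnit (T i i)) : IsUnit T := by
  choose u hu using hd
  let D : (Matrix (Fin N) (Fin N) R)ˣ :=
    ⟨Matrix.diagonal fun i => (u i : R), Matrix.diagonal fun i => ((u i)⁻¹ : Rˣ), by simp, by simp⟩
  have e : T = D * (1 + (D⁻¹ : (Matrix (Fin N) (Fin N) R)ˣ) * (T - D)) := by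
    rw [mul_add, Units.mul_inv_cancel_left, mul_one, add_sub_cancel]
  rw [e]
  refine D.isUnit.mul (IsNilpotent.isUnit_one_add (isNilpotent_of_strictlyLower fun i j hij => ?_))
  have : ((D⁻¹ : (Matrix (Fin N) (Fin N) R)ˣ) : Matrix (Fin N) (Fin N) R) =
    Matrix.diagonal fun i => (((u i)⁻¹ : Rˣ) : R) := rfl
  rw [this, Matrix.diagonal_mul, Matrix.sub_apply]
  rcases hij.lt_or_eq with hlt | rfl
  · rw [h i j hlt, show (D : Matrix (Fin N) (Fin N) R) i j = 0 from Matrix.diagonal_apply_ne _ hlt.ne,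
      sub_zero, mul_zero]
  · rw [← hu, show (D : Matrix (Fin N) (Fin N) R) i i = u i from Matrix.diagonal_apply_eq _ _, sub_self,
      mul_zero]

end PowerSeriesMatrix

/-! ### L-operators over Laurent series -/

section Laurent

open HahnSeries

variable {N : ℕ} [NeZero N] {R : Type*} [Ring R] [Algebra ℂ R]

theorem smul_single (c : ℂ) (d : ℤ) (x : R) :
    c • (single d x : LaurentSeries R) = single d (c • x) := by
  ext k
  by_cases h : k = d
  · subst h; simp
  · simp [coeff_single_of_ne h]

/-- The entries off the diagonal of the L-operators. -/
def laurentOff (d : ℤ) (b : Fin N → R) (c : ℂˣ) (i : Fin N) : LaurentSeries R :=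
  if i + 1 = 0 then single d (((c ^ d : ℂˣ) : ℂ) • b i) else single 0 (b i)

theorem Lplus_eq (a b : Fin N → Rˣ) (c : ℂˣ) : Lplus a b c =
    bidiagonal (fun i => single 0 (a i : R)) (laurentOff (-2) (fun i => (b i : R)) c) := rfl

theorem Lminus_eq (a b : Fin N → Rˣ) (c : ℂˣ) : Lminus a b c =
    (bidiagonal (fun i => single 0 ((a i)⁻¹.val : R))
      (laurentOff 2 (fun i => (b i : R)) c)).transpose := rfl

theorem exists_laurentOff (d : ℤ) (b : Fin N → R) (c : ℂˣ) (i : Fin N) :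
    ∃ (e : ℤ) (x : ℂ), laurentOff d b c i = single e (x • b i) := by
  rw [laurentOff]
  split_ifs
  · exact ⟨_, _, rfl⟩
  · exact ⟨0, 1, by rw [one_smul]⟩

theorem laurentOff_commute (d d' : ℤ) {b b' : Fin N → R} {i j : Fin N} (h : Commute (b i) (b' j))
    (c c' : ℂˣ) : Commute (laurentOff d b c i) (laurentOff d' b' c' j) := by
  obtain ⟨e, x, h1⟩ := exists_laurentOff d b c i
  obtain ⟨e', x', h2⟩ := exists_laurentOff d' b' c' j
  rw [h1, h2, Commute, SemiconjBy, single_mul_single, single_mul_single, add_comm,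
    ((h.smul_left x).smul_right x').eq]

theorem single_commute_laurentOff (d : ℤ) {b : Fin N → R} {x : R} {j : Fin N}
    (h : Commute x (b j)) (c : ℂˣ) : Commute (single 0 x) (laurentOff d b c j) := by
  obtain ⟨e', x', h2⟩ := exists_laurentOff d b c j
  rw [h2, Commute, SemiconjBy, single_mul_single, single_mul_single, add_comm,
    (h.smul_right x').eq]

theorem single_mul_laurentOff (d : ℤ) {b : Fin N → R} {x : R} {j : Fin N} {p : ℂ}
    (h : x * b j = p • (b j * x)) (c : ℂˣ) :
    single 0 x * laurentOff d b c j = p • (laurentOff d b c j * single 0 x) := by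
  obtain ⟨e', x', h2⟩ := exists_laurentOff d b c j
  rw [h2, single_mul_single, single_mul_single, smul_single, add_comm, mul_smul_comm, h,
    smul_mul_assoc, smul_comm]

theorem WeylRel.laurent {q r : ℂ} {a b : Fin N → R} (h : WeylRel q r a b) (d : ℤ) (c : ℂˣ) :
    WeylRel q r (fun i => (single 0 (a i) : LaurentSeries R)) (laurentOff d b c) where
  aa i j := (h.aa i j).map C
  succ i := single_mul_laurentOff d (h.succ i) c
  same i := single_mul_laurentOff d (h.same i) c
  other i j h1 h2 := single_commute_laurentOff d (h.other i j h1 h2) c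

/-- The defining relations of `A_q(N)`. -/
structure SiteRel (q : ℂˣ) (a b : Fin N → Rˣ) : Prop where
  weyl : WeylRel (q : ℂ) ((q⁻¹ : ℂˣ) : ℂ) (fun i => (a i : R)) (fun i => (b i : R))
  bb : ∀ i j, Commute (b i : R) (b j)

theorem inv_mul_eq_smul {c d : ℂ} (hcd : d * c = 1) {x : Rˣ} {y : R} (h : x * y = c • (y * x)) :
    (x⁻¹ : Rˣ) * y = d • (y * (x⁻¹ : Rˣ)) := by
  have h1 : y * x = d • (x * y) := by rw [h, smul_smul, hcd, one_smul]
  calc (x⁻¹ : Rˣ) * y = (x⁻¹ : Rˣ) * (y * x) * (x⁻¹ : Rˣ) := by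
        rw [mul_assoc, Units.mul_inv_cancel_right]
    _ = _ := by rw [h1, mul_smul_comm, Units.inv_mul_cancel_left, smul_mul_assoc]

/-- Inverting the `a i` exchanges q and q⁻¹. This offsets the interchange of upper and lower weights
caused by transposing `L⁻`, so that the same R-matrix serves for `L⁺` and `L⁻`. -/
theorem SiteRel.weyl_inv {q : ℂˣ} {a b : Fin N → Rˣ} (h : SiteRel q a b) :
    WeylRel ((q⁻¹ : ℂˣ) : ℂ) (q : ℂ) (fun i => (((a i)⁻¹ : Rˣ) : R)) (fun i => (b i : R)) where
  aa i j := (h.weyl.aa i j).units_inv_left.units_inv_right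
  succ i := inv_mul_eq_smul (by simp) (h.weyl.succ i)
  same i := inv_mul_eq_smul (by simp) (h.weyl.same i)
  other i j h1 h2 := (h.weyl.other i j h1 h2).units_inv_left

variable {q : ℂˣ} {a b : Fin N → Rˣ} {l : ℕ}

theorem laurentOff_of_ne (d : ℤ) (b : Fin N → R) (c c' : ℂˣ) {i : Fin N} (h : i + 1 ≠ 0) :
    laurentOff d b c i = laurentOff d b c' i := by
  rw [laurentOff, laurentOff, if_neg h, if_neg h]

theorem smul_laurentOff (d : ℤ) (b : Fin N → R) {c c' : ℂˣ} {i : Fin N} (h : i + 1 = 0)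
    {s t : ℂ} (hst : s * (c ^ d : ℂˣ) = t * (c' ^ d : ℂˣ)) :
    s • laurentOff d b c i = t • laurentOff d b c' i := by
  rw [laurentOff, laurentOff, if_pos h, if_pos h, smul_single, smul_single, smul_smul, smul_smul, hst]

/-- Neighbouring parameters differ by the factor q, hence their squares by q², the degeneration
point. The corner entries satisfy the compatibility with `rhat` because q⁻¹ c⁻² = q (q c)⁻². -/
theorem SiteRel.preserves_plus (h : SiteRel q a b) (hN : 2 ≤ N) :
    Preserves q (descProd fun k : Fin l => Lplus a b (q ^ (k : ℕ))) := by
  refine Preserves.descProd fun k hk => Exchange.embed ?_ (by simp)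
  dsimp only
  rw [Lplus_eq, Lplus_eq]
  refine exchange_bidiagonal hN (h.weyl.laurent _ _) (h.weyl.laurent _ _)
    (fun i j => laurentOff_commute _ _ (h.bb i j) _ _) (by simp)
    (fun i hi => laurentOff_of_ne _ _ _ _ hi) (fun i hi => smul_laurentOff _ _ hi ?_) (by ring) (by simp)
  push_cast
  have := q.ne_zero
  field_simp
  ring

theorem SiteRel.exchangeOp_minus (h : SiteRel q a b) (hN : 2 ≤ N) (c : ℂˣ) :
    ExchangeOp (diagOff (0 : ℂ) 1) (upperLower (-((q⁻¹ : ℂˣ) : ℂ)) (-(q : ℂ))) (Lminus a b c)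
      (Lminus a b (c * q)) := by
  rw [Lminus_eq, Lminus_eq]
  refine exchangeOp_bidiagonal_transpose hN (h.weyl_inv.laurent _ _) (h.weyl_inv.laurent _ _)
    (fun i j => laurentOff_commute _ _ (h.bb i j) _ _) (by simp)
    (fun i hi => laurentOff_of_ne _ _ _ _ hi) (fun i hi => smul_laurentOff _ _ hi ?_) (by simp)
    (by ring)
  push_cast
  have := q.ne_zero
  field_simp

theorem SiteRel.preserves_minus (h : SiteRel q a b) (hN : 2 ≤ N) :
    Preserves q (ascProd fun k : Fin l => Lminus a b (q ^ (k : ℕ))) :=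
  Preserves.ascProd fun k _ => (h.exchangeOp_minus hN (q ^ k)).embed (by simp)

/-- `L⁻` involves no negative powers of z, so it comes from a matrix of power series. At z = 0 the
corner entry disappears, leaving a lower triangular matrix with diagonal entries `(a i)⁻¹`. -/
theorem isUnit_Lminus (a b : Fin N → Rˣ) (c : ℂˣ) (hN : 2 ≤ N) : IsUnit (Lminus a b c) := by
  let P : Matrix (Fin N) (Fin N) (PowerSeries R) := Matrix.of fun i j =>
    (if i = j then PowerSeries.C ((a j)⁻¹.val : R) else 0) +
    (if i = j + 1 then
      (if j + 1 = 0 then PowerSeries.C (((c ^ (2 : ℤ) : ℂˣ) : ℂ) • (b j : R)) * PowerSeries.X ^ 2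
        else PowerSeries.C (b j : R)) else 0)
  have e : (ofPowerSeries ℤ R).mapMatrix P = Lminus a b c := by
    ext1 i j
    simp only [RingHom.mapMatrix_apply, Matrix.map_apply, P, Matrix.of_apply, Lminus, map_add]
    congr 1
    · split_ifs <;> simp
    · split_ifs
      · rw [map_mul, ofPowerSeries_C, ofPowerSeries_X_pow, C_apply, single_mul_single, zero_add,
          mul_one]
        rfl
      · simp
      · simp
  rw [← e]
  refine IsUnit.map _ (isUnit_of_constantCoeff (isUnit_of_lower (fun i j hij => ?_) fun i => ?_))
  · simp only [Matrix.map_apply, P, Matrix.of_apply, if_neg hij.ne, zero_add]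
    split_ifs with h1 h2
    · simp
    · have := val_add_one_of_ne h2
      have := Fin.lt_def.1 hij
      rw [h1] at this
      omega
    · simp
  · simp [P, (add_one_ne_self hN i).symm]

/-- The inverse of `L⁻(c z)`. -/
def LminusInv (a b : Fin N → Rˣ) (c : ℂˣ) : Matrix (Fin N) (Fin N) (LaurentSeries R) :=
  Ring.inverse (Lminus a b c)

theorem Lminus_mul_inv (a b : Fin N → Rˣ) (c : ℂˣ) (hN : 2 ≤ N) :
    Lminus a b c * LminusInv a b c = 1 := Ring.mul_inverse_cancel _ (isUnit_Lminus a b c hN)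

theorem Lminus_inv_mul (a b : Fin N → Rˣ) (c : ℂˣ) (hN : 2 ≤ N) :
    LminusInv a b c * Lminus a b c = 1 := Ring.inverse_mul_cancel _ (isUnit_Lminus a b c hN)

theorem exchange_embed_inv {n ι S : Type*} [Fintype n] [DecidableEq n] [Fintype ι] [DecidableEq ι]
    [Ring S] {R : Matrix (ι → n) (ι → n) S} {x y x' y' : Matrix n n S} {p p' : ι} (hx : x * x' = 1)
    (hx' : x' * x = 1) (hy : y * y' = 1) (hy' : y' * y = 1)
    (h : embed p x * embed p' y * R = R * embed p' y * embed p x) :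
    R * embed p x' * embed p' y' = embed p' y' * embed p x' * R :=
  exchange_inv (embed_mul_embed_eq_one hx p) (embed_mul_embed_eq_one hx' p)
    (embed_mul_embed_eq_one hy p') (embed_mul_embed_eq_one hy' p') h

/-- Inverting the relation for `L⁻` gives that of `L⁺`; accordingly the inverses are fused in
descending order. -/
theorem SiteRel.preserves_minusInv (h : SiteRel q a b) (hN : 2 ≤ N) :
    Preserves q (descProd fun k : Fin l => LminusInv a b (q ^ (k : ℕ))) := by
  refine Preserves.descProd fun k hk => ?_
  refine exchange_embed_inv (Lminus_mul_inv _ _ _ hN) (Lminus_inv_mul _ _ _ hN)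
    (Lminus_mul_inv _ _ _ hN) (Lminus_inv_mul _ _ _ hN)
    ((h.exchangeOp_minus hN (q ^ k)).embed (by simp))

theorem tensorPlus_eq (q : ℂˣ) (l : ℕ) (a b : Fin N → Rˣ) :
    tensorPlus q l a b = descProd fun k : Fin l => Lplus a b (q ^ (k : ℕ)) := by
  ext1 i j
  rw [descProd_apply]
  rfl

theorem tensorMinus_eq (q : ℂˣ) (l : ℕ) (a b : Fin N → Rˣ) :
    tensorMinus q l a b = ascProd fun k : Fin l => Lminus a b (q ^ (k : ℕ)) := by
  ext1 i j
  rw [ascProd_apply]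
  rfl

theorem fusedPlus_eq (q : ℂˣ) (l : ℕ) (a b : Fin N → Rˣ) :
    fusedPlus q l a b = fuse q (descProd fun k : Fin l => Lplus a b (q ^ (k : ℕ))) := by
  rw [← tensorPlus_eq]
  rfl

theorem fusedMinus_eq (q : ℂˣ) (l : ℕ) (a b : Fin N → Rˣ) :
    fusedMinus q l a b = fuse q (ascProd fun k : Fin l => Lminus a b (q ^ (k : ℕ))) := by
  rw [← tensorMinus_eq]
  rfl

/-- The fusion of the inverses of `L⁻`. -/
def fusedMinusInv (q : ℂˣ) (l : ℕ) (a b : Fin N → Rˣ) :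
    Matrix (Fin l ↪o Fin N) (Fin l ↪o Fin N) (LaurentSeries R) :=
  fuse q (descProd fun k : Fin l => LminusInv a b (q ^ (k : ℕ)))

theorem SiteRel.tensorPlus_mul (h : SiteRel q a b) (hN : 2 ≤ N) :
    tensorPlus q l a b * qAntisymSeries q N R l = qAntisymSeries q N R l * fusedPlus q l a b := by
  rw [tensorPlus_eq, fusedPlus_eq]
  exact (h.preserves_plus hN).mul_antisymMatrix

theorem SiteRel.tensorMinus_mul (h : SiteRel q a b) (hN : 2 ≤ N) :
    tensorMinus q l a b * qAntisymSeries q N R l = qAntisymSeries q N R l * fusedMinus q l a b := by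
  rw [tensorMinus_eq, fusedMinus_eq]
  exact (h.preserves_minus hN).mul_antisymMatrix

/-- The ascending product of the `L⁻` is inverse to the descending product of their inverses, and
`fuse` respects products of operators that preserve antisymmetry. -/
theorem SiteRel.fusedMinus_mul_inv (h : SiteRel q a b) (hN : 2 ≤ N) :
    fusedMinus q l a b * fusedMinusInv q l a b = 1 := by
  rw [fusedMinus_eq, fusedMinusInv, ← fuse_mul (h.preserves_minusInv hN),
    ascProd_mul_descProd fun k => Lminus_mul_inv _ _ _ hN, fuse_one]

theorem SiteRel.fusedMinus_inv_mul (h : SiteRel q a b) (hN : 2 ≤ N) :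
    fusedMinusInv q l a b * fusedMinus q l a b = 1 := by
  rw [fusedMinus_eq, fusedMinusInv, ← fuse_mul (h.preserves_minus hN),
    descProd_mul_ascProd fun k => Lminus_inv_mul _ _ _ hN, fuse_one]

theorem SiteRel.isUnit_fusedMinus (h : SiteRel q a b) (hN : 2 ≤ N) :
    IsUnit (fusedMinus q l a b) :=
  ⟨⟨_, _, h.fusedMinus_mul_inv hN, h.fusedMinus_inv_mul hN⟩, rfl⟩

theorem SiteRel.inverse_fusedMinus (h : SiteRel q a b) (hN : 2 ≤ N) :
    Ring.inverse (fusedMinus q l a b) = fusedMinusInv q l a b :=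
  Ring.inverse_unit ⟨_, _, h.fusedMinus_mul_inv hN, h.fusedMinus_inv_mul hN⟩

end Laurent

/-! ### Commutation relations within one site and between two sites -/

section Generators

variable (q : ℂˣ) (N L : ℕ) [NeZero N]

theorem siteRel_gen (n : ZMod (2 * L)) :
    SiteRel q (fun i => a q N L i n) (fun i => b q N L i n) where
  weyl :=
    { aa := fun i j => by simpa [a, gen, commute_iff_eq] using gen_rel q N L (.a_a i j n n)
      succ := fun i => by simpa [a, b, gen] using gen_rel q N L (.a_b_succ i n)
      same := fun i => by simpa [a, b, gen] using gen_rel q N L (.a_b_same i n)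
      other := fun i j h1 h2 => by
        simpa [a, b, gen, commute_iff_eq] using gen_rel q N L (.a_b_other i j n n (Or.inr ⟨h1, h2⟩)) }
  bb i j := by simpa [b, gen, commute_iff_eq] using gen_rel q N L (.b_b i j n n)

/-- The generators at two different sites commute. -/
structure SitesCommute {N : ℕ} {R : Type*} [Ring R] (a b a' b' : Fin N → Rˣ) : Prop where
  aa : ∀ i j, Commute (a i : R) (a' j)
  ab : ∀ i j, Commute (a i : R) (b' j)
  ba : ∀ i j, Commute (b i : R) (a' j)
  bb : ∀ i j, Commute (b i : R) (b' j)

theorem sitesCommute_gen {n m : ZMod (2 * L)} (h : n ≠ m) :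
    SitesCommute (fun i => a q N L i n) (fun i => b q N L i n) (fun i => a q N L i m)
      (fun i => b q N L i m) where
  aa i j := by simpa [a, gen, commute_iff_eq] using gen_rel q N L (.a_a i j n m)
  ab i j := by
    simpa [a, b, gen, commute_iff_eq] using gen_rel q N L (.a_b_other i j n m (Or.inl h))
  ba i j := by
    simpa [a, b, gen, commute_iff_eq] using (gen_rel q N L (.a_b_other j i m n (Or.inl h.symm))).symm
  bb i j := by simpa [b, gen, commute_iff_eq] using gen_rel q N L (.b_b i j n m)

end Generators

end

end Toda

namespace Toda

noncomputable section

/-! ### Change of coefficients -/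

section Map

open HahnSeries

variable {N l : ℕ} {R R' S S' : Type*} [Ring R] [Algebra ℂ R] [Ring R'] [Algebra ℂ R']
  [Ring S] [Algebra ℂ S] [Ring S'] [Algebra ℂ S']

/-- The map of Laurent series given by a map of coefficients. -/
def laurentMap (f : R →ₐ[ℂ] R') : LaurentSeries R →ₐ[ℂ] LaurentSeries R' where
  toFun x := x.map f
  map_one' := HahnSeries.map_one (f : R →+* R').toMonoidWithZeroHom
  map_zero' := HahnSeries.map_zero (((f : R →+* R') : R →+ R') : ZeroHom R R')
  map_add' _ _ := HahnSeries.map_add ((f : R →+* R') : R →+ R')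
  map_mul' _ _ := HahnSeries.map_mul ((f : R →+* R') : R →ₙ+* R')
  commutes' c := by
    rw [HahnSeries.algebraMap_apply, HahnSeries.algebraMap_apply]
    ext k
    by_cases hk : k = 0
    · subst hk; simp
    · simp [coeff_single_of_ne hk]

theorem laurentMap_coeff (f : R →ₐ[ℂ] R') (x : LaurentSeries R) (k : ℤ) :
    (laurentMap f x).coeff k = f (x.coeff k) := rfl

theorem laurentMap_single (f : R →ₐ[ℂ] R') (d : ℤ) (x : R) :
    laurentMap f (single d x) = single d (f x) := by
  ext k
  rw [laurentMap_coeff]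
  by_cases hk : k = d
  · subst hk; simp
  · simp [coeff_single_of_ne hk]

theorem mapMatrix_descProd (f : S →ₐ[ℂ] S') (L : Fin l → Matrix (Fin N) (Fin N) S) :
    f.mapMatrix (descProd L) = descProd fun k => f.mapMatrix (L k) := by
  ext1 i j
  rw [AlgHom.mapMatrix_apply, Matrix.map_apply, descProd_apply, descProd_apply, map_list_prod,
    List.map_map]
  rfl

theorem mapMatrix_ascProd (f : S →ₐ[ℂ] S') (L : Fin l → Matrix (Fin N) (Fin N) S) :
    f.mapMatrix (ascProd L) = ascProd fun k => f.mapMatrix (L k) := by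
  ext1 i j
  rw [AlgHom.mapMatrix_apply, Matrix.map_apply, ascProd_apply, ascProd_apply, map_list_prod,
    List.map_map]
  rfl

theorem mapMatrix_fuse (q : ℂˣ) (f : S →ₐ[ℂ] S') (T : Matrix (Fin l → Fin N) (Fin l → Fin N) S) :
    f.mapMatrix (fuse q T) = fuse q (f.mapMatrix T) := by
  ext1 I J
  simp [fuse, Matrix.mul_apply, antisymMatrix]

theorem list_prod_map_smul {κ : Type*} (c : κ → ℂ) (x : κ → S) (ks : List κ) :
    (ks.map fun k => c k • x k).prod = (ks.map c).prod • (ks.map x).prod := by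
  induction ks with
  | nil => simp
  | cons k ks ih => simp only [List.map_cons, List.prod_cons, ih, smul_mul_smul_comm]

/-- The weight of a tensor under a diagonal matrix. -/
def tensorWeight (x : Fin N → ℂˣ) (i : Fin l → Fin N) : ℂˣ := ∏ k, x (i k)

theorem list_prod_tensorWeight (x y : Fin N → ℂˣ) (i j : Fin l → Fin N) :
    ((List.finRange l).map fun k => ((x (i k) * (y (j k))⁻¹ : ℂˣ) : ℂ)).prod =
      ((tensorWeight x i * (tensorWeight y j)⁻¹ : ℂˣ) : ℂ) := by
  have h : ((List.finRange l).map fun k => (x (i k) * (y (j k))⁻¹ : ℂˣ)).prod =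
      tensorWeight x i * (tensorWeight y j)⁻¹ := by
    rw [tensorWeight, tensorWeight, ← Finset.prod_inv_distrib, ← Finset.prod_mul_distrib,
      Fin.prod_univ_def]
  rw [← h, ← Units.coeHom_apply, map_list_prod, List.map_map]
  rfl

theorem descProd_scaled {L L' : Fin l → Matrix (Fin N) (Fin N) S} {x y : Fin N → ℂˣ}
    (h : ∀ k i j, L k i j = ((x i * (y j)⁻¹ : ℂˣ) : ℂ) • L' k i j) (i j : Fin l → Fin N) :
    descProd L i j = ((tensorWeight x i * (tensorWeight y j)⁻¹ : ℂˣ) : ℂ) • descProd L' i j := by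
  rw [descProd_apply, descProd_apply]
  simp only [h]
  rw [list_prod_map_smul, List.map_reverse, List.prod_reverse, list_prod_tensorWeight]

theorem ascProd_scaled {L L' : Fin l → Matrix (Fin N) (Fin N) S} {x y : Fin N → ℂˣ}
    (h : ∀ k i j, L k i j = ((x i * (y j)⁻¹ : ℂˣ) : ℂ) • L' k i j) (i j : Fin l → Fin N) :
    ascProd L i j = ((tensorWeight x i * (tensorWeight y j)⁻¹ : ℂˣ) : ℂ) • ascProd L' i j := by
  rw [ascProd_apply, ascProd_apply]
  simp only [h]
  rw [list_prod_map_smul, list_prod_tensorWeight]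

/-- Only permutations of `J` occur in `v_J`, and these all have the same weight, so diagonal
matrices restrict to diagonal matrices on V(ω_l). -/
theorem fuse_scaled (q : ℂˣ) {T T' : Matrix (Fin l → Fin N) (Fin l → Fin N) S} {x y : Fin N → ℂˣ}
    (h : ∀ i j, T i j = ((tensorWeight x i * (tensorWeight y j)⁻¹ : ℂˣ) : ℂ) • T' i j)
    (I J : Fin l ↪o Fin N) :
    fuse q T I J = ((tensorWeight x I * (tensorWeight y J)⁻¹ : ℂˣ) : ℂ) • fuse q T' I J := by
  simp only [fuse, Matrix.of_apply, Matrix.mul_apply, Finset.smul_sum]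
  refine Finset.sum_congr rfl fun j _ => ?_
  by_cases hj : ∃ σ : Equiv.Perm (Fin l), j = fun k => J (σ k)
  · obtain ⟨σ, rfl⟩ := hj
    have : tensorWeight y (fun k => J (σ k)) = tensorWeight y J :=
      Equiv.prod_comp σ fun k => y (J k)
    rw [h, this, smul_mul_assoc]
  · have : antisymMatrix N S q l j J = 0 := by
      rw [antisymMatrix, Matrix.map_apply, qAntisym, Matrix.of_apply, Finset.sum_eq_zero, map_zero]
      intro σ _
      rw [if_neg fun e => hj ⟨σ, e⟩]
    rw [this, mul_zero, mul_zero, smul_zero]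

variable (S l) in
/-- The diagonal matrix of weights. -/
def weightMatrix (x : Fin N → ℂˣ) : (Matrix (Fin l ↪o Fin N) (Fin l ↪o Fin N) S)ˣ where
  val := Matrix.diagonal fun I => algebraMap ℂ S (tensorWeight x I : ℂˣ)
  inv := Matrix.diagonal fun I => algebraMap ℂ S ((tensorWeight x I)⁻¹ : ℂˣ)
  val_inv := by simp [← map_mul]
  inv_val := by simp [← map_mul]

theorem weightMatrix_mul_mul_apply (x y : Fin N → ℂˣ)
    (F : Matrix (Fin l ↪o Fin N) (Fin l ↪o Fin N) S) (I J : Fin l ↪o Fin N) :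
    ((weightMatrix l S x : Matrix (Fin l ↪o Fin N) (Fin l ↪o Fin N) S) * F *
      ((weightMatrix l S y)⁻¹ : (Matrix (Fin l ↪o Fin N) (Fin l ↪o Fin N) S)ˣ)) I J =
      ((tensorWeight x I * (tensorWeight y J)⁻¹ : ℂˣ) : ℂ) • F I J := by
  have : (((weightMatrix l S y)⁻¹ : (Matrix (Fin l ↪o Fin N) (Fin l ↪o Fin N) S)ˣ) :
      Matrix (Fin l ↪o Fin N) (Fin l ↪o Fin N) S) =
    Matrix.diagonal fun I : Fin l ↪o Fin N => algebraMap ℂ S ((tensorWeight y I)⁻¹ : ℂˣ) := rfl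
  rw [this, Matrix.mul_diagonal, weightMatrix, Matrix.diagonal_mul, ← Algebra.commutes, ← mul_assoc,
    ← map_mul, Units.val_mul, Algebra.smul_def, mul_comm (((tensorWeight x I : ℂˣ) : ℂ))]

theorem trace_weightMatrix_conj (x : Fin N → ℂˣ)
    (F : Matrix (Fin l ↪o Fin N) (Fin l ↪o Fin N) S) :
    ((weightMatrix l S x : Matrix (Fin l ↪o Fin N) (Fin l ↪o Fin N) S) * F *
      ((weightMatrix l S x)⁻¹ : (Matrix (Fin l ↪o Fin N) (Fin l ↪o Fin N) S)ˣ)).trace = F.trace := by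
  simp only [Matrix.trace, Matrix.diag_apply, weightMatrix_mul_mul_apply, mul_inv_cancel,
    Units.val_one, one_smul]

variable [NeZero N] {a b : Fin N → Rˣ} {a' b' : Fin N → R'ˣ} {f : R →ₐ[ℂ] R'} {x y : Fin N → ℂˣ}

theorem laurentMap_Lplus (ha : ∀ i, f (a i) = ((x i * (y i)⁻¹ : ℂˣ) : ℂ) • (a' i : R'))
    (hb : ∀ i, f (b i) = ((x i * (y (i + 1))⁻¹ : ℂˣ) : ℂ) • (b' i : R')) (c : ℂˣ) (i j : Fin N) :
    laurentMap f (Lplus a b c i j) = ((x i * (y j)⁻¹ : ℂˣ) : ℂ) • Lplus a' b' c i j := by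
  simp only [Lplus, Matrix.of_apply, map_add, smul_add]
  congr 1
  · split_ifs with h
    · rw [laurentMap_single, ha, smul_single, h]
    · rw [map_zero, smul_zero]
  · split_ifs with h
    · rw [laurentMap_single, map_smul, hb, smul_single, h, smul_comm]
    · rw [laurentMap_single, hb, smul_single, h]
    · rw [map_zero, smul_zero]

theorem laurentMap_Lminus
    (ha : ∀ i, f ((a i)⁻¹ : Rˣ) = ((y i * (x i)⁻¹ : ℂˣ) : ℂ) • (((a' i)⁻¹ : R'ˣ) : R'))
    (hb : ∀ i, f (b i) = ((y (i + 1) * (x i)⁻¹ : ℂˣ) : ℂ) • (b' i : R')) (c : ℂˣ) (i j : Fin N) :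
    laurentMap f (Lminus a b c i j) = ((y i * (x j)⁻¹ : ℂˣ) : ℂ) • Lminus a' b' c i j := by
  simp only [Lminus, Matrix.of_apply, map_add, smul_add]
  congr 1
  · split_ifs with h
    · rw [laurentMap_single, ha, smul_single, h]
    · rw [map_zero, smul_zero]
  · split_ifs with h
    · rw [laurentMap_single, map_smul, hb, smul_single, h, smul_comm]
    · rw [laurentMap_single, hb, smul_single, h]
    · rw [map_zero, smul_zero]

theorem laurentMap_fusedPlus (ha : ∀ i, f (a i) = ((x i * (y i)⁻¹ : ℂˣ) : ℂ) • (a' i : R'))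
    (hb : ∀ i, f (b i) = ((x i * (y (i + 1))⁻¹ : ℂˣ) : ℂ) • (b' i : R')) (q : ℂˣ)
    (I J : Fin l ↪o Fin N) : laurentMap f (fusedPlus q l a b I J) =
      ((tensorWeight x I * (tensorWeight y J)⁻¹ : ℂˣ) : ℂ) • fusedPlus q l a' b' I J := by
  rw [fusedPlus_eq, fusedPlus_eq, ← fuse_scaled q (descProd_scaled fun k i j =>
    laurentMap_Lplus ha hb (q ^ (k : ℕ)) i j)]
  have := mapMatrix_fuse q (laurentMap f) (descProd fun k : Fin l => Lplus a b (q ^ (k : ℕ)))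
  rw [mapMatrix_descProd] at this
  exact congrFun (congrFun this I) J

theorem laurentMap_fusedMinus
    (ha : ∀ i, f ((a i)⁻¹ : Rˣ) = ((y i * (x i)⁻¹ : ℂˣ) : ℂ) • (((a' i)⁻¹ : R'ˣ) : R'))
    (hb : ∀ i, f (b i) = ((y (i + 1) * (x i)⁻¹ : ℂˣ) : ℂ) • (b' i : R')) (q : ℂˣ)
    (I J : Fin l ↪o Fin N) : laurentMap f (fusedMinus q l a b I J) =
      ((tensorWeight y I * (tensorWeight x J)⁻¹ : ℂˣ) : ℂ) • fusedMinus q l a' b' I J := by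
  rw [fusedMinus_eq, fusedMinus_eq, ← fuse_scaled q (ascProd_scaled fun k i j =>
    laurentMap_Lminus ha hb (q ^ (k : ℕ)) i j)]
  have := mapMatrix_fuse q (laurentMap f) (ascProd fun k : Fin l => Lminus a b (q ^ (k : ℕ)))
  rw [mapMatrix_ascProd] at this
  exact congrFun (congrFun this I) J

theorem mapMatrix_fusedPlus (ha : ∀ i, f (a i) = ((x i * (y i)⁻¹ : ℂˣ) : ℂ) • (a' i : R'))
    (hb : ∀ i, f (b i) = ((x i * (y (i + 1))⁻¹ : ℂˣ) : ℂ) • (b' i : R')) (q : ℂˣ) :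
    (laurentMap f).mapMatrix (fusedPlus q l a b) =
      (weightMatrix l (LaurentSeries R') x : Matrix (Fin l ↪o Fin N) (Fin l ↪o Fin N) (LaurentSeries R')) *
        fusedPlus q l a' b' * ((weightMatrix l (LaurentSeries R') y)⁻¹ :
          (Matrix (Fin l ↪o Fin N) (Fin l ↪o Fin N) (LaurentSeries R'))ˣ) := by
  ext1 I J
  rw [weightMatrix_mul_mul_apply, ← laurentMap_fusedPlus ha hb]
  rfl

/-- The transformation rule is that of `fusedMinus` with `x` and `y` exchanged, by uniqueness of
inverses. -/
theorem mapMatrix_fusedMinusInv {q : ℂˣ} (h : SiteRel q a b) (h' : SiteRel q a' b') (hN : 2 ≤ N)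
    (ha : ∀ i, f ((a i)⁻¹ : Rˣ) = ((y i * (x i)⁻¹ : ℂˣ) : ℂ) • (((a' i)⁻¹ : R'ˣ) : R'))
    (hb : ∀ i, f (b i) = ((y (i + 1) * (x i)⁻¹ : ℂˣ) : ℂ) • (b' i : R')) :
    (laurentMap f).mapMatrix (fusedMinusInv q l a b) =
      (weightMatrix l (LaurentSeries R') x : Matrix (Fin l ↪o Fin N) (Fin l ↪o Fin N) (LaurentSeries R')) *
        fusedMinusInv q l a' b' * ((weightMatrix l (LaurentSeries R') y)⁻¹ :
          (Matrix (Fin l ↪o Fin N) (Fin l ↪o Fin N) (LaurentSeries R'))ˣ) := by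
  have e : (laurentMap f).mapMatrix (fusedMinus q l a b) =
      (weightMatrix l (LaurentSeries R') y : Matrix (Fin l ↪o Fin N) (Fin l ↪o Fin N) (LaurentSeries R')) *
        fusedMinus q l a' b' * ((weightMatrix l (LaurentSeries R') x)⁻¹ :
          (Matrix (Fin l ↪o Fin N) (Fin l ↪o Fin N) (LaurentSeries R'))ˣ) := by
    ext1 I J
    rw [weightMatrix_mul_mul_apply, ← laurentMap_fusedMinus ha hb]
    rfl
  refine left_inv_eq_right_inv (a := (laurentMap f).mapMatrix (fusedMinus q l a b)) ?_ ?_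
  · rw [← map_mul, h.fusedMinus_inv_mul hN, map_one]
  · rw [e]
    have h1 := h'.fusedMinus_mul_inv (l := l) hN
    calc _ = (weightMatrix l (LaurentSeries R') y : Matrix (Fin l ↪o Fin N) (Fin l ↪o Fin N) (LaurentSeries R')) *
        (fusedMinus q l a' b' * fusedMinusInv q l a' b') * ((weightMatrix l (LaurentSeries R') y)⁻¹ :
          (Matrix (Fin l ↪o Fin N) (Fin l ↪o Fin N) (LaurentSeries R'))ˣ) := by
          simp only [mul_assoc, Units.inv_mul_cancel_left]
      _ = 1 := by rw [h1, mul_one, Units.mul_inv]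

end Map

/-! ### Transfer matrices and gauge invariance -/

section Transfer

variable {q : ℂˣ} {N L : ℕ} [NeZero N]

/-- The product of the fused L-operators of two adjacent sites. -/
def siteProduct (q : ℂˣ) (N L l : ℕ) [NeZero N] (n : ZMod (2 * L)) :
    Matrix (Fin l ↪o Fin N) (Fin l ↪o Fin N) (LaurentSeries (Aq q N L)) :=
  fusedMinusInv q l (fun i => a q N L i (n + 1)) (fun i => b q N L i (n + 1)) *
    fusedPlus q l (fun i => a q N L i n) (fun i => b q N L i n)

/-- The first site of the transfer matrix is at time `t` given by `k = 0`. -/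
def evenSite (L : ℕ) (t : ℤ) (k : ℕ) : ZMod (2 * L) := ((2 * (k : ℤ) + 1 + t % 2 : ℤ) : ZMod (2 * L))

theorem transfer_eq (hN : 2 ≤ N) (l : ℕ) (t : ℤ) : transfer q N L l t =
    (((List.range L).reverse.map fun k => siteProduct q N L l (evenSite L t k)).prod).trace := by
  rw [transfer]
  congr 3
  funext k
  rw [(siteRel_gen q N L _).inverse_fusedMinus hN, siteProduct, evenSite]
  have : ((2 * (k : ℤ) + 2 + t % 2 : ℤ) : ZMod (2 * L)) =
      ((2 * (k : ℤ) + 1 + t % 2 : ℤ) : ZMod (2 * L)) + 1 := by push_cast; ring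
  rw [this]

theorem odd_val_intCast [NeZero L] (m t : ℤ) :
    Odd ((((m : ZMod (2 * L)).val : ℕ) : ℤ) + t) ↔ Odd (m + t) := by
  have hL := NeZero.ne L
  have : NeZero (2 * L) := ⟨by omega⟩
  rw [ZMod.val_intCast]
  have : m % ((2 * L : ℕ) : ℤ) % 2 = m % 2 := Int.emod_emod_of_dvd _ ⟨L, by push_cast; ring⟩
  rw [Int.odd_iff, Int.odd_iff]
  omega

theorem odd_evenSite [NeZero L] (t : ℤ) (k : ℕ) : Odd (((evenSite L t k).val : ℤ) + t) := by
  rw [evenSite, odd_val_intCast, Int.odd_iff]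
  omega

/-- The diagonal matrix of the site `n` cancels between the two factors; those of `n + 1` and `n -
1` remain. -/
theorem mapMatrix_siteProduct [NeZero L] (hN : 2 ≤ N) (l : ℕ) {t : ℤ} {n : ZMod (2 * L)}
    (h : Odd ((n.val : ℤ) + t)) (α : Fin N → ZMod (2 * L) → ℂˣ) :
    (laurentMap (gauge q N L t α)).mapMatrix (siteProduct q N L l n) =
      (weightMatrix l (LaurentSeries (Aq q N L)) (fun i => α i (n + 1)) :
        Matrix (Fin l ↪o Fin N) (Fin l ↪o Fin N) (LaurentSeries (Aq q N L))) *
        siteProduct q N L l n * ((weightMatrix l (LaurentSeries (Aq q N L)) (fun i => α i (n - 1)))⁻¹ :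
          (Matrix (Fin l ↪o Fin N) (Fin l ↪o Fin N) (LaurentSeries (Aq q N L)))ˣ) := by
  have h' := odd_val_add_one L n t h
  rw [siteProduct, map_mul, mapMatrix_fusedPlus (x := fun i => α i n) (y := fun i => α i (n - 1))
    (a' := fun i => a q N L i n) (b' := fun i => b q N L i n),
    mapMatrix_fusedMinusInv (siteRel_gen q N L _) (siteRel_gen q N L (n + 1)) hN
      (x := fun i => α i (n + 1)) (y := fun i => α i n)]
  · simp only [mul_assoc, Units.inv_mul_cancel_left]
  · intro i
    refine (rescale_gen q N L _ _ (.aInv i (n + 1))).trans ?_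
    simp [weight, a, mul_comm]
  · intro i
    refine (rescale_gen q N L _ _ (.b i (n + 1))).trans ?_
    simp only [weight, if_neg h']
    simp [b]
  · intro i
    refine (rescale_gen q N L _ _ (.a i n)).trans ?_
    simp [weight, a]
  · intro i
    refine (rescale_gen q N L _ _ (.b i n)).trans ?_
    simp only [weight, if_pos h]
    simp [b]

/-- Under a gauge transformation the partial products telescope, and only the diagonal matrices at
the two ends survive. After a full period they are inverse to each other, and having scalar entries
they drop out of the trace. -/
theorem transfer_coeff_mem [NeZero L] (hN : 2 ≤ N) (l : ℕ) (t k : ℤ) :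
    (transfer q N L l t).coeff k ∈ Ainv q N L t := by
  intro α
  rw [← laurentMap_coeff]
  congr 1
  rw [transfer_eq hN]
  have key : ∀ K : ℕ, (laurentMap (gauge q N L t α)).mapMatrix
      ((List.range K).reverse.map fun k => siteProduct q N L l (evenSite L t k)).prod =
      (weightMatrix l (LaurentSeries (Aq q N L)) (fun i => α i ((2 * (K : ℤ) + t % 2 : ℤ) : ZMod (2 * L))) :
        Matrix (Fin l ↪o Fin N) (Fin l ↪o Fin N) (LaurentSeries (Aq q N L))) *
      ((List.range K).reverse.map fun k => siteProduct q N L l (evenSite L t k)).prod *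
      ((weightMatrix l (LaurentSeries (Aq q N L)) (fun i => α i ((t % 2 : ℤ) : ZMod (2 * L))))⁻¹ :
          (Matrix (Fin l ↪o Fin N) (Fin l ↪o Fin N) (LaurentSeries (Aq q N L)))ˣ) := by
    intro K
    induction K with
    | zero => simp
    | succ K ih =>
      rw [List.range_succ, List.reverse_append, List.reverse_singleton, List.singleton_append,
        List.map_cons, List.prod_cons, map_mul, ih, mapMatrix_siteProduct hN l (odd_evenSite t K)]
      have e1 : evenSite L t K + 1 = ((2 * ((K + 1 : ℕ) : ℤ) + t % 2 : ℤ) : ZMod (2 * L)) := by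
        rw [evenSite]; push_cast; ring
      have e2 : evenSite L t K - 1 = ((2 * (K : ℤ) + t % 2 : ℤ) : ZMod (2 * L)) := by
        rw [evenSite]; push_cast; ring
      rw [e1, e2]
      simp only [mul_assoc, Units.inv_mul_cancel_left]
  have e3 : ((2 * (L : ℤ) + t % 2 : ℤ) : ZMod (2 * L)) = ((t % 2 : ℤ) : ZMod (2 * L)) := by
    have := ZMod.natCast_self (2 * L)
    push_cast at this ⊢
    rw [this, zero_add]
  rw [AddMonoidHom.map_trace (laurentMap (gauge q N L t α))]
  have := congrArg Matrix.trace (key L)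
  rw [e3, trace_weightMatrix_conj] at this
  exact this

end Transfer

end

end Toda

namespace Toda

noncomputable section

/-! ### Commutation of coefficients -/

section Coefficients

open HahnSeries

variable {N l : ℕ} {R : Type*} [Ring R]

theorem commute_of_coeff {x y : LaurentSeries R}
    (h : ∀ i j, Commute (x.coeff i) (y.coeff j)) : Commute x y := by
  ext k
  rw [coeff_mul, coeff_mul]
  refine Finset.sum_equiv (Equiv.prodComm ℤ ℤ) (fun p => ?_) fun p _ => (h _ _).eq
  simp only [Finset.mem_antidiagonal, Equiv.prodComm_apply, Prod.fst_swap, Prod.snd_swap]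
  rw [add_comm]
  tauto

theorem commute_C_iff {x : R} {y : LaurentSeries R} :
    Commute (C x) y ↔ ∀ k, Commute x (y.coeff k) := by
  rw [commute_iff_eq, HahnSeries.ext_iff, funext_iff]
  simp only [C_apply, coeff_single_zero_mul, coeff_mul_single_zero]
  rfl

theorem commute_single {x y : R} (h : Commute x y) (d : ℤ) : Commute (C x) (single d y) := by
  rw [C_apply, Commute, SemiconjBy, single_mul_single, single_mul_single, add_comm, h.eq]

variable [Algebra ℂ R]

theorem commute_descProd_apply {S : Type*} [Ring S] {s : S}
    {L : Fin l → Matrix (Fin N) (Fin N) S} (h : ∀ k i j, Commute s (L k i j))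
    (i j : Fin l → Fin N) : Commute s (descProd L i j) := by
  rw [descProd_apply]
  exact commute_list_map_prod fun k _ => h k _ _

theorem commute_fuse_apply {S : Type*} [Ring S] [Algebra ℂ S] (q : ℂˣ) {s : S}
    {T : Matrix (Fin l → Fin N) (Fin l → Fin N) S} (h : ∀ i j, Commute s (T i j))
    (I J : Fin l ↪o Fin N) : Commute s (fuse q T I J) := by
  rw [fuse, Matrix.of_apply, Matrix.mul_apply]
  exact Commute.sum_right _ _ _ fun j _ => (h _ _).mul_right (Algebra.commutes _ _).symm

variable [NeZero N] {a b : Fin N → Rˣ} {x : R}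

theorem commute_Lplus (ha : ∀ i, Commute x (a i)) (hb : ∀ i, Commute x (b i)) (c : ℂˣ)
    (i j : Fin N) : Commute (C x) (Lplus a b c i j) := by
  rw [Lplus, Matrix.of_apply]
  refine Commute.add_right ?_ ?_ <;> split_ifs
  exacts [commute_single (ha _) _, Commute.zero_right _,
    commute_single ((hb _).smul_right _) _, commute_single (hb _) _, Commute.zero_right _]

theorem commute_Lminus (ha : ∀ i, Commute x (a i)) (hb : ∀ i, Commute x (b i)) (c : ℂˣ)
    (i j : Fin N) : Commute (C x) (Lminus a b c i j) := by
  rw [Lminus, Matrix.of_apply]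
  refine Commute.add_right ?_ ?_ <;> split_ifs
  exacts [commute_single (ha _).units_inv_right _, Commute.zero_right _,
    commute_single ((hb _).smul_right _) _, commute_single (hb _) _, Commute.zero_right _]

theorem commute_LminusInv (hN : 2 ≤ N) (ha : ∀ i, Commute x (a i)) (hb : ∀ i, Commute x (b i))
    (c : ℂˣ) (i j : Fin N) : Commute (C x) (LminusInv a b c i j) :=
  commute_inverse_apply (Lminus_mul_inv a b c hN) (Lminus_inv_mul a b c hN)
    (commute_Lminus ha hb c) i j

theorem commute_fusedPlus_coeff (q : ℂˣ) (ha : ∀ i, Commute x (a i)) (hb : ∀ i, Commute x (b i))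
    (I J : Fin l ↪o Fin N) (k : ℤ) : Commute x ((fusedPlus q l a b I J).coeff k) := by
  refine commute_C_iff.1 ?_ k
  rw [fusedPlus_eq]
  exact commute_fuse_apply q (commute_descProd_apply fun k => commute_Lplus ha hb _) I J

theorem commute_fusedMinusInv_coeff (hN : 2 ≤ N) (q : ℂˣ) (ha : ∀ i, Commute x (a i))
    (hb : ∀ i, Commute x (b i)) (I J : Fin l ↪o Fin N) (k : ℤ) :
    Commute x ((fusedMinusInv q l a b I J).coeff k) := by
  refine commute_C_iff.1 ?_ k
  exact commute_fuse_apply q (commute_descProd_apply fun k => commute_LminusInv hN ha hb _) I J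

end Coefficients

/-! ### Ultralocality: operators at different sites commute -/

section SiteCommute

open HahnSeries

variable {q : ℂˣ} {N L l l' : ℕ} [NeZero N]

/-- `x` commutes with the generators at the site `n`. -/
def CommuteSite (x : Aq q N L) (n : ZMod (2 * L)) : Prop :=
  (∀ i, Commute x (a q N L i n)) ∧ ∀ i, Commute x (b q N L i n)

theorem commuteSite_a {n m : ZMod (2 * L)} (h : n ≠ m) (i : Fin N) :
    CommuteSite (a q N L i n : Aq q N L) m :=
  ⟨(sitesCommute_gen q N L h).aa i, (sitesCommute_gen q N L h).ab i⟩

theorem commuteSite_b {n m : ZMod (2 * L)} (h : n ≠ m) (i : Fin N) :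
    CommuteSite (b q N L i n : Aq q N L) m :=
  ⟨(sitesCommute_gen q N L h).ba i, (sitesCommute_gen q N L h).bb i⟩

/-- The fused L-operators at the site `n`. -/
def IsSiteOperator (n : ZMod (2 * L)) (x : LaurentSeries (Aq q N L)) : Prop :=
  ∀ y, CommuteSite y n → ∀ k, Commute y (x.coeff k)

/-- A coefficient of `x` commutes with the generators at the other site `m`, so it is itself an
admissible test element in the defining property of `y`. -/
theorem IsSiteOperator.commute {n m : ZMod (2 * L)} (h : n ≠ m) {x y : LaurentSeries (Aq q N L)}
    (hx : IsSiteOperator n x) (hy : IsSiteOperator m y) (i j : ℤ) :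
    Commute (x.coeff i) (y.coeff j) :=
  hy _ ⟨fun r => (hx _ (commuteSite_a h.symm r) i).symm,
    fun r => (hx _ (commuteSite_b h.symm r) i).symm⟩ j

theorem isSiteOperator_fusedPlus (n : ZMod (2 * L)) (I J : Fin l ↪o Fin N) :
    IsSiteOperator n (fusedPlus q l (fun i => a q N L i n) (fun i => b q N L i n) I J) :=
  fun _ hy => commute_fusedPlus_coeff q hy.1 hy.2 I J

theorem isSiteOperator_fusedMinusInv (hN : 2 ≤ N) (n : ZMod (2 * L)) (I J : Fin l ↪o Fin N) :
    IsSiteOperator n (fusedMinusInv q l (fun i => a q N L i n) (fun i => b q N L i n) I J) :=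
  fun _ hy => commute_fusedMinusInv_coeff hN q hy.1 hy.2 I J

theorem siteProduct_commute (hN : 2 ≤ N) {n m : ZMod (2 * L)} (h1 : n ≠ m) (h2 : n + 1 ≠ m)
    (h3 : n ≠ m + 1) (I J : Fin l ↪o Fin N) (I' J' : Fin l' ↪o Fin N) (i j : ℤ) :
    Commute ((siteProduct q N L l n I J).coeff i) ((siteProduct q N L l' m I' J').coeff j) := by
  have key : ∀ (l : ℕ) (x : Aq q N L) (n : ZMod (2 * L)), CommuteSite x n →
      CommuteSite x (n + 1) → ∀ (I J : Fin l ↪o Fin N) (k : ℤ),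
      Commute x ((siteProduct q N L l n I J).coeff k) := by
    intro l x n hx hx' I J
    refine commute_C_iff.1 ?_
    rw [siteProduct, Matrix.mul_apply]
    exact Commute.sum_right _ _ _ fun K _ => Commute.mul_right
      (commute_C_iff.2 (isSiteOperator_fusedMinusInv hN (n + 1) I K x hx'))
      (commute_C_iff.2 (isSiteOperator_fusedPlus n K J x hx))
  have key' : ∀ r, r ≠ n → r ≠ n + 1 → CommuteSite ((siteProduct q N L l n I J).coeff i) r :=
    fun r hr hr' => ⟨fun p => (key l _ n (commuteSite_a hr p) (commuteSite_a hr' p) I J i).symm,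
      fun p => (key l _ n (commuteSite_b hr p) (commuteSite_b hr' p) I J i).symm⟩
  exact key l' _ m (key' m h1.symm h2.symm)
    (key' (m + 1) h3.symm (fun h => h1 (add_right_cancel h).symm)) I' J' j

end SiteCommute

/-! ### Commutativity of the transfer matrices -/

section TwoVariables

open HahnSeries Sum

variable {N l l' : ℕ} {R S K : Type*} [Ring R] [Algebra ℂ R] [Ring S] [Algebra ℂ S]
  [CommRing K] [Algebra ℂ K] [Algebra K S] [IsScalarTower ℂ K S]

/-- The maps `f` and `g` substitute for `z` two independent variables, with squares `z` and `w`. -/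
structure TwoVariables (f g : LaurentSeries R →ₐ[ℂ] S) (z w : Kˣ) : Prop where
  const : ∀ x, f (single 0 x) = g (single 0 x)
  left : ∀ x, f (single 2 x) = (z : K) • f (single 0 x)
  right : ∀ x, g (single 2 x) = (w : K) • g (single 0 x)
  left' : ∀ x, f (single (-2) x) = ((z⁻¹ : Kˣ) : K) • f (single 0 x)
  right' : ∀ x, g (single (-2) x) = ((w⁻¹ : Kˣ) : K) • g (single 0 x)
  comm : ∀ x y, (∀ i j, Commute (x.coeff i) (y.coeff j)) → Commute (f x) (g y)
  isUnit : ∀ c d : ℂˣ, IsUnit (algebraMap ℂ K c * (z : K) - algebraMap ℂ K d * (w : K))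

theorem WeylRel.map_tower [NeZero N] {p r : ℂ} {a b : Fin N → R} (h : WeylRel p r a b)
    (f : R →ₐ[ℂ] S) : WeylRel (algebraMap ℂ K p) (algebraMap ℂ K r) (fun i => f (a i))
      (fun i => f (b i)) where
  aa i j := (h.aa i j).map f
  succ i := by simpa using congrArg f (h.succ i)
  same i := by simpa using congrArg f (h.same i)
  other i j h1 h2 := (h.other i j h1 h2).map f

theorem antisymProj_map (f : R →ₐ[ℂ] S) (q : ℂˣ) (p p' : Fin l) :
    f.mapMatrix (antisymProj (Fin N) R q p p') = antisymProj (Fin N) S q p p' := by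
  ext1 i j
  simp only [antisymProj, rmat, AlgHom.mapMatrix_apply, Matrix.map_apply, Matrix.of_apply, map_add,
    apply_ite f, AlgHom.commutes, map_zero]

theorem Preserves.map {q : ℂˣ} {T : Matrix (Fin l → Fin N) (Fin l → Fin N) R}
    (h : Preserves q T) (f : R →ₐ[ℂ] S) : Preserves q (f.mapMatrix T) := fun k hk => by
  have := congrArg f.mapMatrix (h k hk)
  rwa [map_mul, map_mul, map_mul, antisymProj_map] at this

theorem mapMatrix_bidiagonal [NeZero N] (f : R →ₐ[ℂ] S) (a b : Fin N → R) :
    f.mapMatrix (bidiagonal a b) = bidiagonal (fun i => f (a i)) (fun i => f (b i)) := by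
  ext1 i j
  simp only [AlgHom.mapMatrix_apply, Matrix.map_apply, bidiagonal_apply, map_add, apply_ite f,
    map_zero]

end TwoVariables

end

end Toda

namespace Toda

noncomputable section

/-! ### Exchange relations with two independent spectral parameters -/

section TwoVariableExchange

open HahnSeries Sum

variable {N l l' : ℕ} {R S K : Type*} [Ring R] [Algebra ℂ R] [Ring S] [Algebra ℂ S]
  [CommRing K] [Algebra ℂ K] [Algebra K S] [IsScalarTower ℂ K S]

/-- The square of the spectral parameter `c z`. -/
def spectral (c : ℂˣ) (z : Kˣ) : Kˣ := scalarUnit K c ^ 2 * z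

/-- The corner entry of `L⁺` is inversely proportional to the squared parameter. Hence
multiplication by Z and W, respectively, gives equal results, as the wrap-around hypothesis of
`exchange_bidiagonal` demands. -/
theorem smul_of_laurentOff [NeZero N] {f : LaurentSeries R →ₐ[ℂ] S} {z : Kˣ} {b : Fin N → R}
    (hf : ∀ x, f (single (-2) x) = ((z⁻¹ : Kˣ) : K) • f (single 0 x)) (c : ℂˣ) {i : Fin N}
    (hi : i + 1 = 0) :
    (spectral c z : K) • f (laurentOff (-2) b c i) = f (single 0 (b i)) := by
  rw [laurentOff, if_pos hi, hf, ← smul_single, map_smul, ← algebraMap_smul K (((c ^ (-2 : ℤ) : ℂˣ)) : ℂ),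
    smul_smul, smul_smul]
  convert one_smul K _
  have : algebraMap ℂ K ((c ^ (-2 : ℤ) : ℂˣ) : ℂ) = ((scalarUnit K c ^ (-2 : ℤ) : Kˣ) : K) := by
    rw [← map_zpow]; rfl
  rw [this, ← Units.val_mul, ← Units.val_mul, Units.val_eq_one, spectral, mul_inv_cancel_right,
    zpow_neg]
  exact mul_inv_cancel _

/-- For `L⁻` the corner entry is proportional to the squared parameter, which fits the transposed
version with the weights interchanged. -/
theorem laurentOff_eq_smul [NeZero N] {f : LaurentSeries R →ₐ[ℂ] S} {z : Kˣ} {b : Fin N → R}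
    (hf : ∀ x, f (single 2 x) = (z : K) • f (single 0 x)) (c : ℂˣ) {i : Fin N}
    (hi : i + 1 = 0) :
    f (laurentOff 2 b c i) = (spectral c z : K) • f (single 0 (b i)) := by
  rw [laurentOff, if_pos hi, hf, ← smul_single, map_smul, ← algebraMap_smul K (((c ^ (2 : ℤ) : ℂˣ)) : ℂ),
    smul_smul]
  congr 1
  have : algebraMap ℂ K ((c ^ (2 : ℤ) : ℂˣ) : ℂ) = ((scalarUnit K c ^ (2 : ℤ) : Kˣ) : K) := by
    rw [← map_zpow]; rfl
  rw [this, spectral, mul_comm, Units.val_mul]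
  rfl

namespace TwoVariables

variable {f g : LaurentSeries R →ₐ[ℂ] S} {z w : Kˣ} (h : TwoVariables f g z w)
include h

omit [IsScalarTower ℂ K S] in
theorem map_laurentOff_of_ne [NeZero N] (d : ℤ) (b : Fin N → R) (c c' : ℂˣ) {i : Fin N}
    (hi : i + 1 ≠ 0) : f (laurentOff d b c i) = g (laurentOff d b c' i) := by
  rw [laurentOff, laurentOff, if_neg hi, if_neg hi, h.const]

omit [IsScalarTower ℂ K S] in
theorem commute_laurentOff [NeZero N] (d d' : ℤ) {b b' : Fin N → R} {i j : Fin N}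
    (hb : Commute (b i) (b' j)) (c c' : ℂˣ) :
    Commute (f (laurentOff d b c i)) (g (laurentOff d' b' c' j)) := by
  refine h.comm _ _ fun m k => ?_
  obtain ⟨e, x, h1⟩ := exists_laurentOff d b c i
  obtain ⟨e', x', h2⟩ := exists_laurentOff d' b' c' j
  rw [h1, h2, coeff_single, coeff_single]
  split_ifs
  exacts [(hb.smul_left x).smul_right x', Commute.zero_right _, Commute.zero_left _,
    Commute.zero_left _]

variable [NeZero N] {q : ℂˣ} {a b : Fin N → Rˣ}

theorem exchange_Lplus (hab : SiteRel q a b) (hN : 2 ≤ N) (c c' : ℂˣ) {ι : Type*} [Fintype ι]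
    [DecidableEq ι] {p p' : ι} (hp : p ≠ p') :
    rmatrix (Fin N) S (scalarUnit K q) (spectral c z : K) (spectral c' w : K) p p' *
        embed p (f.mapMatrix (Lplus a b c)) * embed p' (g.mapMatrix (Lplus a b c')) =
      embed p' (g.mapMatrix (Lplus a b c')) * embed p (f.mapMatrix (Lplus a b c)) *
        rmatrix (Fin N) S (scalarUnit K q) (spectral c z : K) (spectral c' w : K) p p' := by
  refine Exchange.embed ?_ hp
  rw [Lplus_eq, Lplus_eq, mapMatrix_bidiagonal, mapMatrix_bidiagonal]
  have h1 := (hab.weyl.laurent (-2) c).map_tower (K := K) f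
  have h2 := (hab.weyl.laurent (-2) c').map_tower (K := K) g
  simp only [← h.const] at h2 ⊢
  refine exchange_bidiagonal hN h1 h2 (fun i j => h.commute_laurentOff _ _ (hab.bb i j) _ _)
    (by rw [← map_mul]; simp) (fun i hi => h.map_laurentOff_of_ne _ _ _ _ hi) (fun i hi => ?_)
    ?_ ?_
  · rw [mul_smul, smul_of_laurentOff h.left' c hi, mul_smul, smul_of_laurentOff h.right' c' hi,
      h.const]
  · change (algebraMap ℂ K q) * _ - _ = _ * _ + ((algebraMap ℂ K q) - _) * _
    ring
  · change _ - (algebraMap ℂ K (q⁻¹ : ℂˣ)) * _ = _ * _ + (_ - (algebraMap ℂ K (q⁻¹ : ℂˣ))) * _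
    ring

theorem exchangeOp_Lminus (hab : SiteRel q a b) (hN : 2 ≤ N) (c c' : ℂˣ) {ι : Type*} [Fintype ι]
    [DecidableEq ι] {p p' : ι} (hp : p ≠ p') :
    embed p (f.mapMatrix (Lminus a b c)) * embed p' (g.mapMatrix (Lminus a b c')) *
        rmatrix (Fin N) S (scalarUnit K q) (spectral c z : K) (spectral c' w : K) p p' =
      rmatrix (Fin N) S (scalarUnit K q) (spectral c z : K) (spectral c' w : K) p p' *
        embed p' (g.mapMatrix (Lminus a b c')) * embed p (f.mapMatrix (Lminus a b c)) := by
  refine ExchangeOp.embed ?_ hp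
  have e : ∀ (f : LaurentSeries R →ₐ[ℂ] S) (M : Matrix (Fin N) (Fin N) (LaurentSeries R)),
    f.mapMatrix M.transpose = (f.mapMatrix M).transpose := fun _ _ => rfl
  rw [Lminus_eq, Lminus_eq, e, e, mapMatrix_bidiagonal, mapMatrix_bidiagonal]
  have h1 := (hab.weyl_inv.laurent 2 c).map_tower (K := K) f
  have h2 := (hab.weyl_inv.laurent 2 c').map_tower (K := K) g
  simp only [← h.const] at h2 ⊢
  refine exchangeOp_bidiagonal_transpose hN h1 h2
    (fun i j => h.commute_laurentOff _ _ (hab.bb i j) _ _)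
    (by rw [← map_mul]; simp) (fun i hi => h.map_laurentOff_of_ne _ _ _ _ hi) (fun i hi => ?_)
    ?_ ?_
  · rw [laurentOff_eq_smul h.left c hi, laurentOff_eq_smul h.right c' hi, h.const, smul_smul,
      smul_smul, mul_right_comm]
  · change _ - (algebraMap ℂ K (q⁻¹ : ℂˣ)) * _ = _ * _ + (_ - (algebraMap ℂ K (q⁻¹ : ℂˣ))) * _
    ring
  · change (algebraMap ℂ K q) * _ - _ = _ * _ + ((algebraMap ℂ K q) - _) * _
    ring

theorem exchange_LminusInv (hab : SiteRel q a b) (hN : 2 ≤ N) (c c' : ℂˣ) {ι : Type*} [Fintype ι]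
    [DecidableEq ι] {p p' : ι} (hp : p ≠ p') :
    rmatrix (Fin N) S (scalarUnit K q) (spectral c z : K) (spectral c' w : K) p p' *
        embed p (f.mapMatrix (LminusInv a b c)) * embed p' (g.mapMatrix (LminusInv a b c')) =
      embed p' (g.mapMatrix (LminusInv a b c')) * embed p (f.mapMatrix (LminusInv a b c)) *
        rmatrix (Fin N) S (scalarUnit K q) (spectral c z : K) (spectral c' w : K) p p' := by
  refine exchange_embed_inv (x := f.mapMatrix (Lminus a b c)) (y := g.mapMatrix (Lminus a b c'))
    ?_ ?_ ?_ ?_ (h.exchangeOp_Lminus hab hN c c' hp)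
  · rw [← map_mul, Lminus_mul_inv _ _ _ hN, map_one]
  · rw [← map_mul, Lminus_inv_mul _ _ _ hN, map_one]
  · rw [← map_mul, Lminus_mul_inv _ _ _ hN, map_one]
  · rw [← map_mul, Lminus_inv_mul _ _ _ hN, map_one]

omit [NeZero N] in
-- The squared parameters of the fused factors form geometric progressions of ratio q², and every
-- scalar to be inverted has the form cZ - dW with c, d nonzero constants.
theorem exists_fusedR (q : ℂˣ) :
    ∃ R : Matrix ((Fin l ↪o Fin N) × (Fin l' ↪o Fin N)) ((Fin l ↪o Fin N) × (Fin l' ↪o Fin N)) S,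
      IsUnit R ∧ (∀ s I J, Commute s (R I J)) ∧
      ∀ (x : Fin l → Matrix (Fin N) (Fin N) S) (y : Fin l' → Matrix (Fin N) (Fin N) S),
        (∀ (k : Fin l) (m : Fin l'), rmatrix (Fin N) S (scalarUnit K q) (spectral (q ^ (k : ℕ)) z : K)
              (spectral (q ^ (m : ℕ)) w : K) (inl k : Fin l ⊕ Fin l') (inr m) *
            embed (inl k) (x k) * embed (inr m) (y m) = embed (inr m) (y m) * embed (inl k) (x k) *
            rmatrix (Fin N) S (scalarUnit K q) (spectral (q ^ (k : ℕ)) z : K)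
              (spectral (q ^ (m : ℕ)) w : K) (inl k : Fin l ⊕ Fin l') (inr m)) →
        Preserves q (descProd x) → Preserves q (descProd y) →
        R * tensLeft (Fin l' ↪o Fin N) (fuse q (descProd x)) *
            tensRight (Fin l ↪o Fin N) (fuse q (descProd y)) =
          tensRight (Fin l ↪o Fin N) (fuse q (descProd y)) *
            tensLeft (Fin l' ↪o Fin N) (fuse q (descProd x)) * R := by
  have hs : ∀ (u : Kˣ) (k : ℕ), (spectral (q ^ (k + 1)) u : K) =
      (scalarUnit K q : K) ^ 2 * (spectral (q ^ k) u : K) := fun u k => by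
    rw [spectral, spectral]
    simp only [map_pow]
    push_cast
    ring
  refine Toda.exists_fusedR (Z := fun k : Fin l => (spectral (q ^ (k : ℕ)) z : K))
    (W := fun k : Fin l' => (spectral (q ^ (k : ℕ)) w : K)) q (fun k _ => hs z k)
    (fun k _ => hs w k) fun k m => ?_
  have key : ∀ c d : ℂˣ, (scalarUnit K c : K) * (spectral (q ^ (k : ℕ)) z : K) -
      (scalarUnit K d : K) * (spectral (q ^ (m : ℕ)) w : K) =
      algebraMap ℂ K (c * (q ^ (k : ℕ)) ^ 2 : ℂˣ) * z -
        algebraMap ℂ K (d * (q ^ (m : ℕ)) ^ 2 : ℂˣ) * w := by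
    intro c d
    simp [spectral]
    ring
  refine IsUnit.mul ?_ ?_
  · rw [← map_inv, key]
    exact h.isUnit _ _
  · rw [← neg_sub, ← map_inv, key]
    exact (h.isUnit _ _).neg

end TwoVariables

end TwoVariableExchange

end

end Toda

namespace Toda

noncomputable section

/-! ### Exchange relation for the monodromy matrix -/

section Commutativity

open HahnSeries Sum

variable {q : ℂˣ} {N L l l' : ℕ} [NeZero N] {S K : Type*} [Ring S] [Algebra ℂ S]
  [CommRing K] [Algebra ℂ K] [Algebra K S] [IsScalarTower ℂ K S]

theorem mapMatrix_fusedPlus_eq {R : Type*} [Ring R] [Algebra ℂ R] (f : LaurentSeries R →ₐ[ℂ] S)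
    (a b : Fin N → Rˣ) : f.mapMatrix (fusedPlus q l a b) =
      fuse q (descProd fun k : Fin l => f.mapMatrix (Lplus a b (q ^ (k : ℕ)))) := by
  rw [fusedPlus_eq, mapMatrix_fuse, mapMatrix_descProd]

theorem mapMatrix_fusedMinusInv_eq {R : Type*} [Ring R] [Algebra ℂ R]
    (f : LaurentSeries R →ₐ[ℂ] S) (a b : Fin N → Rˣ) : f.mapMatrix (fusedMinusInv q l a b) =
      fuse q (descProd fun k : Fin l => f.mapMatrix (LminusInv a b (q ^ (k : ℕ)))) := by
  rw [fusedMinusInv, mapMatrix_fuse, mapMatrix_descProd]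

theorem exchange_mul {M : Type*} [Monoid M] {r x₁ x₂ y₁ y₂ : M} (h₁ : r * x₁ * y₁ = y₁ * x₁ * r)
    (h₂ : r * x₂ * y₂ = y₂ * x₂ * r) (h : Commute x₂ y₁) (h' : Commute x₁ y₂) :
    r * (x₁ * x₂) * (y₁ * y₂) = y₁ * y₂ * (x₁ * x₂) * r := by
  calc r * (x₁ * x₂) * (y₁ * y₂) = r * x₁ * (x₂ * y₁) * y₂ := by simp only [mul_assoc]
    _ = (r * x₁ * y₁) * x₂ * y₂ := by rw [h.eq]; simp only [mul_assoc]
    _ = y₁ * x₁ * (r * x₂ * y₂) := by rw [h₁]; simp only [mul_assoc]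
    _ = y₁ * (x₁ * y₂) * x₂ * r := by rw [h₂]; simp only [mul_assoc]
    _ = _ := by rw [h'.eq]; simp only [mul_assoc]

omit [IsScalarTower ℂ K S] in
theorem TwoVariables.tens_commute {R : Type*} [Ring R] [Algebra ℂ R]
    {f g : LaurentSeries R →ₐ[ℂ] S} {z w : Kˣ} (h : TwoVariables f g z w) {m o : Type*} [Fintype m]
    [DecidableEq m] [Fintype o] [DecidableEq o] {F : Matrix m m (LaurentSeries R)}
    {G : Matrix o o (LaurentSeries R)}
    (hFG : ∀ I J I' J' i j, Commute ((F I J).coeff i) ((G I' J').coeff j)) :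
    Commute (tensLeft o (f.mapMatrix F)) (tensRight m (g.mapMatrix G)) :=
  tensLeft_commute_tensRight fun I J I' J' => h.comm _ _ (hFG I J I' J')

variable {f g : LaurentSeries (Aq q N L) →ₐ[ℂ] S} {z w : Kˣ}

theorem ne_add_one [NeZero L] (n : ZMod (2 * L)) : n ≠ n + 1 := by
  have := NeZero.ne L
  have : Fact (1 < 2 * L) := ⟨by omega⟩
  intro h
  exact one_ne_zero (left_eq_add.1 h)

theorem evenSite_injOn [NeZero L] (t : ℤ) {i j : ℕ} (hi : i < L) (hj : j < L)
    (h : evenSite L t i = evenSite L t j) : i = j := by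
  rw [evenSite, evenSite, ZMod.intCast_eq_intCast_iff, Int.modEq_iff_dvd] at h
  obtain ⟨c, hc⟩ := h
  push_cast at hc
  have h1 : (j : ℤ) - i = L * c := by
    have : 2 * ((j : ℤ) - i) = 2 * (L * c) := by linarith
    linarith
  have : c = 0 := by
    by_contra hc0
    rcases lt_or_gt_of_ne hc0 with h | h <;> nlinarith
  subst this
  omega

theorem evenSite_ne_add_one [NeZero L] (t : ℤ) (i j : ℕ) : evenSite L t i ≠ evenSite L t j + 1 := by
  intro h
  exact odd_val_add_one L _ t (odd_evenSite t j) (h ▸ odd_evenSite t i)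

/-- A single fused R-matrix exchanges the fused operators of all sites and of both signs.
Ultralocality propagates the exchange to the product over the sites, and the trace over the tensor
product of the two auxiliary spaces factors into the two transfer matrices. -/
theorem TwoVariables.transfer_commute [NeZero L] (h : TwoVariables f g z w) (hN : 2 ≤ N) (t : ℤ) :
    Commute (f (transfer q N L l t)) (g (transfer q N L l' t)) := by
  obtain ⟨R, hR, hRc, key⟩ := h.exists_fusedR (N := N) (l := l) (l' := l') q
  have hP : ∀ n : ZMod (2 * L), R *
      tensLeft (Fin l' ↪o Fin N) (f.mapMatrix
        (fusedPlus q l (fun i => a q N L i n) (fun i => b q N L i n))) *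
      tensRight (Fin l ↪o Fin N) (g.mapMatrix
        (fusedPlus q l' (fun i => a q N L i n) (fun i => b q N L i n))) =
      tensRight (Fin l ↪o Fin N) (g.mapMatrix
        (fusedPlus q l' (fun i => a q N L i n) (fun i => b q N L i n))) *
      tensLeft (Fin l' ↪o Fin N) (f.mapMatrix
        (fusedPlus q l (fun i => a q N L i n) (fun i => b q N L i n))) * R := fun n => by
    have hab := siteRel_gen q N L n
    rw [mapMatrix_fusedPlus_eq, mapMatrix_fusedPlus_eq]
    refine key _ _ (fun k m => h.exchange_Lplus hab hN _ _ (by simp)) ?_ ?_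
    · have := (hab.preserves_plus (l := l) hN).map f
      rwa [mapMatrix_descProd] at this
    · have := (hab.preserves_plus (l := l') hN).map g
      rwa [mapMatrix_descProd] at this
  have hM : ∀ n : ZMod (2 * L), R *
      tensLeft (Fin l' ↪o Fin N) (f.mapMatrix
        (fusedMinusInv q l (fun i => a q N L i n) (fun i => b q N L i n))) *
      tensRight (Fin l ↪o Fin N) (g.mapMatrix
        (fusedMinusInv q l' (fun i => a q N L i n) (fun i => b q N L i n))) =
      tensRight (Fin l ↪o Fin N) (g.mapMatrix
        (fusedMinusInv q l' (fun i => a q N L i n) (fun i => b q N L i n))) *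
      tensLeft (Fin l' ↪o Fin N) (f.mapMatrix
        (fusedMinusInv q l (fun i => a q N L i n) (fun i => b q N L i n))) * R := fun n => by
    have hab := siteRel_gen q N L n
    rw [mapMatrix_fusedMinusInv_eq, mapMatrix_fusedMinusInv_eq]
    refine key _ _ (fun k m => h.exchange_LminusInv hab hN _ _ (by simp)) ?_ ?_
    · have := (hab.preserves_minusInv (l := l) hN).map f
      rwa [mapMatrix_descProd] at this
    · have := (hab.preserves_minusInv (l := l') hN).map g
      rwa [mapMatrix_descProd] at this
  -- `L⁺` and the inverse of `L⁻` in one block live at the distinct sites `n` and `n + 1`, so their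
  -- exchange relations can be multiplied.
  have hS : ∀ n : ZMod (2 * L), R *
      tensLeft (Fin l' ↪o Fin N) (f.mapMatrix (siteProduct q N L l n)) *
      tensRight (Fin l ↪o Fin N) (g.mapMatrix (siteProduct q N L l' n)) =
      tensRight (Fin l ↪o Fin N) (g.mapMatrix (siteProduct q N L l' n)) *
      tensLeft (Fin l' ↪o Fin N) (f.mapMatrix (siteProduct q N L l n)) * R := fun n => by
    simp only [siteProduct, map_mul]
    exact exchange_mul (hM _) (hP _)
      (h.tens_commute fun I J I' J' => (isSiteOperator_fusedPlus n I J).commute (ne_add_one n)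
        (isSiteOperator_fusedMinusInv hN (n + 1) I' J'))
      (h.tens_commute fun I J I' J' => (isSiteOperator_fusedMinusInv hN (n + 1) I J).commute
        (ne_add_one n).symm (isSiteOperator_fusedPlus n I' J'))
  have hT := exchange_prod (r := R) (ks := (List.range L).reverse)
    (x := fun k => tensLeft (Fin l' ↪o Fin N) (f.mapMatrix (siteProduct q N L l (evenSite L t k))))
    (y := fun k => tensRight (Fin l ↪o Fin N) (g.mapMatrix (siteProduct q N L l' (evenSite L t k))))
    (List.nodup_reverse.2 List.nodup_range) (fun k _ => hS _) (fun k hk j hj hkj => by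
      rw [List.mem_reverse, List.mem_range] at hk hj
      exact h.tens_commute fun I J I' J' => siteProduct_commute hN
        (fun e => hkj (evenSite_injOn t hk hj e)) (evenSite_ne_add_one t j k).symm
        (evenSite_ne_add_one t k j) I J I' J')
  have hl : ((List.range L).reverse.map fun k => tensLeft (Fin l' ↪o Fin N)
      (f.mapMatrix (siteProduct q N L l (evenSite L t k)))).prod = tensLeft (Fin l' ↪o Fin N)
      (f.mapMatrix (((List.range L).reverse.map fun k => siteProduct q N L l (evenSite L t k)).prod)) := by
    rw [map_list_prod, map_list_prod, List.map_map, List.map_map]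
    rfl
  have hr : ((List.range L).reverse.map fun k => tensRight (Fin l ↪o Fin N)
      (g.mapMatrix (siteProduct q N L l' (evenSite L t k)))).prod = tensRight (Fin l ↪o Fin N)
      (g.mapMatrix (((List.range L).reverse.map fun k => siteProduct q N L l' (evenSite L t k)).prod)) := by
    rw [map_list_prod, map_list_prod, List.map_map, List.map_map]
    rfl
  rw [hl, hr] at hT
  have := trace_mul_comm_of_exchange hR hRc hT
  rw [trace_tensLeft_mul_tensRight, trace_tensRight_mul_tensLeft] at this
  rw [transfer_eq hN, transfer_eq hN, AddMonoidHom.map_trace f, AddMonoidHom.map_trace g]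
  exact this

end Commutativity

/-! ### Iterated Laurent series as a model of two independent parameters -/

section IteratedLaurent

open HahnSeries

variable {R : Type*} [Ring R] [Algebra ℂ R]

instance laurentAlgebra : Algebra ℂ (LaurentSeries R) := HahnSeries.instAlgebra

variable (R) in
/-- Coefficients as constant Laurent series. -/
def constHom : R →ₐ[ℂ] LaurentSeries R := { (C : R →+* LaurentSeries R) with
  commutes' := fun _ => rfl }

theorem constHom_apply (x : R) : constHom R x = single 0 x := rfl

/-- Iterated Laurent series over `ℂ` act on those over a `ℂ`-algebra. -/
def iteratedLaurentMap : LaurentSeries (LaurentSeries ℂ) →ₐ[ℂ] LaurentSeries (LaurentSeries R) :=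
  laurentMap (laurentMap (Algebra.ofId ℂ R))

variable (R) in
@[reducible]
def iteratedLaurentAlgebra :
    Algebra (LaurentSeries (LaurentSeries ℂ)) (LaurentSeries (LaurentSeries R)) :=
  (iteratedLaurentMap : _ →ₐ[ℂ] LaurentSeries (LaurentSeries R)).toRingHom.toAlgebra' fun _ _ =>
    (commute_of_coeff fun _ _ => commute_of_coeff fun _ _ =>
      show Commute (algebraMap ℂ R _) _ from Algebra.commutes _ _)

/-- The outer and the inner variable. -/
def outerUnit : (LaurentSeries (LaurentSeries ℂ))ˣ where
  val := single 2 1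
  inv := single (-2) 1
  val_inv := by rw [single_mul_single]; simp
  inv_val := by rw [single_mul_single]; simp

def innerUnit : (LaurentSeries (LaurentSeries ℂ))ˣ where
  val := single 0 (single 2 1)
  inv := single 0 (single (-2) 1)
  val_inv := by rw [single_mul_single, single_mul_single]; simp
  inv_val := by rw [single_mul_single, single_mul_single]; simp

/-- Constant outer series carry the first parameter as inner variable, while `laurentMap (constHom
R)` makes the second parameter the outer variable. The scalars ℂ((z))((w)) act centrally and form a
field, so invertibility is just nonvanishing. -/
theorem twoVariables : letI := iteratedLaurentAlgebra R
    TwoVariables (K := LaurentSeries (LaurentSeries ℂ)) (constHom (LaurentSeries R))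
      (laurentMap (constHom R)) innerUnit outerUnit := by
  let _ := iteratedLaurentAlgebra R
  have hsmul : ∀ (c : LaurentSeries (LaurentSeries ℂ)) (x : LaurentSeries (LaurentSeries R)),
    c • x = iteratedLaurentMap c * x := fun _ _ => rfl
  refine ⟨fun x => ?_, fun x => ?_, fun x => ?_, fun x => ?_, fun x => ?_, fun x y hxy => ?_,
    fun c d => ?_⟩
  · rw [laurentMap_single]; rfl
  · rw [hsmul, innerUnit, iteratedLaurentMap, laurentMap_single, laurentMap_single, constHom_apply,
      constHom_apply, single_mul_single, single_mul_single]
    simp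
  · rw [hsmul, outerUnit, iteratedLaurentMap, laurentMap_single, laurentMap_single,
      laurentMap_single, constHom_apply, single_mul_single]
    simp
  · rw [hsmul, innerUnit]
    change _ = iteratedLaurentMap (single 0 (single (-2) 1)) * _
    rw [iteratedLaurentMap, laurentMap_single, laurentMap_single, constHom_apply,
      constHom_apply, single_mul_single, single_mul_single]
    simp
  · rw [hsmul, outerUnit]
    change _ = iteratedLaurentMap (single (-2) 1) * _
    rw [iteratedLaurentMap, laurentMap_single, laurentMap_single,
      laurentMap_single, constHom_apply, single_mul_single]
    simp
  · refine commute_C_iff.2 fun k => ?_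
    rw [laurentMap_coeff, constHom_apply]
    exact (commute_C_iff.2 fun j => (hxy j k).symm).symm
  · refine (isUnit_iff_ne_zero (G₀ := LaurentSeries (LaurentSeries ℂ))).2 fun h0 => ?_
    -- The coefficient of outer degree 0 and inner degree 2 is `c`; the outer square does not
    -- contribute to it.
    have := congrArg (fun x : LaurentSeries (LaurentSeries ℂ) => (x.coeff 0).coeff 2) h0
    simp [innerUnit, outerUnit, HahnSeries.algebraMap_apply, C_apply, single_mul_single] at this

/-- Since the two variables are independent, one commutation relation of series contains those of
all pairs of coefficients. -/
theorem commute_of_iterated {x y : LaurentSeries R}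
    (h : Commute (constHom (LaurentSeries R) x) (laurentMap (constHom R) y)) (i j : ℤ) :
    Commute (x.coeff i) (y.coeff j) := by
  have := commute_C_iff.1 h j
  rw [laurentMap_coeff, constHom_apply] at this
  exact (commute_C_iff.1 this.symm i).symm

theorem transfer_coeff_commute {q : ℂˣ} {N L : ℕ} [NeZero N] [NeZero L] (hN : 2 ≤ N) (l l' : ℕ)
    (t i j : ℤ) :
    Commute ((transfer q N L l t).coeff i) ((transfer q N L l' t).coeff j) := by
  let _ := iteratedLaurentAlgebra (Aq q N L)
  have : IsScalarTower ℂ (LaurentSeries (LaurentSeries ℂ)) (LaurentSeries (LaurentSeries (Aq q N L))) :=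
    IsScalarTower.of_algebraMap_eq (R := ℂ) (S := LaurentSeries (LaurentSeries ℂ))
      (A := LaurentSeries (LaurentSeries (Aq q N L))) fun c =>
      ((iteratedLaurentMap : _ →ₐ[ℂ] LaurentSeries (LaurentSeries (Aq q N L))).commutes c).symm
  exact commute_of_iterated (twoVariables.transfer_commute hN t) i j

end IteratedLaurent

end

end Toda

namespace Toda

noncomputable section

/-! ### Conservation -/

section Rescale

open HahnSeries

variable {N : ℕ} [NeZero N] {R : Type*} [Ring R] [Algebra ℂ R]

/-- The substitution `z ↦ c z`. -/
def laurentRescaleFun (c : ℂˣ) (x : LaurentSeries R) : LaurentSeries R where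
  coeff k := ((c ^ k : ℂˣ) : ℂ) • x.coeff k
  isPWO_support' := x.isPWO_support.mono fun k hk h => hk (by
    change _ • x.coeff k = 0
    rw [not_not.1 (fun h' => h' h), smul_zero])

theorem laurentRescaleFun_coeff (c : ℂˣ) (x : LaurentSeries R) (k : ℤ) :
    (laurentRescaleFun c x).coeff k = ((c ^ k : ℂˣ) : ℂ) • x.coeff k := rfl

theorem laurentRescaleFun_single (c : ℂˣ) (d : ℤ) (x : R) :
    laurentRescaleFun c (single d x) = single d (((c ^ d : ℂˣ) : ℂ) • x) := by
  ext k
  rw [laurentRescaleFun_coeff]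
  by_cases hk : k = d
  · subst hk; simp
  · simp [coeff_single_of_ne hk]

theorem support_laurentRescaleFun (c : ℂˣ) (x : LaurentSeries R) :
    (laurentRescaleFun c x).support = x.support := by
  ext k
  rw [mem_support, mem_support, laurentRescaleFun_coeff, ne_eq, ne_eq,
    show ((c ^ k : ℂˣ) : ℂ) • x.coeff k = 0 ↔ x.coeff k = 0 from
      smul_eq_zero_iff_eq (c ^ k : ℂˣ)]

/-- The substitution `z ↦ c z`. -/
def laurentRescale (c : ℂˣ) : LaurentSeries R →+* LaurentSeries R where
  toFun := laurentRescaleFun c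
  map_one' := by
    change laurentRescaleFun c (single 0 1) = single 0 1
    rw [laurentRescaleFun_single]
    simp
  map_zero' := by ext k; simp [laurentRescaleFun_coeff]
  map_add' x y := by ext k; simp [laurentRescaleFun_coeff]
  map_mul' x y := by
    ext k
    rw [laurentRescaleFun_coeff, coeff_mul, coeff_mul, Finset.smul_sum]
    refine Finset.sum_congr (by simp only [support_laurentRescaleFun]) fun p hp => ?_
    rw [laurentRescaleFun_coeff, laurentRescaleFun_coeff, smul_mul_smul_comm,
      ← (Finset.mem_antidiagonal.1 hp).2.2, zpow_add, Units.val_mul]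

theorem laurentRescale_single (c : ℂˣ) (d : ℤ) (x : R) :
    laurentRescale c (single d x) = single d (((c ^ d : ℂˣ) : ℂ) • x) :=
  laurentRescaleFun_single c d x

theorem laurentRescale_Lplus (a b : Fin N → Rˣ) (c : ℂˣ) :
    (laurentRescale c).mapMatrix (Lplus a b 1) = Lplus a b c := by
  ext1 i j
  simp only [RingHom.mapMatrix_apply, Matrix.map_apply, Lplus, Matrix.of_apply, map_add,
    apply_ite (laurentRescale c), laurentRescale_single, map_zero, zpow_zero, Units.val_one,
    one_smul, one_zpow]

theorem laurentRescale_Lminus (a b : Fin N → Rˣ) (c : ℂˣ) :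
    (laurentRescale c).mapMatrix (Lminus a b 1) = Lminus a b c := by
  ext1 i j
  simp only [RingHom.mapMatrix_apply, Matrix.map_apply, Lminus, Matrix.of_apply, map_add,
    apply_ite (laurentRescale c), laurentRescale_single, map_zero, zpow_zero, Units.val_one,
    one_smul, one_zpow]

variable {R' : Type*} [Ring R'] [Algebra ℂ R']

theorem mapMatrix_Lplus (f : R →ₐ[ℂ] R') (a b : Fin N → Rˣ) (c : ℂˣ) :
    (laurentMap f).mapMatrix (Lplus a b c) =
      Lplus (fun i => Units.map (f : R →* R') (a i)) (fun i => Units.map (f : R →* R') (b i)) c := by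
  ext1 i j
  have := laurentMap_Lplus (a := a) (b := b) (a' := fun i => Units.map (f : R →* R') (a i))
    (b' := fun i => Units.map (f : R →* R') (b i)) (f := f) (x := 1) (y := 1) (by simp) (by simp) c i j
  simpa using this

theorem mapMatrix_Lminus (f : R →ₐ[ℂ] R') (a b : Fin N → Rˣ) (c : ℂˣ) :
    (laurentMap f).mapMatrix (Lminus a b c) =
      Lminus (fun i => Units.map (f : R →* R') (a i)) (fun i => Units.map (f : R →* R') (b i)) c := by
  ext1 i j
  have := laurentMap_Lminus (a := a) (b := b) (a' := fun i => Units.map (f : R →* R') (a i))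
    (b' := fun i => Units.map (f : R →* R') (b i)) (f := f) (x := 1) (y := 1)
    (fun i => by rw [← map_inv]; simp) (by simp) c i j
  simpa using this

end Rescale

/-! ### Zero curvature for fused operators and monodromy matrices -/

section Conservation

open HahnSeries

variable {q : ℂˣ} {N L l : ℕ} [NeZero N] {B : Type*} [Ring B] [Algebra ℂ B]
  {ρ : ℤ → (Aq q N L →ₐ[ℂ] B)}

theorem Lplus_commute_Lminus {n m : ZMod (2 * L)} (h : n ≠ m) (c c' : ℂˣ) (i j i' j' : Fin N) :
    Commute (Lplus (fun i => a q N L i n) (fun i => b q N L i n) c i j)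
      (Lminus (fun i => a q N L i m) (fun i => b q N L i m) c' i' j') :=
  commute_of_coeff fun r => by
    have h1 : ∀ x : Aq q N L, CommuteSite x n → Commute x
        ((Lplus (fun i => a q N L i n) (fun i => b q N L i n) c i j).coeff r) := fun x hx =>
      commute_C_iff.1 (commute_Lplus hx.1 hx.2 c i j) r
    exact commute_C_iff.1 (commute_Lminus (fun p => (h1 _ (commuteSite_a h.symm p)).symm)
      (fun p => (h1 _ (commuteSite_b h.symm p)).symm) c' i' j')

/-- The equation is an identity in the formal variable, so the substitution of `c z` for z supplies
the shifted parameters needed in fusion. -/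
theorem ZeroCurvature.mul (h : ZeroCurvature ρ) {t : ℤ} {n : ZMod (2 * L)}
    (hn : Odd ((n.val : ℤ) + t)) (c : ℂˣ) :
    (laurentMap (ρ (t + 1))).mapMatrix (Lminus (fun i => a q N L i n) (fun i => b q N L i n) c) *
      (laurentMap (ρ t)).mapMatrix (Lplus (fun i => a q N L i n) (fun i => b q N L i n) c) =
    (laurentMap (ρ (t + 1))).mapMatrix
        (Lplus (fun i => a q N L i (n - 1)) (fun i => b q N L i (n - 1)) c) *
      (laurentMap (ρ t)).mapMatrix
        (Lminus (fun i => a q N L i (n - 1)) (fun i => b q N L i (n - 1)) c) := by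
  have := congrArg (laurentRescale c).mapMatrix (h t n hn)
  rw [map_mul, map_mul, laurentRescale_Lplus, laurentRescale_Lplus, laurentRescale_Lminus,
    laurentRescale_Lminus] at this
  rw [mapMatrix_Lplus, mapMatrix_Lplus, mapMatrix_Lminus, mapMatrix_Lminus]
  exact this

/-- The fused L-operators satisfy the zero curvature equation. -/
theorem ZeroCurvature.fused [NeZero L] (h : ZeroCurvature ρ) (hN : 2 ≤ N) {t : ℤ}
    {n : ZMod (2 * L)} (hn : Odd ((n.val : ℤ) + t)) :
    (laurentMap (ρ (t + 1))).mapMatrix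
        (fusedMinus q l (fun i => a q N L i n) (fun i => b q N L i n)) *
      (laurentMap (ρ t)).mapMatrix (fusedPlus q l (fun i => a q N L i n) (fun i => b q N L i n)) =
    (laurentMap (ρ (t + 1))).mapMatrix
        (fusedPlus q l (fun i => a q N L i (n - 1)) (fun i => b q N L i (n - 1))) *
      (laurentMap (ρ t)).mapMatrix
        (fusedMinus q l (fun i => a q N L i (n - 1)) (fun i => b q N L i (n - 1))) := by
  have ne : n - 1 ≠ n := fun e => ne_add_one (n - 1) (by rw [sub_add_cancel]; exact e)
  have h1 := (((siteRel_gen q N L n).preserves_plus (l := l) hN)).map (laurentMap (ρ t))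
  have h2 := (((siteRel_gen q N L (n - 1)).preserves_minus (l := l) hN)).map (laurentMap (ρ t))
  rw [fusedPlus_eq, fusedPlus_eq, fusedMinus_eq, fusedMinus_eq, mapMatrix_fuse, mapMatrix_fuse,
    mapMatrix_fuse, mapMatrix_fuse, ← fuse_mul h1, ← fuse_mul h2, mapMatrix_descProd,
    mapMatrix_descProd, mapMatrix_ascProd, mapMatrix_ascProd]
  congr 1
  -- The innermost pair is exchanged first, and the others follow outwards. The operators in
  -- different tensor factors that have to pass each other belong to the same time and to the sites
  -- `n` and `n - 1`; no relation between different times is used.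
  refine nested_prod (List.nodup_finRange l) (fun k => ?_) (fun k j hkj => ?_) fun k j hkj => ?_
  · rw [← embed_mul, ← embed_mul, h.mul hn]
  · exact embed_commute hkj fun i i' r r' =>
      (Lplus_commute_Lminus ne (q ^ (j : ℕ)) (q ^ (k : ℕ)) r r' i i').symm.map (laurentMap (ρ (t + 1)))
  · exact embed_commute hkj fun i i' r r' =>
      (Lplus_commute_Lminus ne.symm (q ^ (k : ℕ)) (q ^ (j : ℕ)) i i' r r').map (laurentMap (ρ t))

/-- The monodromy matrix of the sites from `n` to `n + 2 K - 1`. -/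
def monodromy (q : ℂˣ) (N L l : ℕ) [NeZero N] (n : ZMod (2 * L)) (K : ℕ) :
    Matrix (Fin l ↪o Fin N) (Fin l ↪o Fin N) (LaurentSeries (Aq q N L)) :=
  ((List.range K).reverse.map fun k : ℕ => siteProduct q N L l (n + 2 * (k : ZMod (2 * L)))).prod

theorem monodromy_succ (n : ZMod (2 * L)) (K : ℕ) : monodromy q N L l n (K + 1) =
    siteProduct q N L l (n + 2 * (K : ZMod (2 * L))) * monodromy q N L l n K := by
  rw [monodromy, List.range_succ, List.reverse_append, List.reverse_singleton,
    List.singleton_append, List.map_cons, List.prod_cons]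
  rfl

theorem monodromy_succ' (n : ZMod (2 * L)) (K : ℕ) : monodromy q N L l n (K + 1) =
    monodromy q N L l (n + 2) K * siteProduct q N L l n := by
  induction K with
  | zero => simp [monodromy]
  | succ K ih =>
    have e : n + 2 * ((K + 1 : ℕ) : ZMod (2 * L)) = n + 2 + 2 * (K : ZMod (2 * L)) := by
      push_cast
      ring
    rw [monodromy_succ, ih, monodromy_succ, mul_assoc, e]

theorem transfer_eq_monodromy (hN : 2 ≤ N) (t : ℤ) :
    transfer q N L l t = (monodromy q N L l (evenSite L t 0) L).trace := by
  have e : ∀ k : ℕ, evenSite L t k = evenSite L t 0 + 2 * (k : ZMod (2 * L)) := fun k => by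
    rw [evenSite, evenSite]
    push_cast
    ring
  have e' : ((List.range L).reverse.map fun k => siteProduct q N L l (evenSite L t k)) =
      (List.range L).reverse.map fun k : ℕ =>
        siteProduct q N L l (evenSite L t 0 + 2 * (k : ZMod (2 * L))) :=
    List.map_congr_left fun k _ => congrArg _ (e k)
  rw [transfer_eq hN, monodromy, e']

theorem natCast_ne_of_lt {k : ℕ} (h0 : 0 < k) (hk : k < 2 * L) (n : ZMod (2 * L)) :
    n + (k : ZMod (2 * L)) ≠ n := by
  intro h
  rw [add_eq_left, ZMod.natCast_eq_zero_iff] at h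
  exact absurd (Nat.le_of_dvd h0 h) (by omega)

theorem two_mul_natCast_self (L : ℕ) : (2 : ZMod (2 * L)) * (L : ZMod (2 * L)) = 0 := by
  have := ZMod.natCast_self (2 * L)
  push_cast at this
  exact this

theorem sites_ne {k : ℕ} (hk : k + 1 < L) (n : ZMod (2 * L)) :
    n ≠ n + 2 + 2 * (k : ZMod (2 * L)) ∧ n + 1 ≠ n + 2 + 2 * (k : ZMod (2 * L)) ∧
      n ≠ n + 2 + 2 * (k : ZMod (2 * L)) + 1 := by
  have h1 := natCast_ne_of_lt (L := L) (k := 2 + 2 * k) (by omega) (by omega) n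
  have h2 := natCast_ne_of_lt (L := L) (k := 1 + 2 * k) (by omega) (by omega) (n + 1)
  have h3 := natCast_ne_of_lt (L := L) (k := 3 + 2 * k) (by omega) (by omega) n
  push_cast at h1 h2 h3
  refine ⟨fun h => h1 ?_, fun h => h2 ?_, fun h => h3 ?_⟩
  · linear_combination -h
  · linear_combination -h
  · linear_combination -h

/-- A block and the product of the remaining blocks involve disjoint sets of sites, so this instance
of cyclicity is legitimate. -/
theorem trace_siteProduct_mul_monodromy (hN : 2 ≤ N) (n : ZMod (2 * L)) {K : ℕ} (hK : K + 1 = L) :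
    (siteProduct q N L l n * monodromy q N L l (n + 2) K).trace =
      (monodromy q N L l (n + 2) K * siteProduct q N L l n).trace := by
  have key : ∀ i j i' j', Commute (siteProduct q N L l n i j) (monodromy q N L l (n + 2) K i' j') := by
    intro i j i' j'
    rw [monodromy]
    refine commute_prod_apply (S := LaurentSeries (Aq q N L)) (fun M hM i' j' => ?_) i' j'
    obtain ⟨k, hk, rfl⟩ := List.mem_map.1 hM
    rw [List.mem_reverse, List.mem_range] at hk
    obtain ⟨h1, h2, h3⟩ := sites_ne (L := L) (k := k) (by omega) n
    exact commute_of_coeff (siteProduct_commute hN h1 h2 h3 i j i' j')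
  generalize siteProduct q N L l n = A at key ⊢
  generalize monodromy q N L l (n + 2) K = M at key ⊢
  exact trace_mul_comm_of_commute (S := LaurentSeries (Aq q N L)) fun i j => key i j j i

/-- The trace of the monodromy matrix does not depend on the initial site. -/
theorem trace_monodromy_add_two [NeZero L] (hN : 2 ≤ N) (n : ZMod (2 * L)) :
    (monodromy q N L l (n + 2) L).trace = (monodromy q N L l n L).trace := by
  obtain ⟨K, hK⟩ : ∃ K, K + 1 = L := ⟨L - 1, by have := NeZero.ne L; omega⟩
  have e1 := monodromy_succ (q := q) (N := N) (l := l) (n + 2) K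
  have e2 := monodromy_succ' (q := q) (N := N) (l := l) n K
  have e : n + 2 + 2 * (K : ZMod (2 * L)) = n := by
    have := two_mul_natCast_self L
    have hK' : ((K : ZMod (2 * L)) + 1) = L := by rw [← hK]; push_cast; rfl
    linear_combination this + 2 * hK'
  rw [e, hK] at e1
  rw [hK] at e2
  rw [e1, e2, trace_siteProduct_mul_monodromy hN n hK]

theorem odd_val_add_two_mul [NeZero L] {n : ZMod (2 * L)} {t : ℤ} (h : Odd ((n.val : ℤ) + t))
    (k : ℕ) : Odd (((n + 2 * (k : ZMod (2 * L))).val : ℤ) + t) := by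
  have hL := NeZero.ne L
  have : NeZero (2 * L) := ⟨by omega⟩
  have e : n + 2 * (k : ZMod (2 * L)) = (((n.val : ℤ) + 2 * k : ℤ) : ZMod (2 * L)) := by
    push_cast
    rw [ZMod.natCast_zmod_val]
  rw [e, odd_val_intCast, Int.odd_iff]
  rw [Int.odd_iff] at h
  omega

/-- The discrete parallel transport: one time step conjugates the monodromy by the `L⁻` at the two
ends of the interval of sites. It follows by adding one pair of sites at a time. -/
theorem ZeroCurvature.monodromy [NeZero L] (h : ZeroCurvature ρ) (hN : 2 ≤ N) {t : ℤ}
    {n : ZMod (2 * L)} (hn : Odd ((n.val : ℤ) + t)) (K : ℕ) :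
    (laurentMap (ρ t)).mapMatrix (fusedMinus q l
        (fun i => a q N L i (n + 2 * (K : ZMod (2 * L)) - 1))
        (fun i => b q N L i (n + 2 * (K : ZMod (2 * L)) - 1))) *
      (laurentMap (ρ t)).mapMatrix (monodromy q N L l n K) =
    (laurentMap (ρ (t + 1))).mapMatrix (Toda.monodromy q N L l (n - 1) K) *
      (laurentMap (ρ t)).mapMatrix (fusedMinus q l (fun i => a q N L i (n - 1))
        (fun i => b q N L i (n - 1))) := by
  induction K with
  | zero => simp [Toda.monodromy]
  | succ K ih =>
    have hK := odd_val_add_two_mul hn K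
    have e1 : n + 2 * ((K + 1 : ℕ) : ZMod (2 * L)) - 1 = n + 2 * (K : ZMod (2 * L)) + 1 := by
      push_cast; ring
    have e2 : n - 1 + 2 * (K : ZMod (2 * L)) = n + 2 * (K : ZMod (2 * L)) - 1 := by ring
    have hzc := h.fused (l := l) hN hK
    rw [e1, monodromy_succ, monodromy_succ, e2]
    generalize n + 2 * (K : ZMod (2 * L)) = m at *
    rw [map_mul, siteProduct, ← mul_assoc, map_mul, ← mul_assoc, ← map_mul,
      (siteRel_gen q N L (m + 1)).fusedMinus_mul_inv hN, map_one, one_mul]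
    -- The zero curvature equation solved for `L⁺` at time t: it becomes a complete block at time
    -- t+1, shifted by one site, times `L⁻` at time t.
    have h2 : (laurentMap (ρ t)).mapMatrix
        (fusedPlus q l (fun i => a q N L i m) (fun i => b q N L i m)) =
        (laurentMap (ρ (t + 1))).mapMatrix (siteProduct q N L l (m - 1)) *
          (laurentMap (ρ t)).mapMatrix (fusedMinus q l (fun i => a q N L i (m - 1))
            (fun i => b q N L i (m - 1))) := by
      rw [siteProduct, map_mul, mul_assoc, sub_add_cancel, ← hzc, ← mul_assoc, ← map_mul,
        (siteRel_gen q N L m).fusedMinus_inv_mul hN, map_one, one_mul]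
    rw [h2, mul_assoc, ih, map_mul, mul_assoc]

/-- By periodicity both ends of the transport carry the same `L⁻`. Conjugation does not preserve the
trace in general, but here it only moves the leftmost factor of the monodromy matrix to its right
end. -/
theorem ZeroCurvature.transfer_succ [NeZero L] (h : ZeroCurvature ρ) (hN : 2 ≤ N) (t : ℤ) :
    laurentMap (ρ t) (transfer q N L l t) = laurentMap (ρ (t + 1)) (transfer q N L l (t + 1)) := by
  have hn := odd_evenSite (L := L) t 0
  -- For odd t the shifted product starts at the initial site prescribed at time t+1. For even t it
  -- starts at site 0 and not at 2, so one rotation by two sites is needed.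
  have hrot : (Toda.monodromy q N L l (evenSite L t 0 - 1) L).trace = transfer q N L l (t + 1) := by
    rw [transfer_eq_monodromy hN]
    rcases Int.emod_two_eq_zero_or_one t with ht | ht
    · rw [← trace_monodromy_add_two hN]
      congr 2
      rw [evenSite, evenSite, ht, (by omega : (t + 1) % 2 = 1)]
      push_cast
      ring
    · congr 2
      rw [evenSite, evenSite, ht, (by omega : (t + 1) % 2 = 0)]
      push_cast
      ring
  rw [← hrot, transfer_eq_monodromy hN]
  generalize evenSite L t 0 = n at hn
  obtain ⟨K, rfl⟩ : ∃ K, L = K + 1 := ⟨L - 1, by have := NeZero.ne L; omega⟩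
  have key := h.monodromy (l := l) hN hn (K + 1)
  have e : n + 2 * ((K + 1 : ℕ) : ZMod (2 * (K + 1))) - 1 = n - 1 := by
    rw [two_mul_natCast_self, add_zero]
  have e' : n + 2 * (K : ZMod (2 * (K + 1))) + 1 = n - 1 := by
    rw [← e]; push_cast; ring
  rw [e] at key
  have hm := siteRel_gen q N (K + 1) (n - 1)
  -- The remaining factors occupy the sites `n, …, n + 2K`, all distinct from `n - 1`.
  have hcomm : (fusedMinusInv q l (fun i => a q N (K + 1) i (n - 1))
        (fun i => b q N (K + 1) i (n - 1)) *
      (fusedPlus q l (fun i => a q N (K + 1) i (n + 2 * (K : ZMod (2 * (K + 1)))))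
        (fun i => b q N (K + 1) i (n + 2 * (K : ZMod (2 * (K + 1))))) *
          Toda.monodromy q N (K + 1) l n K)).trace =
      (fusedPlus q l (fun i => a q N (K + 1) i (n + 2 * (K : ZMod (2 * (K + 1)))))
        (fun i => b q N (K + 1) i (n + 2 * (K : ZMod (2 * (K + 1))))) *
          Toda.monodromy q N (K + 1) l n K * fusedMinusInv q l (fun i => a q N (K + 1) i (n - 1))
        (fun i => b q N (K + 1) i (n - 1))).trace := by
    refine trace_mul_comm_of_commute fun i j => ?_
    rw [Matrix.mul_apply]
    refine Commute.sum_right _ _ _ fun r _ => Commute.mul_right ?_ ?_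
    · exact commute_of_coeff fun c c' => (isSiteOperator_fusedMinusInv hN (n - 1) i j).commute
        (by rw [← e']; exact (ne_add_one _).symm) (isSiteOperator_fusedPlus _ j r) c c'
    · refine commute_prod_apply (fun M hM i' j' => ?_) _ _
      obtain ⟨k, hk, rfl⟩ := List.mem_map.1 hM
      rw [List.mem_reverse, List.mem_range] at hk
      rw [siteProduct, Matrix.mul_apply]
      refine Commute.sum_right _ _ _ fun r' _ => Commute.mul_right ?_ ?_
      · refine commute_of_coeff fun c c' => (isSiteOperator_fusedMinusInv hN (n - 1) i j).commute
          ?_ (isSiteOperator_fusedMinusInv hN _ i' r') c c'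
        have := natCast_ne_of_lt (L := K + 1) (k := 2 + 2 * k) (by omega) (by omega) (n - 1)
        intro h
        apply this
        conv_rhs => rw [h]
        push_cast
        ring
      · refine commute_of_coeff fun c c' => (isSiteOperator_fusedMinusInv hN (n - 1) i j).commute
          ?_ (isSiteOperator_fusedPlus _ r' j') c c'
        have := natCast_ne_of_lt (L := K + 1) (k := 1 + 2 * k) (by omega) (by omega) (n - 1)
        intro h
        apply this
        conv_rhs => rw [h]
        push_cast
        ring
  -- Since `n + 2K + 1 = n - 1`, the `L⁻` on the left of the transport relation cancels the leftmost
  -- factor of the monodromy matrix, and the one on the right is inverted.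
  have key2 : (laurentMap (ρ (t + 1))).mapMatrix (Toda.monodromy q N (K + 1) l (n - 1) (K + 1)) =
      (laurentMap (ρ t)).mapMatrix (fusedPlus q l
        (fun i => a q N (K + 1) i (n + 2 * (K : ZMod (2 * (K + 1)))))
        (fun i => b q N (K + 1) i (n + 2 * (K : ZMod (2 * (K + 1))))) *
          Toda.monodromy q N (K + 1) l n K * fusedMinusInv q l (fun i => a q N (K + 1) i (n - 1))
        (fun i => b q N (K + 1) i (n - 1))) := by
    rw [monodromy_succ n, siteProduct, e', mul_assoc, ← map_mul, ← mul_assoc (fusedMinus q l _ _),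
      hm.fusedMinus_mul_inv hN, one_mul] at key
    rw [map_mul, key, mul_assoc, ← map_mul, hm.fusedMinus_mul_inv hN, map_one, mul_one]
  rw [AddMonoidHom.map_trace (laurentMap (ρ (t + 1))), ← AlgHom.mapMatrix_apply, key2,
    AlgHom.mapMatrix_apply, ← AddMonoidHom.map_trace, ← hcomm, monodromy_succ n, siteProduct, e',
    mul_assoc]

end Conservation

end

end Toda

namespace Toda

noncomputable section

/-! ### The zero curvature equation in components -/

section Components

open HahnSeries

variable {N : ℕ} [NeZero N] {R : Type*} [Ring R] [Algebra ℂ R]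

theorem sum_bidiagonal_mul {S : Type*} [Ring S] (x y f : Fin N → S) (i : Fin N) :
    ∑ j, bidiagonal x y i j * f j = x i * f i + y i * f (i + 1) := by
  simp [bidiagonal_apply, add_mul, Finset.sum_add_distrib]

theorem sum_bidiagonal_transpose_mul {S : Type*} [Ring S] (x y f : Fin N → S) (i : Fin N) :
    ∑ j, (bidiagonal x y).transpose i j * f j = x i * f i + y (i - 1) * f (i - 1) := by
  simp [bidiagonal_apply, add_mul, Finset.sum_add_distrib, ← sub_eq_iff_eq_add]

/-- The power of `z` multiplying `b_i` in `L⁺`. -/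
def offDegree (i : Fin N) : ℤ := if i + 1 = 0 then -2 else 0

theorem laurentOff_neg_two (b : Fin N → R) (i : Fin N) :
    laurentOff (-2) b 1 i = single (offDegree i) (b i) := by
  rw [laurentOff, offDegree]
  split_ifs <;> simp

theorem laurentOff_two (b : Fin N → R) (i : Fin N) :
    laurentOff 2 b 1 i = single (-offDegree i) (b i) := by
  rw [laurentOff, offDegree]
  split_ifs <;> simp

/-- For N = 2 the neighbours `i + 1` and `i - 1` coincide, and an entry of the zero curvature
equation mixes two relations. They are told apart by their powers of z. -/
theorem offDegree_ne {i : Fin N} (h : i + 1 + 1 = i) : -offDegree (i + 1) ≠ offDegree i := by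
  intro e
  rw [offDegree, offDegree] at e
  by_cases h2 : i + 1 = 0
  · rw [if_pos h2] at e
    split_ifs at e
    all_goals omega
  · by_cases h1 : i + 1 + 1 = 0
    · rw [if_pos h1, if_neg h2] at e
      omega
    · have e1 := val_add_one_of_ne h2
      have e2 := val_add_one_of_ne h1
      rw [h] at e2
      omega

variable {a b a' b' A B A' B' : Fin N → Rˣ}

/-- These are the entries at `(i, i)`, `(i, i + 1)` and `(i + 1, i)`. On the diagonal the powers of
z cancel; off the diagonal a single power is selected, which also separates the relations when N =
2. -/
theorem zeroCurvature_components (hN : 2 ≤ N)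
    (h : Lminus A B 1 * Lplus a b 1 = Lplus A' B' 1 * Lminus a' b' 1) (i : Fin N) :
    (((A i)⁻¹ * a i : Rˣ) : R) + (B (i - 1) * b (i - 1) : Rˣ) =
        ((A' i * (a' i)⁻¹ : Rˣ) : R) + (B' i * b' i : Rˣ) ∧
      (A i)⁻¹ * b i = B' i * (a' (i + 1))⁻¹ ∧ B i * a i = A' (i + 1) * b' i := by
  have ne : ∀ i : Fin N, i + 1 ≠ i := add_one_ne_self hN
  have ne' : ∀ i : Fin N, i ≠ i - 1 := fun i e => ne (i - 1) (by rw [sub_add_cancel]; exact e)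
  have D : ∀ (x y : Fin N → LaurentSeries R) i, bidiagonal x y i i = x i := fun x y i => by
    simp [bidiagonal_apply, (ne i).symm]
  have O : ∀ (x y : Fin N → LaurentSeries R) i, bidiagonal x y i (i + 1) = y i := fun x y i => by
    simp [bidiagonal_apply, ne i]
  have O' : ∀ (x y : Fin N → LaurentSeries R) i, bidiagonal x y (i - 1) i = y (i - 1) :=
    fun x y i => by simp [bidiagonal_apply, ne' i]
  have key : ∀ i k : Fin N, single 0 ((A i)⁻¹.val : R) *
        bidiagonal (fun i => single 0 (a i : R)) (laurentOff (-2) (fun i => (b i : R)) 1) i k +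
      single (-offDegree (i - 1)) (B (i - 1) : R) *
        bidiagonal (fun i => single 0 (a i : R)) (laurentOff (-2) (fun i => (b i : R)) 1) (i - 1) k =
      single 0 (A' i : R) * bidiagonal (fun i => single 0 ((a' i)⁻¹.val : R))
        (laurentOff 2 (fun i => (b' i : R)) 1) k i +
      single (offDegree i) (B' i : R) * bidiagonal (fun i => single 0 ((a' i)⁻¹.val : R))
        (laurentOff 2 (fun i => (b' i : R)) 1) k (i + 1) := fun i k => by
    have := congrFun (congrFun h i) k
    rwa [Matrix.mul_apply, Matrix.mul_apply, Lplus_eq, Lplus_eq, Lminus_eq, Lminus_eq,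
      sum_bidiagonal_mul, sum_bidiagonal_transpose_mul, laurentOff_neg_two, laurentOff_two] at this
  refine ⟨?_, ?_, ?_⟩
  · have h0 := congrArg (fun x => x.coeff 0) (key i i)
    rw [D, O', D, O, laurentOff_neg_two, laurentOff_two] at h0
    simpa [single_mul_single] using h0
  · have h0 := congrArg (fun x => x.coeff (offDegree i)) (key i (i + 1))
    rw [D, O, laurentOff_neg_two] at h0
    rw [← Units.val_inj]
    -- If the two neighbours of `i` coincide, the extra terms are removed by comparing degrees;
    -- otherwise they vanish as matrix entries.
    by_cases h2 : i + 1 + 1 = i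
    · have e : i - 1 = i + 1 := by rw [sub_eq_iff_eq_add, h2]
      have O2 : ∀ (x y : Fin N → LaurentSeries R), bidiagonal x y (i + 1) i = y (i + 1) :=
        fun x y => by have := O x y (i + 1); rwa [h2] at this
      rw [e, D, O2, laurentOff_two] at h0
      simpa [single_mul_single, coeff_single_of_ne (offDegree_ne h2).symm] using h0
    · have h3 : i + 1 ≠ i - 1 := fun e => h2 (by rw [e, sub_add_cancel])
      have h4 : i + 1 ≠ i - 1 + 1 := by rw [sub_add_cancel]; exact ne i
      have Z : ∀ (x y : Fin N → LaurentSeries R), bidiagonal x y (i - 1) (i + 1) = 0 :=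
        fun x y => by simp [bidiagonal_apply, h3, ne i]
      have Z' : ∀ (x y : Fin N → LaurentSeries R), bidiagonal x y (i + 1) i = 0 :=
        fun x y => by simp [bidiagonal_apply, (ne i).symm, Ne.symm h2]
      rw [Z, Z'] at h0
      simpa [single_mul_single] using h0
  · have h0 := congrArg (fun x => x.coeff (-offDegree i)) (key (i + 1) i)
    rw [add_sub_cancel_right, D, O, laurentOff_two] at h0
    rw [← Units.val_inj]
    by_cases h2 : i + 1 + 1 = i
    · have O2 : ∀ (x y : Fin N → LaurentSeries R), bidiagonal x y (i + 1) i = y (i + 1) :=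
        fun x y => by have := O x y (i + 1); rwa [h2] at this
      have hd : -offDegree i ≠ offDegree (i + 1) := fun e => offDegree_ne h2 (by rw [← e, neg_neg])
      rw [h2, D, O2, laurentOff_neg_two] at h0
      simpa [single_mul_single, coeff_single_of_ne hd] using h0
    · have Z : ∀ (x y : Fin N → LaurentSeries R), bidiagonal x y (i + 1) i = 0 :=
        fun x y => by simp [bidiagonal_apply, (ne i).symm, Ne.symm h2]
      have Z' : ∀ (x y : Fin N → LaurentSeries R), bidiagonal x y i (i + 1 + 1) = 0 :=
        fun x y => by simp [bidiagonal_apply, h2, ne (i + 1)]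
      rw [Z, Z'] at h0
      simpa [single_mul_single] using h0

end Components

end

end Toda

namespace Toda

noncomputable section

/-! ### The discrete Toda equations -/

section TodaAlgebra

/-- The field is regrouped as `(A * B') * (A'⁻¹ * B)`, and each bracket is carried to the previous
time by one off-diagonal relation. -/
theorem toda_variable_eq {G : Type*} [Group G] {A B A' B' a b a' b' : G} (h1 : Commute B B')
    (h2 : Commute B A') (h3 : A⁻¹ * b = B' * a'⁻¹) (h4 : B * a = A' * b') :
    A * B * B' * A'⁻¹ = b * a' * b' * a⁻¹ := by
  have e1 : A * B' = b * a' := by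
    rw [inv_mul_eq_iff_eq_mul] at h3
    rw [h3]
    group
  have e2 : A'⁻¹ * B = b' * a⁻¹ := by rw [eq_mul_inv_iff_mul_eq, mul_assoc, h4]; group
  calc A * B * B' * A'⁻¹ = A * (B * B') * A'⁻¹ := by simp only [mul_assoc]
    _ = (A * B') * (B * A'⁻¹) := by rw [h1.eq]; simp only [mul_assoc]
    _ = (A * B') * (A'⁻¹ * B) := by rw [h2.inv_right.eq]
    _ = _ := by rw [e1, e2]; simp only [mul_assoc]

/-- The factor `Q` produced at one site is absorbed by the one produced at the other. -/
theorem toda_factors_comm {G : Type*} [Group G] {Q a b a' b' : G} (hQ : ∀ x, Commute Q x)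
    (h1 : a' * b' = Q * (b' * a')) (h2 : b * a = Q * (a * b)) (hbb : Commute b b')
    (haa : Commute a a') : b * a' * b' * a⁻¹ = b' * a⁻¹ * (b * a') := by
  have e : a⁻¹ * b = Q * (b * a⁻¹) := by
    calc a⁻¹ * b = a⁻¹ * (b * a) * a⁻¹ := by group
      _ = a⁻¹ * Q * a * b * a⁻¹ := by rw [h2]; simp only [mul_assoc]
      _ = Q * (b * a⁻¹) := by rw [← (hQ a⁻¹).eq]; group
  calc b * a' * b' * a⁻¹ = b * (a' * b') * a⁻¹ := by simp only [mul_assoc]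
    _ = (b * Q) * b' * (a' * a⁻¹) := by rw [h1]; simp only [mul_assoc]
    _ = Q * (b * b') * (a⁻¹ * a') := by rw [← (hQ b).eq, haa.inv_left.eq]; simp only [mul_assoc]
    _ = (Q * b') * (b * a⁻¹) * a' := by rw [hbb.eq]; simp only [mul_assoc]
    _ = b' * (Q * (b * a⁻¹)) * a' := by rw [(hQ b').eq]; simp only [mul_assoc]
    _ = _ := by rw [← e]; simp only [mul_assoc]

/-- The diagonal relation is multiplied by `A` on the left and by `a'` on the right. The four terms
become two pure products and their multiples by `x` and `y`, which assemble to `1 - x` and `1 - y`.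
-/
theorem toda_transport {R : Type*} [Ring R] {A A' a a' b b' B B' x y : Rˣ}
    (h : ((A⁻¹ * a : Rˣ) : R) + (B * b : Rˣ) = ((A' * a'⁻¹ : Rˣ) : R) + (B' * b' : Rˣ))
    (hx : x = A * B' * b' * a⁻¹) (hy : y = A'⁻¹ * B * b * a') :
    (1 - (x : R)) * (a * a' : Rˣ) = (A * A' : Rˣ) * (1 - (y : R)) := by
  have h1 := congrArg (fun u => (A : R) * u * (a' : R)) h
  simp only [mul_add, add_mul] at h1
  have e1 : (A : R) * ((A⁻¹ * a : Rˣ) : R) * a' = ((a * a' : Rˣ) : R) := by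
    rw [← Units.val_mul, ← Units.val_mul]; congr 1; group
  have e2 : (A : R) * ((A' * a'⁻¹ : Rˣ) : R) * a' = ((A * A' : Rˣ) : R) := by
    rw [← Units.val_mul, ← Units.val_mul]; congr 1; group
  have e3 : (A : R) * ((B * b : Rˣ) : R) * a' = ((A * A' : Rˣ) : R) * y := by
    rw [← Units.val_mul, ← Units.val_mul, ← Units.val_mul, hy]; congr 1; group
  have e4 : (A : R) * ((B' * b' : Rˣ) : R) * a' = (x : R) * ((a * a' : Rˣ) : R) := by
    rw [← Units.val_mul, ← Units.val_mul, ← Units.val_mul, hx]; congr 1; group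
  rw [e1, e2, e3, e4] at h1
  rw [sub_mul, one_mul, mul_sub, mul_one, sub_eq_sub_iff_add_eq_add, h1]

/-- Each of the pairs `b₁, a₁` and `b, a` contributes one `Q`. This is the origin of the q² in the
denominators of the Toda equations. -/
theorem todaLeft_comm {G : Type*} [Group G] {Q a₁ a a' b₁ b : G} (hQ : ∀ x, Commute Q x)
    (h₁ : b₁ * a₁ = Q * (a₁ * b₁)) (h : b * a = Q * (a * b)) (hab : Commute a b₁)
    (haa' : Commute a a') (ha₁a' : Commute a₁ a') (ha₁b : Commute a₁ b) (haa : Commute a₁ a) :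
    (b₁ * a' * b * a₁⁻¹) * (a₁ * a) = Q ^ 2 * (a₁ * a * (b₁ * a' * b * a₁⁻¹)) := by
  symm
  calc Q ^ 2 * (a₁ * a * (b₁ * a' * b * a₁⁻¹))
      = Q * (Q * (a₁ * (a * b₁) * a' * b * a₁⁻¹)) := by simp only [pow_two, mul_assoc]
    _ = Q * (Q * (a₁ * b₁) * (a * a') * b * a₁⁻¹) := by rw [hab.eq]; simp only [mul_assoc]
    _ = Q * (b₁ * a₁ * (a' * a) * b * a₁⁻¹) := by rw [h₁, haa'.eq]
    _ = Q * b₁ * (a₁ * a') * (a * b) * a₁⁻¹ := by simp only [mul_assoc]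
    _ = b₁ * Q * (a' * a₁) * (a * b) * a₁⁻¹ := by rw [ha₁a'.eq, (hQ b₁).eq]
    _ = b₁ * (Q * (a' * a₁)) * (a * b) * a₁⁻¹ := by simp only [mul_assoc]
    _ = b₁ * a' * a₁ * (Q * (a * b)) * a₁⁻¹ := by rw [(hQ (a' * a₁)).eq]; simp only [mul_assoc]
    _ = b₁ * a' * (a₁ * b) * (a * a₁⁻¹) := by rw [← h]; simp only [mul_assoc]
    _ = (b₁ * a' * b * a₁⁻¹) * (a₁ * a) := by
      rw [ha₁b.eq, haa.symm.inv_right.eq]; group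

theorem todaRight_comm {G : Type*} [Group G] {Q a₁ c₁ a' b₁ b : G} (hQ : ∀ x, Commute Q x)
    (h₁ : c₁ * b₁ = Q * (b₁ * c₁)) (h : a' * b = Q * (b * a')) (hab : Commute a' b₁)
    (hcb : Commute c₁ b) (hca : Commute c₁ a') (hac : Commute a₁ c₁) (haa : Commute a₁ a') :
    (c₁ * a') * (b₁ * a' * b * a₁⁻¹) = Q ^ 2 * ((b₁ * a' * b * a₁⁻¹) * (c₁ * a')) := by
  calc (c₁ * a') * (b₁ * a' * b * a₁⁻¹) = c₁ * (a' * b₁) * (a' * b) * a₁⁻¹ := by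
        simp only [mul_assoc]
    _ = (c₁ * b₁) * a' * (a' * b) * a₁⁻¹ := by rw [hab.eq]; simp only [mul_assoc]
    _ = Q * b₁ * (c₁ * a') * Q * (b * a') * a₁⁻¹ := by rw [h₁, h]; simp only [mul_assoc]
    _ = Q * (b₁ * (a' * c₁) * Q) * (b * a') * a₁⁻¹ := by rw [hca.eq]; simp only [mul_assoc]
    _ = Q ^ 2 * (b₁ * a' * (c₁ * b) * (a' * a₁⁻¹)) := by
      rw [← (hQ _).eq, pow_two]; simp only [mul_assoc]
    _ = Q ^ 2 * (b₁ * a' * b * (c₁ * a₁⁻¹) * a') := by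
      rw [hcb.eq, ← haa.inv_left.eq]; simp only [mul_assoc]
    _ = _ := by rw [← hac.inv_left.eq]; simp only [mul_assoc]

/-- Moving `U` to the right past `q² x` turns it into `x`, so `U (1 - q² x) = (1 - x) U`; the
transport relation then applies. -/
theorem toda_left_factor {R : Type*} [Ring R] {Q U V W x y : Rˣ} (hQ : ∀ z, Commute Q z)
    (h : x * U = Q ^ 2 * (U * x)) (h' : (1 - (x : R)) * (U : R) = V * (1 - (y : R))) :
    ((Q⁻¹ * W * U : Rˣ) : R) * (1 - (Q : R) ^ 2 * x) =
      ((Q⁻¹ * (W * V) : Rˣ) : R) * (1 - (y : R)) := by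
  have e : U * (Q ^ 2 * x) = x * U := by
    rw [h, ← mul_assoc, ← ((hQ U).pow_left 2).eq, mul_assoc]
  have e' : (U : R) * ((Q : R) ^ 2 * x) = x * U := congrArg Units.val e
  rw [Units.val_mul, mul_assoc, mul_sub, mul_one, e']
  rw [sub_mul, one_mul] at h'
  rw [h']
  simp only [Units.val_mul, mul_assoc]

/-- The same mechanism for the inverse of `U`, with the transport relation read backwards. -/
theorem toda_right_factor {R : Type*} [Ring R] {Q U V W x y : Rˣ}
    (h : U * x = Q ^ 2 * (x * U)) (h' : (1 - (y : R)) * (U : R) = V * (1 - (x : R))) :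
    ((W * U⁻¹ : Rˣ) : R) * (1 - (Q : R) ^ 2 * x) = ((W * V⁻¹ : Rˣ) : R) * (1 - (y : R)) := by
  have e : U⁻¹ * (Q ^ 2 * x) = x * U⁻¹ := by
    rw [eq_mul_inv_iff_mul_eq, mul_assoc, mul_assoc, inv_mul_eq_iff_eq_mul, h]
  have e' : ((U⁻¹ : Rˣ) : R) * ((Q : R) ^ 2 * x) = x * (U⁻¹ : Rˣ) := congrArg Units.val e
  have e2 : ((1 : R) - x) * (U⁻¹ : Rˣ) = (V⁻¹ : Rˣ) * (1 - (y : R)) := by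
    rw [Units.mul_inv_eq_iff_eq_mul, mul_assoc, h', Units.inv_mul_cancel_left]
  rw [sub_mul, one_mul] at e2
  rw [Units.val_mul, mul_assoc, mul_sub, mul_one, e', e2, Units.val_mul, mul_assoc]

/-- The `Q` from reordering `xb`, `xa` cancels `Q⁻¹`; the two from moving `uc` through `ub` and `ub`
through `ua` give `Q ^ 2`. -/
theorem toda_monomial {G : Type*} [Group G] {Q xa xb ya yb yc ua ub uc v : G}
    (hQ : ∀ x, Commute Q x) (hx : xb * xa = Q * (xa * xb)) (hu : uc * ub = Q * (ub * uc))
    (hu' : ub * ua = Q * (ua * ub)) (huu : Commute uc ua) (hyy : Commute ya yc)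
    (hXya : Commute (xa * xb) ya) (hXyb : Commute (xa * xb) yb) (hXyc : Commute (xa * xb) yc)
    (hXub : Commute (xa * xb) ub) (hXuc : Commute (xa * xb) uc) (hyu : Commute yc ub)
    (hyu' : Commute yc uc) (hv : Commute v uc) :
    (yb * uc * ub * ya⁻¹) * (Q⁻¹ * (yc⁻¹ * xb * (xa * ya))) * (ua * v * uc⁻¹) =
      Q ^ 2 * (xa * xb * yb * yc⁻¹ * (ua * ub * v)) := by
  have e1 : yc⁻¹ * xb * (xa * ya) = Q * (ya * yc⁻¹ * (xa * xb)) := by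
    calc yc⁻¹ * xb * (xa * ya) = yc⁻¹ * (xb * xa) * ya := by simp only [mul_assoc]
      _ = yc⁻¹ * Q * ((xa * xb) * ya) := by rw [hx]; simp only [mul_assoc]
      _ = Q * (yc⁻¹ * ya) * (xa * xb) := by rw [hXya.eq, ← (hQ _).eq]; simp only [mul_assoc]
      _ = _ := by rw [← hyy.inv_right.eq]; simp only [mul_assoc]
  rw [e1, inv_mul_cancel_left]
  generalize xa * xb = X at *
  have e2 : uc * ub * ua * uc⁻¹ = Q ^ 2 * (ua * ub) := by
    calc uc * ub * ua * uc⁻¹ = Q * (ub * (uc * ua) * uc⁻¹) := by rw [hu]; simp only [mul_assoc]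
      _ = Q * (ub * ua) := by rw [huu.eq]; group
      _ = _ := by rw [hu', pow_two]; simp only [mul_assoc]
  calc yb * uc * ub * ya⁻¹ * (ya * yc⁻¹ * X) * (ua * v * uc⁻¹)
      = yb * uc * (ub * yc⁻¹) * X * ua * (v * uc⁻¹) := by group
    _ = yb * (uc * yc⁻¹) * (ub * X) * ua * uc⁻¹ * v := by
        rw [← hyu.inv_left.eq, hv.inv_right.eq]; simp only [mul_assoc]
    _ = yb * yc⁻¹ * (uc * X) * ub * ua * uc⁻¹ * v := by
        rw [← hyu'.inv_left.eq, ← hXub.eq]; simp only [mul_assoc]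
    _ = yb * (yc⁻¹ * X) * (uc * ub * ua * uc⁻¹) * v := by
        rw [← hXuc.eq]; simp only [mul_assoc]
    _ = (yb * X) * yc⁻¹ * Q ^ 2 * (ua * ub) * v := by
        rw [← hXyc.inv_right.eq, e2]; simp only [mul_assoc]
    _ = Q ^ 2 * (X * yb * yc⁻¹) * (ua * ub) * v := by
        rw [← hXyb.eq, ← ((hQ _).pow_left 2).eq]
    _ = _ := by simp only [mul_assoc]

end TodaAlgebra

/-! ### The Toda fields as operators and their one-step evolution -/

section Operators

variable {q : ℂˣ} {N L : ℕ} [NeZero N] {B : Type*} [Ring B] [Algebra ℂ B]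

/-- The operator `a_i(n, t)`. -/
def opA (ρ : ℤ → (Aq q N L →ₐ[ℂ] B)) (t : ℤ) (i : Fin N) (n : ZMod (2 * L)) : Bˣ :=
  Units.map (ρ t : Aq q N L →* B) (a q N L i n)

/-- The operator `b_i(n, t)`. -/
def opB (ρ : ℤ → (Aq q N L →ₐ[ℂ] B)) (t : ℤ) (i : Fin N) (n : ZMod (2 * L)) : Bˣ :=
  Units.map (ρ t : Aq q N L →* B) (b q N L i n)

/-- The Toda variable `χ_i(n, t)` as an operator. -/
def opChi (ρ : ℤ → (Aq q N L →ₐ[ℂ] B)) (t : ℤ) (i : Fin N) (n : ZMod (2 * L)) : Bˣ :=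
  opA ρ t i (n + 1) * opB ρ t i (n + 1) * opB ρ t i n * (opA ρ t (i + 1) n)⁻¹

variable (B) in
/-- `q` as an element of a `ℂ`-algebra. -/
def centralUnit (q : ℂˣ) : Bˣ := Units.map (algebraMap ℂ B : ℂ →* B) q

variable (ρ : ℤ → (Aq q N L →ₐ[ℂ] B)) (t : ℤ)

theorem opChi_eq (i : Fin N) (n : ZMod (2 * L)) : (opChi ρ t i n : B) = ρ t (chi q N L i n) := by
  rw [opChi, opA, opB, opB, opA, ← map_inv, ← map_mul, ← map_mul, ← map_mul]
  rfl

theorem commute_map {x y : (Aq q N L)ˣ} (h : Commute (x : Aq q N L) y) :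
    Commute (Units.map (ρ t : Aq q N L →* B) x) (Units.map (ρ t : Aq q N L →* B) y) := by
  have h' : Commute x y := Units.ext h
  exact h'.map _

theorem opA_opA (i j : Fin N) (n m : ZMod (2 * L)) : Commute (opA ρ t i n) (opA ρ t j m) := by
  refine commute_map ρ t ?_
  by_cases h : n = m
  · subst h
    exact (siteRel_gen q N L n).weyl.aa i j
  · exact (sitesCommute_gen q N L h).aa i j

theorem opB_opB (i j : Fin N) (n m : ZMod (2 * L)) : Commute (opB ρ t i n) (opB ρ t j m) := by
  refine commute_map ρ t ?_
  by_cases h : n = m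
  · subst h
    exact (siteRel_gen q N L n).bb i j
  · exact (sitesCommute_gen q N L h).bb i j

theorem opA_opB {n m : ZMod (2 * L)} (h : n ≠ m) (i j : Fin N) :
    Commute (opA ρ t i n) (opB ρ t j m) :=
  commute_map ρ t ((sitesCommute_gen q N L h).ab i j)

theorem centralUnit_commute (x : Bˣ) : Commute (centralUnit B q) x :=
  Units.ext (Algebra.commutes _ _)

theorem opA_succ_opB (i : Fin N) (n : ZMod (2 * L)) :
    opA ρ t (i + 1) n * opB ρ t i n = centralUnit B q * (opB ρ t i n * opA ρ t (i + 1) n) := by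
  have := congrArg (ρ t) ((siteRel_gen q N L n).weyl.succ i)
  rw [map_smul, map_mul, map_mul, Algebra.smul_def] at this
  exact Units.ext this

theorem opB_opA (i : Fin N) (n : ZMod (2 * L)) :
    opB ρ t i n * opA ρ t i n = centralUnit B q * (opA ρ t i n * opB ρ t i n) := by
  have := congrArg (ρ t) ((siteRel_gen q N L n).weyl.same i)
  rw [map_smul, map_mul, map_mul, Algebra.smul_def] at this
  have h2 : opA ρ t i n * opB ρ t i n =
      (centralUnit B q)⁻¹ * (opB ρ t i n * opA ρ t i n) := by
    rw [centralUnit, ← map_inv]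
    exact Units.ext this
  rw [h2, mul_inv_cancel_left]

variable {ρ} (h : ZeroCurvature ρ) (hN : 2 ≤ N) {t} {n : ZMod (2 * L)}
  (hn : Odd (((n + 1).val : ℤ) + t))
include h hN hn

theorem ZeroCurvature.components (i : Fin N) :
    (((opA ρ (t + 1) i (n + 1))⁻¹ * opA ρ t i (n + 1) : Bˣ) : B) +
        (opB ρ (t + 1) (i - 1) (n + 1) * opB ρ t (i - 1) (n + 1) : Bˣ) =
      ((opA ρ (t + 1) i n * (opA ρ t i n)⁻¹ : Bˣ) : B) +
        (opB ρ (t + 1) i n * opB ρ t i n : Bˣ) ∧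
    (opA ρ (t + 1) i (n + 1))⁻¹ * opB ρ t i (n + 1) =
      opB ρ (t + 1) i n * (opA ρ t (i + 1) n)⁻¹ ∧
    opB ρ (t + 1) i (n + 1) * opA ρ t i (n + 1) = opA ρ (t + 1) (i + 1) n * opB ρ t i n := by
  have := h t (n + 1) hn
  rw [add_sub_cancel_right] at this
  exact zeroCurvature_components hN this i

theorem ZeroCurvature.opChi_succ [NeZero L] (i : Fin N) : opChi ρ (t + 1) i n =
    opB ρ t i (n + 1) * opA ρ t (i + 1) n * opB ρ t i n * (opA ρ t i (n + 1))⁻¹ := by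
  obtain ⟨-, h2, h3⟩ := h.components hN hn i
  exact toda_variable_eq (opB_opB ρ (t + 1) i i (n + 1) n)
    (opA_opB ρ (t + 1) (ne_add_one n) (i + 1) i).symm h2 h3

/-- The diagonal zero curvature relation, rewritten in Toda fields: the fields with indices `i` and
`i - 1` appear because the diagonal entry contains both `b_i` and `b_{i-1}`. -/
theorem ZeroCurvature.opChi_transport [NeZero L] (i : Fin N) :
    (1 - (opChi ρ (t + 1) i n : B)) * (opA ρ t i (n + 1) * opA ρ t i n : Bˣ) =
      (opA ρ (t + 1) i (n + 1) * opA ρ (t + 1) i n : Bˣ) *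
        (1 - (opChi ρ (t + 1) (i - 1) n : B)) := by
  obtain ⟨h1, h2, h3⟩ := h.components hN hn i
  obtain ⟨-, -, h4⟩ := h.components hN hn (i - 1)
  have hx := h.opChi_succ hN hn i
  have hy := h.opChi_succ hN hn (i - 1)
  rw [sub_add_cancel] at h4 hy
  refine toda_transport h1 ?_ ?_
  · rw [hx, inv_mul_eq_iff_eq_mul.1 h2]
    group
  · have h5 := opA_succ_opB ρ t (i - 1) n
    rw [sub_add_cancel] at h5
    rw [hy, toda_factors_comm (centralUnit_commute (q := q)) h5 (opB_opA ρ t (i - 1) (n + 1))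
      (opB_opB ρ t _ _ _ _) (opA_opA ρ t _ _ _ _)]
    have e : opB ρ t (i - 1) n * (opA ρ t (i - 1) (n + 1))⁻¹ =
        (opA ρ (t + 1) i n)⁻¹ * opB ρ (t + 1) (i - 1) (n + 1) := by
      rw [mul_inv_eq_iff_eq_mul, mul_assoc, h4]
      group
    rw [e]
    group

/-- The left half of a field at time t absorbs one denominator and leaves a monomial at time t+1
together with a numerator of index `i - 1`. -/
theorem ZeroCurvature.left_factor [NeZero L] (i : Fin N) :
    ((opA ρ t i n * opB ρ t i n : Bˣ) : B) *
        (1 - (centralUnit B q : B) ^ 2 * (opChi ρ (t + 1) i n : B)) =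
      (((centralUnit B q)⁻¹ * ((opA ρ (t + 1) (i + 1) n)⁻¹ * opB ρ (t + 1) i (n + 1) *
          (opA ρ (t + 1) i (n + 1) * opA ρ (t + 1) i n)) : Bˣ) : B) *
        (1 - (opChi ρ (t + 1) (i - 1) n : B)) := by
  have hQ := centralUnit_commute (q := q) (B := B)
  obtain ⟨-, -, h3⟩ := h.components hN hn i
  have h4 := h.opChi_transport hN hn i
  have h5 := todaLeft_comm hQ (opB_opA ρ t i (n + 1)) (opB_opA ρ t i n)
    (opA_opB ρ t (ne_add_one n) i i) (opA_opA ρ t i (i + 1) n n) (opA_opA ρ t i (i + 1) (n + 1) n)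
    (opA_opB ρ t (ne_add_one n).symm i i) (opA_opA ρ t i i (n + 1) n)
  rw [← h.opChi_succ hN hn i] at h5
  have h6 : opA ρ t i n * opB ρ t i n = (centralUnit B q)⁻¹ * ((opA ρ (t + 1) (i + 1) n)⁻¹ *
      opB ρ (t + 1) i (n + 1)) * (opA ρ t i (n + 1) * opA ρ t i n) := by
    have e : opB ρ t i n = (opA ρ (t + 1) (i + 1) n)⁻¹ * opB ρ (t + 1) i (n + 1) *
        opA ρ t i (n + 1) := by rw [mul_assoc, h3]; group
    have e' := opB_opA ρ t i n
    rw [← inv_mul_eq_iff_eq_mul] at e'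
    rw [← e', e]
    group
  rw [h6]
  exact toda_left_factor hQ h5 h4

/-- The right half of a field at time t absorbs the other denominator; transport at `i + 1`, read
backwards, produces the numerator of index `i + 1`. -/
theorem ZeroCurvature.right_factor [NeZero L] (i : Fin N) :
    ((opB ρ t i (n + 1) * (opA ρ t (i + 1) (n + 1))⁻¹ : Bˣ) : B) *
        (1 - (centralUnit B q : B) ^ 2 * (opChi ρ (t + 1) i n : B)) =
      ((opA ρ (t + 1) i (n + 1) * opB ρ (t + 1) i n *
          (opA ρ (t + 1) (i + 1) (n + 1) * opA ρ (t + 1) (i + 1) n)⁻¹ : Bˣ) : B) *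
        (1 - (opChi ρ (t + 1) (i + 1) n : B)) := by
  have hQ := centralUnit_commute (q := q) (B := B)
  obtain ⟨-, h2, -⟩ := h.components hN hn i
  have h4 := h.opChi_transport hN hn (i + 1)
  rw [add_sub_cancel_right] at h4
  have h5 := todaRight_comm hQ (opA_succ_opB ρ t i (n + 1)) (opA_succ_opB ρ t i n)
    (opA_opB ρ t (ne_add_one n) (i + 1) i) (opA_opB ρ t (ne_add_one n).symm (i + 1) i)
    (opA_opA ρ t (i + 1) (i + 1) (n + 1) n) (opA_opA ρ t i (i + 1) (n + 1) (n + 1))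
    (opA_opA ρ t i (i + 1) (n + 1) n)
  rw [← h.opChi_succ hN hn i] at h5
  have h6 : opB ρ t i (n + 1) * (opA ρ t (i + 1) (n + 1))⁻¹ = opA ρ (t + 1) i (n + 1) *
      opB ρ (t + 1) i n * (opA ρ t (i + 1) (n + 1) * opA ρ t (i + 1) n)⁻¹ := by
    rw [inv_mul_eq_iff_eq_mul.1 h2]
    group
  rw [h6]
  exact toda_right_factor h5 h4

end Operators

end

end Toda

namespace Toda

noncomputable section

theorem odd_val_succ {L : ℕ} [NeZero L] (n : ZMod (2 * L)) (t : ℤ) :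
    Odd (((n + 1).val : ℤ) + t) ↔ Odd ((n.val : ℤ) + (t + 1)) := by
  have hL := NeZero.ne L
  have : NeZero (2 * L) := ⟨by omega⟩
  have e : n + 1 = (((n.val : ℤ) + 1 : ℤ) : ZMod (2 * L)) := by
    push_cast
    rw [ZMod.natCast_zmod_val]
  rw [e, odd_val_intCast, add_assoc, add_comm 1 t]

/-- The halves `F` and `S` meet their denominators after `S` has been moved past the first one. The
resulting monomials are collected by moving `M'` past the first numerator. -/
theorem toda_recombine {R : Type*} [Ring R] {Q X F S χ₂ χ₀ M M' : Rˣ} {y y' : R}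
    (hQ : ∀ z, Commute Q z) (hS : Commute S χ₂)
    (hF : (F : R) * (1 - (Q : R) ^ 2 * χ₂) = M * (1 - y))
    (hS' : (S : R) * (1 - (Q : R) ^ 2 * χ₀) = M' * (1 - y')) (hy : Commute (M' : R) y)
    (hX : X * M * M' = Q ^ 2 * (χ₂ * χ₀)) :
    ((Q ^ (-2 : ℤ) : Rˣ) : R) * (X * (F * S)) *
        ((1 - (Q : R) ^ 2 * χ₂) * (1 - (Q : R) ^ 2 * χ₀)) =
      χ₂ * χ₀ * ((1 - y) * (1 - y')) := by
  have h1 : Commute (S : R) (1 - (Q : R) ^ 2 * χ₂) := by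
    refine (Commute.one_right _).sub_right (Commute.mul_right ?_ ?_)
    · exact Commute.pow_right (congrArg Units.val (hQ S).symm.eq) 2
    · exact congrArg Units.val hS.eq
  have h2 : Commute (M' : R) (1 - y) := (Commute.one_right _).sub_right hy
  have h3 : ((Q ^ (-2 : ℤ) : Rˣ) : R) * (X * M * M') = χ₂ * χ₀ := by
    simp only [← Units.val_mul]
    have e : Q ^ (-2 : ℤ) * (Q ^ 2 * (χ₂ * χ₀)) = χ₂ * χ₀ := by group
    rw [hX, e]
  calc ((Q ^ (-2 : ℤ) : Rˣ) : R) * (X * (F * S)) *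
        ((1 - (Q : R) ^ 2 * χ₂) * (1 - (Q : R) ^ 2 * χ₀))
      = (Q ^ (-2 : ℤ) : Rˣ) * X * F * (S * (1 - (Q : R) ^ 2 * χ₂)) *
          (1 - (Q : R) ^ 2 * χ₀) := by simp only [mul_assoc]
    _ = (Q ^ (-2 : ℤ) : Rˣ) * X * (F * (1 - (Q : R) ^ 2 * χ₂)) *
          (S * (1 - (Q : R) ^ 2 * χ₀)) := by rw [h1.eq]; simp only [mul_assoc]
    _ = (Q ^ (-2 : ℤ) : Rˣ) * X * M * ((1 - y) * M') * (1 - y') := by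
        rw [hF, hS']; simp only [mul_assoc]
    _ = ((Q ^ (-2 : ℤ) : Rˣ) * (X * M * M')) * ((1 - y) * (1 - y')) := by
        rw [← h2.eq]; simp only [mul_assoc]
    _ = _ := by rw [h3]

section Operators

variable {q : ℂˣ} {N L : ℕ} [NeZero N] [NeZero L] {B : Type*} [Ring B] [Algebra ℂ B]
  {ρ : ℤ → (Aq q N L →ₐ[ℂ] B)}

/-- The earliest field is split into halves at the sites `p + 2` and `p + 1`, and the latest one is
written in operators at the middle time. After both denominators are absorbed, everything lives at
time `s + 1` and `toda_monomial` finishes. -/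
theorem ZeroCurvature.opChi_toda (h : ZeroCurvature ρ) (hN : 2 ≤ N) (hL : 2 ≤ L) {s : ℤ}
    {p : ZMod (2 * L)} (hp : Odd (((p + 1).val : ℤ) + s)) (i : Fin N) :
    ((centralUnit B q ^ (-2 : ℤ) : Bˣ) : B) *
        ((opChi ρ (s + 1 + 1) i (p + 1) : B) * opChi ρ s i (p + 1)) *
        ((1 - (centralUnit B q : B) ^ 2 * opChi ρ (s + 1) i (p + 1 + 1)) *
          (1 - (centralUnit B q : B) ^ 2 * opChi ρ (s + 1) i p)) =
      opChi ρ (s + 1) i (p + 1 + 1) * opChi ρ (s + 1) i p *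
        ((1 - (opChi ρ (s + 1) (i - 1) (p + 1 + 1) : B)) *
          (1 - (opChi ρ (s + 1) (i + 1) p : B))) := by
  have hp1 : Odd (((p + 1 + 1).val : ℤ) + (s + 1)) := by
    rw [odd_val_succ, show s + 1 + 1 = s + 2 by ring, ← add_assoc]
    exact hp.add_even even_two
  have hp2 : Odd (((p + 1 + 1 + 1).val : ℤ) + s) := by
    rw [odd_val_succ]
    exact hp1
  have n1 := fun n : ZMod (2 * L) => ne_add_one n
  -- The four sites `p, …, p + 3` are involved; they are distinct because 2L ≥ 4.
  have n2 : ∀ n : ZMod (2 * L), n ≠ n + 1 + 1 := fun n e =>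
    natCast_ne_of_lt (k := 2) (by omega) (by omega) n (by push_cast; linear_combination -e)
  have n3 : ∀ n : ZMod (2 * L), n ≠ n + 1 + 1 + 1 := fun n e =>
    natCast_ne_of_lt (k := 3) (by omega) (by omega) n (by push_cast; linear_combination -e)
  have hQ := centralUnit_commute (q := q) (B := B)
  have hF := h.left_factor hN hp2 i
  have hS := h.right_factor hN hp i
  have e : (opChi ρ s i (p + 1) : B) = (opA ρ s i (p + 1 + 1) * opB ρ s i (p + 1 + 1) : Bˣ) *
      (opB ρ s i (p + 1) * (opA ρ s (i + 1) (p + 1))⁻¹ : Bˣ) := by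
    rw [← Units.val_mul, opChi]
    simp only [mul_assoc]
  rw [e]
  refine toda_recombine hQ ?_ hF hS ?_ ?_
  · rw [h.opChi_succ hN hp2 i]
    have b1 : ∀ m, p + 1 ≠ m → ∀ j, Commute (opB ρ s i (p + 1) * (opA ρ s (i + 1) (p + 1))⁻¹)
        (opA ρ s j m) := fun m hm j =>
      ((opA_opB ρ s hm.symm j i).symm).mul_left (opA_opA ρ s _ _ _ _).inv_left
    have b2 : ∀ m, p + 1 ≠ m → ∀ j, Commute (opB ρ s i (p + 1) * (opA ρ s (i + 1) (p + 1))⁻¹)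
        (opB ρ s j m) := fun m hm j =>
      (opB_opB ρ s _ _ _ _).mul_left (opA_opB ρ s hm _ _).inv_left
    exact (((b2 _ (n2 _) _).mul_right (b1 _ (n1 _) _)).mul_right (b2 _ (n1 _) _)).mul_right
      (b1 _ (n2 _) _).inv_right
  · have b1 : ∀ m, p ≠ m → p + 1 ≠ m → ∀ j, Commute (opA ρ (s + 1) i (p + 1) * opB ρ (s + 1) i p *
        (opA ρ (s + 1) (i + 1) (p + 1) * opA ρ (s + 1) (i + 1) p)⁻¹) (opA ρ (s + 1) j m) :=
      fun m hm hm' j => ((opA_opA _ _ _ _ _ _).mul_left (opA_opB _ _ hm.symm _ _).symm).mul_left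
        ((opA_opA _ _ _ _ _ _).mul_left (opA_opA _ _ _ _ _ _)).inv_left
    have b2 : ∀ m, p ≠ m → p + 1 ≠ m → ∀ j, Commute (opA ρ (s + 1) i (p + 1) * opB ρ (s + 1) i p *
        (opA ρ (s + 1) (i + 1) (p + 1) * opA ρ (s + 1) (i + 1) p)⁻¹) (opB ρ (s + 1) j m) :=
      fun m hm hm' j => ((opA_opB _ _ hm' _ _).mul_left (opB_opB _ _ _ _ _ _)).mul_left
        ((opA_opB _ _ hm' _ _).mul_left (opA_opB _ _ hm _ _)).inv_left
    refine congrArg Units.val (Commute.eq ?_)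
    exact (((b1 _ (n3 _) (n2 _) _).mul_right (b2 _ (n3 _) (n2 _) _)).mul_right
      (b2 _ (n2 _) (n1 _) _)).mul_right (b1 _ (n2 _) (n1 _) _).inv_right
  · rw [h.opChi_succ hN hp1 i, mul_inv_rev]
    -- `v` is the part of the field at `p` that lives at the site `p`; it is common to both sides.
    have key := toda_monomial (v := opB ρ (s + 1) i p * (opA ρ (s + 1) (i + 1) p)⁻¹) hQ
      (opB_opA ρ (s + 1) i (p + 1 + 1 + 1))
      (opA_succ_opB ρ (s + 1) i (p + 1)) (opB_opA ρ (s + 1) i (p + 1))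
      (opA_opA ρ (s + 1) (i + 1) i (p + 1) (p + 1))
      (opA_opA ρ (s + 1) i (i + 1) (p + 1 + 1) (p + 1 + 1))
      ((opA_opA _ _ _ _ _ _).mul_left (opA_opB _ _ (n1 _) _ _).symm)
      ((opA_opB _ _ (n1 _).symm _ _).mul_left (opB_opB _ _ i i _ (p + 1 + 1)))
      ((opA_opA _ _ _ _ _ _).mul_left (opA_opB _ _ (n1 _) _ _).symm)
      ((opA_opB _ _ (n2 _).symm _ _).mul_left (opB_opB _ _ _ _ _ _))
      ((opA_opA _ _ _ _ _ _).mul_left (opA_opB _ _ (n2 _) _ _).symm)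
      (opA_opB _ _ (n1 _).symm _ _) (opA_opA _ _ _ _ _ _)
      ((opA_opB _ _ (n1 _).symm _ _).symm.mul_left (opA_opA _ _ _ _ _ _).inv_left)
    simp only [opChi]
    simp only [mul_assoc] at key ⊢
    exact key

end Operators

/-! ### Descent to the gauge invariant evolution -/

section Evolution

universe u

variable {q : ℂˣ} {N L : ℕ} [NeZero N] [NeZero L] {A : Type u} [Ring A] [Algebra ℂ A]
  {Φ : ∀ t : ℤ, Ainv q N L t →ₐ[ℂ] A}

/-- The larger algebra contains the target algebra injectively, so the equation may be verified
there, where the fields factor into operators that are not gauge invariant. -/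
theorem IsEvolution.todaEquation (h : IsEvolution Φ) (hN : 2 ≤ N) (hL : 2 ≤ L) :
    TodaEquation (todaField Φ) q := by
  obtain ⟨B, _, _, j, ρ, hj, hρ, hΦ⟩ := h
  intro i n t hn
  obtain ⟨p, rfl⟩ : ∃ p, n = p + 1 := ⟨n - 1, (sub_add_cancel n 1).symm⟩
  obtain ⟨s, rfl⟩ : ∃ s, t = s + 1 := ⟨t - 1, (sub_add_cancel t 1).symm⟩
  have hp : Odd (((p + 1).val : ℤ) + s) := by
    rw [← add_assoc] at hn
    exact (Int.even_add_one.1 hn) |> Int.not_even_iff_odd.1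
  have field : ∀ {i : Fin N} {n : ZMod (2 * L)} {t : ℤ}, Odd ((n.val : ℤ) + t) →
      j (todaField Φ i n t) = opChi ρ t i n := by
    intro i n t hn
    rw [todaField, dif_pos hn, hΦ, opChi_eq]
  have h0 : Odd ((p.val : ℤ) + (s + 1)) := (odd_val_succ p s).1 hp
  have h1 : Odd (((p + 1).val : ℤ) + (s + 1 + 1)) := by
    rw [show s + 1 + 1 = s + 2 by ring, ← add_assoc]
    exact hp.add_even even_two
  have h2 : Odd (((p + 1 + 1).val : ℤ) + (s + 1)) := (odd_val_succ _ _).2 h1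
  apply hj
  have key := hρ.opChi_toda hN hL hp i
  have e2 : ∀ x : B, (q : ℂ) ^ 2 • x = (centralUnit B q : B) ^ 2 * x := by
    intro x
    rw [Algebra.smul_def, map_pow]
    rfl
  have e3 : ∀ x : B, ((q ^ (-2 : ℤ) : ℂˣ) : ℂ) • x = ((centralUnit B q ^ (-2 : ℤ) : Bˣ) : B) * x := by
    intro x
    rw [Algebra.smul_def, centralUnit, ← map_zpow]
    rfl
  simp only [add_sub_cancel_right, map_mul, map_sub, map_one, map_smul]
  rw [field h1, field hp, field h2, field h0, field h2, field h0, e2, e2, e3]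
  exact key

theorem IsEvolution.transfer_conserved (h : IsEvolution Φ) (hN : 2 ≤ N) (l : ℕ)
    (hinv : ∀ t k : ℤ, (transfer q N L l t).coeff k ∈ Ainv q N L t) (s t k : ℤ) :
    Φ s ⟨(transfer q N L l s).coeff k, hinv s k⟩ = Φ t ⟨(transfer q N L l t).coeff k, hinv t k⟩ := by
  obtain ⟨B, _, _, j, ρ, hj, hρ, hΦ⟩ := h
  apply hj
  rw [hΦ, hΦ]
  have key : ∀ t : ℤ, laurentMap (ρ t) (transfer q N L l t) =
      laurentMap (ρ 0) (transfer q N L l 0) := by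
    intro t
    induction t using Int.induction_on with
    | zero => rfl
    | succ i ih => rw [← hρ.transfer_succ hN, ih]
    | pred i ih =>
      have := hρ.transfer_succ (l := l) hN (-(i : ℤ) - 1)
      rw [sub_add_cancel] at this
      rw [this, ih]
  exact congrArg (fun x : LaurentSeries B => x.coeff k) ((key s).trans (key t).symm)

end Evolution

end

end Toda

theorem mainTheorem5 (q : ℂˣ) (N L : ℕ) [NeZero N] [NeZero L] :
    -- fusion: the operators `L^{ω_l,±}_n(z)` are the restrictions to `V(ω_l)`, `L^{ω_l,-}_n(z)⁻¹` exists
    (∀ l : ℕ, 1 ≤ l → l < N → ∀ n : ZMod (2 * L),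
      Toda.tensorPlus q l (fun i => Toda.a q N L i n) (fun i => Toda.b q N L i n) *
          Toda.qAntisymSeries q N (Toda.Aq q N L) l =
        Toda.qAntisymSeries q N (Toda.Aq q N L) l *
          Toda.fusedPlus q l (fun i => Toda.a q N L i n) (fun i => Toda.b q N L i n) ∧
      Toda.tensorMinus q l (fun i => Toda.a q N L i n) (fun i => Toda.b q N L i n) *
          Toda.qAntisymSeries q N (Toda.Aq q N L) l =
        Toda.qAntisymSeries q N (Toda.Aq q N L) l *
          Toda.fusedMinus q l (fun i => Toda.a q N L i n) (fun i => Toda.b q N L i n) ∧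
      IsUnit (Toda.fusedMinus q l (fun i => Toda.a q N L i n) (fun i => Toda.b q N L i n))) ∧
    -- gauge invariance
    ∃ hinv : ∀ (l : ℕ), 1 ≤ l → l < N → ∀ (t k : ℤ),
        (Toda.transfer q N L l t).coeff k ∈ Toda.Ainv q N L t,
      -- commutativity
      (∀ l l' : ℕ, 1 ≤ l → l < N → 1 ≤ l' → l' < N → ∀ t k k' : ℤ,
        Commute ((Toda.transfer q N L l t).coeff k) ((Toda.transfer q N L l' t).coeff k')) ∧
      -- conservation under the discrete Toda evolution
      (∀ (A : Type*) [Ring A] [Algebra ℂ A] (Φ : ∀ t : ℤ, Toda.Ainv q N L t →ₐ[ℂ] A),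
        Toda.IsEvolution Φ →
          (2 ≤ N → 2 ≤ L → Toda.TodaEquation (Toda.todaField Φ) q) ∧
          ∀ (l : ℕ) (h₁ : 1 ≤ l) (h₂ : l < N) (s t k : ℤ),
            Φ s ⟨(Toda.transfer q N L l s).coeff k, hinv l h₁ h₂ s k⟩ =
              Φ t ⟨(Toda.transfer q N L l t).coeff k, hinv l h₁ h₂ t k⟩) := by
  refine ⟨fun l h1 h2 n => ?_, fun l h1 h2 t k => Toda.transfer_coeff_mem (by omega) l t k,
    fun l l' h1 h2 _ _ t k k' => Toda.transfer_coeff_commute (by omega) l l' t k k',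
    fun A _ _ Φ hΦ => ⟨fun hN hL => hΦ.todaEquation hN hL,
      fun l h1 h2 s t k => hΦ.transfer_conserved (by omega) l _ s t k⟩⟩
  have h := Toda.siteRel_gen q N L n
  -- The existence of some l with 1 ≤ l < N excludes the degenerate case N = 1, in which diagonal
  -- and off-diagonal entries of the L-operators coincide.
  have hN : 2 ≤ N := by omega
  exact ⟨h.tensorPlus_mul hN, h.tensorMinus_mul hN, h.isUnit_fusedMinus hN⟩
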